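/- **Setting.** Let $N=4^m$ and $P=\sqrt N=2^m$. The concurrent practical partition O-RAM stores $N$ blocks of $B$ bits in $P$ server partitions, each of capacity $S=\sqrt N+\varepsilon$ real blocks, where the surplus $\varepsilon=\varepsilon(N)$ satisfies $\varepsilon=o(\sqrt N)$ and $N^{1/4}\sqrt{\log N}=o(\varepsilon)$. A partition has levels $0,\dots,m$; level $\ell<m$ occupies $2\cdot2^\ell$ server blocks and the top level $2\sqrt N+2\varepsilon$ (twice its nominal number of real blocks, the rest being dummy blocks). The client keeps one cache slot per partition, a position map (partition, level, offset of each block), a counter $C_p\in\mathbb Z_S$ per partition, and a FIFO queue $Q$ of jobs. *Requests.* On a request for block $u$: pick a uniformly random partition $r$, let $p$ be the current partition of $u$ and reassign $u$ to $r$; read $u$ from partition $p$ (or do a dummy read of $p$ if $u$ is in cache slot $p$); put $u$ into slot $r$; evict once from slot $p$ (piggy-backed eviction); then evict from the next $k$ slots in cyclic order, where $\Pr[k]\propto q^k$ for $0\le k\le c_{\max}$, with fixed $c_{\max}\ge1$ and $0<q<1$. An eviction from a slot writes one of its blocks (a dummy block if it is empty) to its partition. Every partition read and every partition write is one time step of the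 amortizer. *Amortizer.* A write of a block (or dummy) to $p$ puts a job $(p,\lambda,\beta)$ at the tail of $Q$, where $\lambda\le m$ is the largest $i$ with $2^i\mid C_p$ and $\beta$ holds the block; if $Q$ already has a job $(p,\lambda',\beta')$, it is replaced by the merged job $(p,\max(\lambda,\lambda'),\beta\cup\beta')$ at the tail. Then $C_p$ is incremented. In each time step a total of $w\log_2N$ blocks is transferred (fewer only if there are no jobs left), first by the read of that step, if any, and then by jobs taken from the head of $Q$, one after another; jobs can be paused. A job fetches from each filled level $\ell\le\lambda$ its unread real blocks, together with unread dummy blocks up to the nominal number $2^\ell$ of blocks ($\sqrt N+\varepsilon$ for the top level), as far as available; these levels become unfilled, and the real blocks fetched together with $\beta$, padded with dummies, are written into level $\lambda$. A read of $p$ reads at most one block from each filled level: the requested block from the level that contains it; from another level the next unread dummy block, or, if a queued job or the job in progress covers that level, a random block among those not yet read (nothing if there is none). Blocks read at random from a level covered by a queued job are cached with that job. A requested block found in a pending job or in the shuffling buffer is taken from there, and a requested block is removed from where it was. *Initialization.* Each block is in an independent uniformly random partition, in its top level; the set of filled levels below the top of each partition is uniformly random, with $C_p$ set so that the next job goes up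 to the first unfilled level. The slots and $Q$ are empty. *Measures.* The cost of a request is the number of blocks transferred during its time steps. Client storage counts all blocks held by the client (cache slots, pending writes, cached reads including dummies, shuffling buffer) and all index data (position map, read/unread bits, counters, queue data, and a key of $\kappa$ bits per level). Server storage counts the space reserved for all levels. **Theorem (practical concurrent construction).** For all $c_{\max}\ge 1$, $0<q<1$ and $\varepsilon$ as above there is $w_0$ such that for every integer $w\ge w_0$ there is a constant $C$ with the following property. For all $k,a\in\mathbb N$ there is a constant $K$ such that for all sufficiently large $N=4^m$, every request sequence of length $M\le N^k$ fixed in advance, and all $B\ge1$ and $\kappa\ge 0$, with probability at least $1-N^{-a}$: 1. every request costs at most $C\log_2N$ (worst-case cost); 2. the total cost of all requests is at most $C\,M\log_2N$ (amortized cost); 3. after every time step, the scheduled but unfinished reshuffling work is at most $K\sqrt N\log_2N$; 4. after every time step, the client storage is at most $cN$ blocks (that is, $cNB$ bits), where $$c=\frac{2\log_2N+K}{B}+\frac{K}{\sqrt N}\Bigl(1+\frac{\kappa\log_2N}{B}\Bigr);$$ 5. after every time step, the server storage is at most $CN$ blocks; moreover no level outgrows the space reserved for it and no partition holds more than $\sqrt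 N+\varepsilon$ real blocks on the server. -/

import Mathlib

open Filter Asymptotics
open scoped NNReal ENNReal

/-! The concurrent practical partition O-RAM, as a randomized state machine.

The capacity is `N = 4 ^ m` blocks, kept in `√N = 2 ^ m` partitions with levels `0, …, m`
(so `m = log₂ √N`).  All costs and storage sizes count blocks (or bits) and never depend on the
contents of a block, on whether a request is a read or a write, or on the pseudo-random offset at
which a block is stored inside its level.  Hence a block is represented by its identifier, a request
by the identifier that is accessed, and a level by the set of its unread real blocks together with
the number of its unread dummy blocks. -/

namespace PartitionORAM

/-- Parameters of the construction.
* `m`: there are `N = 4 ^ m` blocks and `2 ^ m` partitions;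
* `surplus`: the surplus `ε`, so a partition has capacity `√N + ε` real blocks;
* `maxEvict`, `ratio`: a request is followed by `k` sequential background evictions with probability
  proportional to `ratio ^ k`, for `0 ≤ k ≤ maxEvict`;
* `workRate`: the constant `w`; the amortizer performs `w * log₂ N` work per time step. -/
structure Params where
  m : ℕ
  surplus : ℕ
  maxEvict : ℕ
  ratio : ℝ≥0
  workRate : ℕ

/-- Identifiers of the `N = 4 ^ m` blocks. -/
abbrev Block (P : Params) : Type := Fin (4 ^ P.m)

/-- The `√N = 2 ^ m` partitions; each of them also has one cache slot on the client. -/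
abbrev Part (P : Params) : Type := Fin (2 ^ P.m)

/-- The levels `0, …, m` of a partition. -/
abbrev Lvl (P : Params) : Type := Fin (P.m + 1)

/-- The largest number of real blocks a partition is designed for, `√N + ε`. -/
def Params.capacity (P : Params) : ℕ := 2 ^ P.m + P.surplus

/-- The nominal number of real blocks of level `ℓ`: `2 ^ ℓ`, and `√N + ε` for the top level. -/
def half (P : Params) (l : Lvl P) : ℕ := if (l : ℕ) = P.m then P.capacity else 2 ^ (l : ℕ)

/-- The number of blocks (real and dummy) that level `ℓ` occupies on the server. -/
def slots (P : Params) (l : Lvl P) : ℕ := 2 * half P l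

/-- The number of blocks that all levels of one partition occupy on the server. -/
def partitionSlots (P : Params) : ℕ := ∑ l : Lvl P, slots P l

/-- `w * log₂ N`, the work of the amortizer in one time step. -/
def Params.budget (P : Params) : ℕ := P.workRate * (2 * P.m)

/-- One level of one partition on the server: whether it is filled, its unread real blocks, the
number of its unread dummy blocks, and the number of blocks written when it was last built. -/
structure Level (P : Params) where
  filled : Bool
  real : Finset (Block P)
  dummies : ℕ
  size : ℕ

/-- An unfilled level. -/
def Level.empty (P : Params) : Level P := ⟨false, ∅, 0, 0⟩

/-- A level freshly built from the real blocks `b`, padded with dummy blocks. -/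
def Level.build (P : Params) (l : Lvl P) (b : Finset (Block P)) : Level P :=
  ⟨true, b, slots P l - b.card, max (slots P l) b.card⟩

/-- A queued job `(p, λ, β)`: reshuffle levels `0, …, λ` of partition `p` and write the blocks `β`.
Real blocks that concurrent reads fetch from these levels while the job waits are cached in `β`;
`cachedDummies` counts the dummy blocks fetched in that way. -/
structure Job (P : Params) where
  part : Part P
  top : Lvl P
  blocks : Finset (Block P)
  cachedDummies : ℕ

/-- The job that is being performed.
* `job.blocks` holds the real blocks of the shuffling buffer (fetched or still to be fetched);
* `availReal ℓ`, `availDummy ℓ` describe the set `S'` of level `ℓ`: the blocks chosen to be fetched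
  from level `ℓ` that no concurrent read has read since the job began;
* `fetch ℓ` is the number of blocks still to be fetched from level `ℓ`;
* `upload` is the number of blocks still to be written. -/
structure CurrentJob (P : Params) where
  job : Job P
  availReal : Lvl P → Finset (Block P)
  availDummy : Lvl P → ℕ
  fetch : Lvl P → ℕ
  upload : ℕ

/-- The joint state of client and server.
* `position`: the position map (partition part);
* `slot`: the cache slots of the client;
* `level`: the levels of the partitions on the server;
* `counter`: the partition counters `C_p`;
* `queue`: the job queue `Q`, head first;
* `current`: the job in progress, if any;
* `scan`: the global counter of the sequential eviction;
* `work`: the blocks transferred since the beginning of the present request. -/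
structure State (P : Params) where
  position : Block P → Part P
  slot : Part P → List (Block P)
  level : Part P → Lvl P → Level P
  counter : Part P → ℕ
  queue : List (Job P)
  current : Option (CurrentJob P)
  scan : Part P
  work : ℕ

variable {P : Params}

/-! ### Concurrent reads -/

/-- A uniformly random unread block among `real` and `d` dummy blocks, `none` if there is none. -/
noncomputable def pickUnread (real : Finset (Block P)) (d : ℕ) : PMF (Option (Block P ⊕ ℕ)) :=
  if h : (real.disjSum (Finset.range d)).Nonempty then
    (PMF.uniformOfFinset (real.disjSum (Finset.range d)) h).map some
  else PMF.pure none

/-- Replace level `l` of partition `p`. -/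
def State.setLevel (s : State P) (p : Part P) (l : Lvl P) (v : Level P) : State P :=
  { s with level := Function.update s.level p (Function.update (s.level p) l v) }

/-- Count one transferred block. -/
def State.charge (s : State P) : State P := { s with work := s.work + 1 }

/-- The access of a concurrent read to a level that the job in progress is reshuffling: the target
if it is in `S'`, otherwise a random block of `S'`, and nothing if `S'` is empty. -/
noncomputable def readInJob (target : Option (Block P)) (l : Lvl P) (c : CurrentJob P)
    (s : State P) : PMF (State P) :=
  if ∃ u ∈ target, u ∈ c.availReal l then PMF.pure s.charge
  else do
    let x ← pickUnread (c.availReal l) (c.availDummy l)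
    match x with
    | none => PMF.pure s
    | some (Sum.inl b) =>
      PMF.pure { s.charge with
        current := some { c with
          availReal := Function.update c.availReal l ((c.availReal l).erase b) } }
    | some (Sum.inr _) =>
      PMF.pure { s.charge with
        current := some { c with
          availDummy := Function.update c.availDummy l (c.availDummy l - 1) } }

/-- The access of a concurrent read to a level that does not contain the target and that a queued
job is going to reshuffle: a random unread block, which is cached with that job. -/
noncomputable def readCached (p : Part P) (l : Lvl P) (s : State P) : PMF (State P) := do
  let v := s.level p l
  let x ← pickUnread v.real v.dummies
  match x with
  | none => PMF.pure s
  | some (Sum.inl b) =>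
    PMF.pure { (s.setLevel p l { v with real := v.real.erase b }).charge with
      queue := s.queue.map fun j =>
        if j.part = p then { j with blocks := insert b j.blocks } else j }
  | some (Sum.inr _) =>
    PMF.pure { (s.setLevel p l { v with dummies := v.dummies - 1 }).charge with
      queue := s.queue.map fun j =>
        if j.part = p then { j with cachedDummies := j.cachedDummies + 1 } else j }

/-- The access of a concurrent read to a level that is not being reshuffled and does not contain
the target: the next unread dummy block. -/
def readDummy (p : Part P) (l : Lvl P) (s : State P) : State P :=
  if 0 < (s.level p l).dummies then
    (s.setLevel p l { s.level p l with dummies := (s.level p l).dummies - 1 }).charge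
  else s

/-- The access of a concurrent read of partition `p` to level `l`. -/
noncomputable def readLevel (p : Part P) (target : Option (Block P)) (s : State P) (l : Lvl P) :
    PMF (State P) :=
  if (s.level p l).filled = false then PMF.pure s
  else
    match s.current.filter (fun c => c.job.part = p ∧ l ≤ c.job.top) with
    | some c => readInJob target l c s
    | none =>
      if ∃ u ∈ target, u ∈ (s.level p l).real then PMF.pure s.charge
      else if ∃ j ∈ s.queue, j.part = p ∧ l ≤ j.top then readCached p l s
      else PMF.pure (readDummy p l s)

/-- Once a block has been read it is logically removed from its partition, from the blocks of the
pending job of that partition, and from the shuffling buffer. -/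
def State.remove (p : Part P) (u : Block P) (s : State P) : State P :=
  { s with
    level := Function.update s.level p fun l =>
      { s.level p l with real := (s.level p l).real.erase u }
    queue := s.queue.map fun j =>
      if j.part = p then { j with blocks := j.blocks.erase u } else j
    current := s.current.map fun c =>
      if c.job.part = p then
        { c with
          job := { c.job with blocks := c.job.blocks.erase u }
          availReal := fun l => (c.availReal l).erase u }
      else c }

/-- The concurrent read of `target` (`none` for a dummy read) from partition `p`: at most one block
is read from each filled level. -/
noncomputable def cReadPartition (p : Part P) (target : Option (Block P)) (s : State P) :
    PMF (State P) := do
  let t ← (List.finRange (P.m + 1)).foldlM (readLevel p target) s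
  match target with
  | none => PMF.pure t
  | some u => PMF.pure (t.remove p u)

/-! ### Concurrent writes and the job queue -/

/-- Levels of the job's partition from which everything has been fetched become unfilled. -/
def State.sweep (c : CurrentJob P) (s : State P) : State P :=
  { s with
    level := Function.update s.level c.job.part fun l =>
      if l ≤ c.job.top ∧ c.fetch l = 0 then Level.empty P else s.level c.job.part l }

/-- Begin job `j`: from every filled level `ℓ ≤ λ`, all unread real blocks are to be fetched,
together with unread dummy blocks up to the nominal number `2 ^ ℓ` of blocks; the blocks `β` join
the shuffling buffer. -/
def State.start (j : Job P) (s : State P) : State P :=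
  let v := s.level j.part
  let real : Lvl P → Finset (Block P) := fun l =>
    if l ≤ j.top ∧ (v l).filled = true then (v l).real else ∅
  let dummy : Lvl P → ℕ := fun l =>
    if l ≤ j.top ∧ (v l).filled = true then min (half P l - (v l).real.card) (v l).dummies else 0
  let buffer : Finset (Block P) := j.blocks ∪ Finset.univ.biUnion real
  let c : CurrentJob P :=
    { job := { j with blocks := buffer }
      availReal := real
      availDummy := dummy
      fetch := fun l => (real l).card + dummy l
      upload := max (slots P j.top) buffer.card }
  ({ s with current := some c } : State P).sweep c

/-- Transfer one block of the job in progress: fetch a block from the lowest level from which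
something is left to be fetched, and otherwise write a block.  When the last block has been written,
level `λ` is filled with the shuffling buffer. -/
def State.advance (c : CurrentJob P) (s : State P) : State P :=
  match (List.finRange (P.m + 1)).find? (fun l => 0 < c.fetch l) with
  | some l =>
    let c' : CurrentJob P := { c with fetch := Function.update c.fetch l (c.fetch l - 1) }
    ({ s.charge with current := some c' } : State P).sweep c'
  | none =>
    if c.upload ≤ 1 then
      { (s.setLevel c.job.part c.job.top (Level.build P c.job.top c.job.blocks)).charge with
        current := none }
    else { s.charge with current := some { c with upload := c.upload - 1 } }

/-- One unit of work from the job queue; nothing happens if there is no job. -/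
def State.workUnit (s : State P) : State P :=
  match s.current with
  | some c => s.advance c
  | none =>
    match s.queue with
    | [] => s
    | j :: rest =>
      let t := ({ s with queue := rest } : State P).start j
      match t.current with
      | some c => t.advance c
      | none => t

/-- `n` units of work from the job queue. -/
def State.perform (n : ℕ) (s : State P) : State P := State.workUnit^[n] s

/-- The largest `i ≤ m` with `C = 0 mod 2 ^ i`. -/
def jobLevel (P : Params) (C : ℕ) : Lvl P :=
  ⟨Nat.findGreatest (fun i => 2 ^ i ∣ C) P.m,
    Nat.lt_succ_of_le (Nat.findGreatest_le P.m)⟩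

/-- Time step of the amortizer for a read; the read consumes part of the work of the step. -/
noncomputable def stepRead (p : Part P) (target : Option (Block P)) (s : State P) :
    PMF (State P) := do
  let t ← cReadPartition p target s
  PMF.pure (t.perform (P.budget - (t.work - s.work)))

/-- Add the job `(p, λ, β)` at the tail of the queue, merged with the queued job of `p`, if any. -/
def State.enqueue (p : Part P) (top : Lvl P) (blocks : Finset (Block P)) (s : State P) : State P :=
  match s.queue.find? (fun j => j.part = p) with
  | none => { s with queue := s.queue ++ [⟨p, top, blocks, 0⟩] }
  | some j =>
    { s with
      queue := s.queue.filter (fun j => j.part ≠ p) ++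
        [⟨p, max top j.top, j.blocks ∪ blocks, j.cachedDummies⟩] }

/-- Time step of the amortizer for the write of `b` (`none` for a dummy block) to partition `p`. -/
def stepWrite (p : Part P) (b : Option (Block P)) (s : State P) : State P :=
  let t := s.enqueue p (jobLevel P (s.counter p)) b.toFinset
  ({ t with
    counter := Function.update s.counter p ((s.counter p + 1) % P.capacity) } : State P).perform
      P.budget

/-! ### Evictions and requests -/

/-- Evict one block from cache slot `p`, or a dummy block if the slot is empty. -/
def evict (p : Part P) (s : State P) : State P :=
  match s.slot p with
  | [] => stepWrite p none s
  | b :: rest => stepWrite p (some b) { s with slot := Function.update s.slot p rest }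

/-- Sequential eviction from the next `n` slots: the states after each of the `n` time steps. -/
def seqEvict : ℕ → State P → List (State P)
  | 0, _ => []
  | n + 1, s =>
    let t := evict (finRotate (2 ^ P.m) s.scan) { s with scan := finRotate (2 ^ P.m) s.scan }
    t :: seqEvict n t

/-- The bounded geometric distribution: `k ≤ c` has probability proportional to `q ^ k`. -/
noncomputable def boundedGeometric (c : ℕ) (q : ℝ≥0) : PMF (Fin (c + 1)) :=
  PMF.normalize (fun k => (q : ℝ≥0∞) ^ (k : ℕ))
    (by
      intro h
      have h0 := (ENNReal.tsum_eq_zero.1 h) 0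
      simp at h0)
    (by
      rw [tsum_fintype]
      exact ENNReal.sum_ne_top.2 fun k _ => ENNReal.pow_ne_top ENNReal.coe_ne_top)

/-- One data request for block `u`: the partition `p` of `u` is read (by a dummy read if `u` is in
the cache), `u` is put into the cache slot of a fresh random partition, one block is evicted from
slot `p` (piggy-backed eviction), and a random number of sequential background evictions follow.
The result lists the states after the time steps of the request. -/
noncomputable def access (u : Block P) (s : State P) : PMF (List (State P)) := do
  let r ← PMF.uniformOfFintype (Part P)
  let p := s.position u
  let s₁ : State P := { s with position := Function.update s.position u r, work := 0 }
  let s₂ ←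
    if u ∈ s.slot p then
      stepRead p none { s₁ with slot := Function.update s.slot p ((s.slot p).erase u) }
    else stepRead p (some u) s₁
  let s₃ : State P := { s₂ with slot := Function.update s₂.slot r (s₂.slot r ++ [u]) }
  let s₄ := evict p s₃
  let num ← boundedGeometric P.maxEvict P.ratio
  PMF.pure (s₃ :: s₄ :: seqEvict num s₄)

/-- The initial state with block positions `pos`, in which level `ℓ < m` of partition `p` is filled
if and only if bit `ℓ` of `fill p` is one.  The top levels are filled and hold the real blocks.  The
counters are such that the next job of a partition goes up to its first unfilled level. -/
def initialState (P : Params) (pos : Block P → Part P) (fill : Part P → Fin (2 ^ P.m)) :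
    State P where
  position := pos
  slot := fun _ => []
  level := fun p l =>
    if (l : ℕ) = P.m then Level.build P l (Finset.univ.filter fun u => pos u = p)
    else if (fill p : ℕ).testBit l then Level.build P l ∅
    else Level.empty P
  counter := fun p => ((fill p : ℕ) + 1) % P.capacity
  queue := []
  current := none
  scan := ⟨0, Nat.two_pow_pos P.m⟩
  work := 0

/-- Perform the requests one after another; for each request, the states after its time steps. -/
noncomputable def run : List (Block P) → State P → PMF (List (List (State P)))
  | [], _ => PMF.pure []
  | u :: us, s => do
    let seg ← access u s
    let rest ← run us (seg.getLast?.getD s)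
    PMF.pure (seg :: rest)

/-- The execution on a request sequence, from uniformly random block positions and uniformly random
fillings of the partitions. -/
noncomputable def execution (P : Params) (requests : List (Block P)) :
    PMF (List (List (State P))) := do
  let pos ← PMF.uniformOfFintype (Block P → Part P)
  let fill ← PMF.uniformOfFintype (Part P → Fin (2 ^ P.m))
  run requests (initialState P pos fill)

/-! ### Cost and storage -/

/-- The cost of a request: the number of blocks transferred during all of its time steps. -/
def requestCost (seg : List (State P)) : ℕ := (seg.getLast?.map State.work).getD 0

/-- An upper bound for the work of a job that reshuffles levels `0, …, λ`. -/
def jobWork (P : Params) (top : Lvl P) : ℕ := ∑ l ∈ Finset.Iic top, slots P l + slots P top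

/-- The reshuffling work that has been scheduled but not yet performed. -/
def State.backlog (s : State P) : ℕ :=
  (s.queue.map fun j => jobWork P j.top).sum +
    (s.current.map fun c => (∑ l, c.fetch l) + c.upload).getD 0

/-- The number of blocks for which the client needs memory: the cache slots, the pending writes and
cached reads of all jobs, and the shuffling buffer, which has the size of a top level. -/
def State.clientBlocks (s : State P) : ℕ :=
  ∑ p, (s.slot p).length +
    (s.queue.map fun j => j.blocks.card + j.cachedDummies).sum +
    (s.current.map fun c => c.job.blocks.card + c.job.cachedDummies).getD 0 +
    slots P (Fin.last P.m)

/-- Client storage in bits, for blocks of `B` bits and level keys of `κ` bits: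
the blocks held by the client with their identifiers; the position map (partition, level and offset
of each block); one bit per block on the server telling whether it has been read; key, dummy
counter, and two flags (filled, never reshuffled) of each level; the partition counters; the
eviction counter; partition and level of each queued job; and partition, level, remaining work and
the sets `S'` of the job in progress. -/
def State.clientBits (B κ : ℕ) (s : State P) : ℕ :=
  s.clientBlocks * (B + Nat.clog 2 (4 ^ P.m)) +
    4 ^ P.m * (Nat.clog 2 (2 ^ P.m) + Nat.clog 2 (P.m + 1) +
      Nat.clog 2 (slots P (Fin.last P.m))) +
    2 ^ P.m * partitionSlots P +
    2 ^ P.m * (P.m + 1) * (κ + Nat.clog 2 (slots P (Fin.last P.m) + 1) + 2) +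
    2 ^ P.m * Nat.clog 2 P.capacity +
    Nat.clog 2 (2 ^ P.m) +
    s.queue.length * (Nat.clog 2 (2 ^ P.m) + Nat.clog 2 (P.m + 1)) +
    (Nat.clog 2 (2 ^ P.m) + Nat.clog 2 (P.m + 1) + Nat.clog 2 (2 * partitionSlots P + 1) +
      partitionSlots P)

/-- Server storage in blocks: the space reserved for every level, enlarged if the level was built
with more blocks than were reserved. -/
def State.serverBlocks (s : State P) : ℕ :=
  ∑ p, ∑ l, max (slots P l) (s.level p l).size

/-- The reserved layout suffices: no level is larger than the space reserved for it, and no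
partition holds more real blocks than its capacity. -/
def State.LayoutSuffices (s : State P) : Prop :=
  (∀ p l, (s.level p l).size ≤ slots P l) ∧
    ∀ p, ∑ l, (s.level p l).real.card ≤ P.capacity

end PartitionORAM

/-! The proof separates a deterministic statement about schedules from a probabilistic one. As the
requests are fixed in advance, the times at which partitions are read and written, and the levels of
all jobs, depend only on the initial positions, the new positions, the numbers of sequential
evictions and the initial fillings; these form a `Schedule`. The only other randomness is which
unread block a concurrent read picks, and it is irrelevant: if the schedule is `Schedule.Good`,
every execution in the support satisfies all bounds (`runFrom_initial`). By `execution_eq` the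
execution is a mixture over schedules, so it remains to bound the probability that a schedule is not
good (`execution_not_fine_le`, `failure_le`).

Deterministic part. Levels do not overflow because `C_p` works like a binary counter: a write that
carries beyond bit `i` schedules a job that empties the levels `0, …, i`, and any other write adds
at most one block there, so these levels hold at most as many real blocks as the counter modulo `2 ^
(i + 1)` (`Inv`). The remaining quantities are queues, followed by `Ghost`; time is counted in write
steps, as read steps never increase the scheduled work. (1) The backlog is a leaky bucket: it is at
most the work scheduled in some window minus the budget of that window. A bound `β ≤ budget * τ`
then makes every job of the FIFO queue wait less than `τ` write steps after its last merge. (2) A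
cache slot holds at most the arrivals minus the evictions in some window. (3) A job that merges `h`
writes comes from a window of at most `h * τ` write steps with `h` writes to one partition. Each
read of that partition is followed by a piggy-backed write to it, so the job caches at most `t + 1`
blocks per write, where `t` is its top level, and one of its writes has level at least `t`.

Probabilistic part. Each position is an independent uniform draw, and each draw is used by at most
one read (`prev_injOn`), since the block then moves to a fresh draw. Hence the numbers of
piggy-backed evictions are occupancy numbers of balls in boxes, with exponential moments dominated
by those of independent Poisson variables (`mean_prod_sum_exp_le`). One such moment per quantity
bounds whole sums over partitions: the squares of the merge numbers (`chain_sq_tail`) and the cache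
slots (`cache_tail`). `load_tail` keeps partitions below capacity; this is where the lower bound on
the surplus enters. The initial fillings randomize the phases of the counters, which limits how
often high levels are due in a window (`mean_exp_multCount_le`, `multCount_tail`) and hence the
scheduled work (`sched_le`) and the sizes of queued jobs (`sum_chain_le`).

The failure probability `N ^ (-a)` needs deviations `A * m` with `A` depending on `k` and `a`, while
`w₀` must not depend on them. Therefore the top `G` levels are treated with exponential tilt `G`
instead of `1`: this divides their deviation by `G` at the price of a factor `exp (2 * G)` in the
mean, which is a constant and is absorbed by `m` for large `m`. -/

namespace PartitionORAM
variable {P : Params}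

/-! ### The structural invariant -/

/-- The real blocks that the levels hold once the job in progress is completed. -/
def pendingReal (lv : Part P → Lvl P → Level P) (cur : Option (CurrentJob P)) (p : Part P)
    (l : Lvl P) : Finset (Block P) :=
  match cur with
  | none => (lv p l).real
  | some c =>
    if c.job.part = p ∧ l ≤ c.job.top then (if l = c.job.top then c.job.blocks else ∅)
    else (lv p l).real

/-- The number of real blocks in the levels `0, …, i` of `p` once the job in progress is
completed. -/
def pendingCount (lv : Part P → Lvl P → Level P) (cur : Option (CurrentJob P)) (p : Part P)
    (i : ℕ) : ℕ :=
  ∑ l ∈ Finset.univ.filter (fun l : Lvl P => (l : ℕ) ≤ i), (pendingReal lv cur p l).card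

/-- The structural invariant: the blocks of partition `p` lie in `A p`, every block is in one place,
and the number of blocks in the low levels is bounded in terms of the counter `g p` of the last
write. -/
structure Inv (A : Part P → Finset (Block P)) (g : Part P → ℕ) (lv : Part P → Lvl P → Level P)
    (Q : List (Job P)) (cur : Option (CurrentJob P)) : Prop where
  pend_sub : ∀ p l, pendingReal lv cur p l ⊆ A p
  real_sub : ∀ p l, (lv p l).real ⊆ A p
  queue_sub : ∀ j ∈ Q, j.blocks ⊆ A j.part
  pend_disj : ∀ p l l', l ≠ l' → Disjoint (pendingReal lv cur p l) (pendingReal lv cur p l')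
  real_disj : ∀ p l l', l ≠ l' → Disjoint (lv p l).real (lv p l').real
  queue_disj : ∀ j ∈ Q, ∀ l, Disjoint j.blocks (pendingReal lv cur j.part l)
  nodup : (Q.map Job.part).Nodup
  unfilled : ∀ p l, (lv p l).filled = false → (lv p l).real = ∅
  size_le : ∀ p l, (lv p l).size ≤ slots P l
  card_le : ∀ p l, (lv p l).real.card ≤ slots P l
  cur_card : ∀ c ∈ cur, c.job.blocks.card ≤ slots P c.job.top
  cur_upload : ∀ c ∈ cur, 1 ≤ c.upload
  cur_fetched : ∀ c ∈ cur, ∀ l ≤ c.job.top, c.fetch l = 0 → (lv c.job.part l).real = ∅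
  -- If no job of `p` is queued, the blocks counted were written since the counter last carried
  -- beyond bit `i`. With a queued job the bound includes the blocks of that job and is claimed only
  -- for `i` at or above its top, since lower levels are about to be emptied. The top level is left
  -- out; it is controlled by the capacity.
  count_none : ∀ p i, i < P.m → (∀ j ∈ Q, j.part ≠ p) → pendingCount lv cur p i ≤ g p % 2 ^ (i + 1)
  count_job : ∀ j ∈ Q, ∀ i, i < P.m → (j.top : ℕ) ≤ i →
    j.blocks.card + pendingCount lv cur j.part i ≤ g j.part % 2 ^ (i + 1)

variable {A A' : Part P → Finset (Block P)} {g : Part P → ℕ} {lv lv' : Part P → Lvl P → Level P}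
  {Q Q' : List (Job P)} {cur cur' : Option (CurrentJob P)}

theorem Inv.mono (h : Inv A g lv Q cur) (hA : ∀ p, A p ⊆ A' p) : Inv A' g lv Q cur :=
  { h with
    pend_sub := fun p l => (h.pend_sub p l).trans (hA p)
    real_sub := fun p l => (h.real_sub p l).trans (hA p)
    queue_sub := fun j hj => (h.queue_sub j hj).trans (hA _) }

/-- Two jobs of the same partition in the queue are equal. -/
theorem Inv.job_unique (h : Inv A g lv Q cur) {j j' : Job P} (hj : j ∈ Q) (hj' : j' ∈ Q)
    (hp : j.part = j'.part) : j = j' :=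
  List.inj_on_of_nodup_map h.nodup hj hj' hp

/-- The invariant does not depend on dummy blocks and on the sets `S'`. -/
theorem Inv.congr_real (h : Inv A g lv Q cur)
    (hlv : ∀ p l, (lv' p l).real = (lv p l).real ∧ (lv' p l).filled = (lv p l).filled ∧
      (lv' p l).size = (lv p l).size) : Inv A g lv' Q cur := by
  have hr : ∀ p l, (lv' p l).real = (lv p l).real := fun p l => (hlv p l).1
  have hp : ∀ p l, pendingReal lv' cur p l = pendingReal lv cur p l := by
    intro p l
    unfold pendingReal
    split <;> simp [hr]
  have hc : ∀ p i, pendingCount lv' cur p i = pendingCount lv cur p i := by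
    intro p i
    simp [pendingCount, hp]
  constructor
  · simpa [hp] using h.pend_sub
  · simpa [hr] using h.real_sub
  · exact h.queue_sub
  · simpa [hp] using h.pend_disj
  · simpa [hr] using h.real_disj
  · simpa [hp] using h.queue_disj
  · exact h.nodup
  · simpa [hr, fun p l => (hlv p l).2.1] using h.unfilled
  · simpa [fun p l => (hlv p l).2.2] using h.size_le
  · simpa [hr] using h.card_le
  · exact h.cur_card
  · exact h.cur_upload
  · simpa [hr] using h.cur_fetched
  · simpa [hc] using h.count_none
  · simpa [hc] using h.count_job

theorem Inv.congr_current {c c' : CurrentJob P} (h : Inv A g lv Q (some c))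
    (hj : c'.job = c.job) (hf : c'.fetch = c.fetch) (hu : 1 ≤ c'.upload) :
    Inv A g lv Q (some c') := by
  have hp : ∀ p l, pendingReal lv (some c') p l = pendingReal lv (some c) p l := by
    intro p l
    simp [pendingReal, hj]
  have hc : ∀ p i, pendingCount lv (some c') p i = pendingCount lv (some c) p i := by
    intro p i
    simp [pendingCount, hp]
  constructor
  · simpa [hp] using h.pend_sub
  · exact h.real_sub
  · exact h.queue_sub
  · simpa [hp] using h.pend_disj
  · exact h.real_disj
  · simpa [hp] using h.queue_disj
  · exact h.nodup
  · exact h.unfilled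
  · exact h.size_le
  · exact h.card_le
  · simpa [hj] using h.cur_card
  · simpa using hu
  · simpa [hj, hf] using h.cur_fetched
  · simpa [hc] using h.count_none
  · simpa [hc] using h.count_job

theorem setLevel_level (s : State P) (p q : Part P) (l i : Lvl P) (v : Level P) :
    (s.setLevel p l v).level q i = if q = p ∧ i = l then v else s.level q i := by
  unfold State.setLevel
  by_cases hq : q = p
  · subst hq
    by_cases hi : i = l
    · subst hi; simp
    · simp [hi]
  · simp [hq]

/-- The invariant when a real block of an uncovered level moves to the queued job of its
partition. -/
theorem Inv.moveToQueue (h : Inv A g lv Q cur) {p : Part P} {l : Lvl P} {b : Block P}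
    (hb : b ∈ (lv p l).real) (hcov : ∀ c ∈ cur, ¬ (c.job.part = p ∧ l ≤ c.job.top))
    {j₀ : Job P} (hj₀ : j₀ ∈ Q) (hp₀ : j₀.part = p) (hl₀ : l ≤ j₀.top)
    (hlv : ∀ q i, lv' q i = if q = p ∧ i = l then { lv p l with real := (lv p l).real.erase b }
      else lv q i) :
    Inv A g lv' (Q.map fun j => if j.part = p then { j with blocks := insert b j.blocks } else j)
      cur := by
  have hr : ∀ q i, (lv' q i).real = if q = p ∧ i = l then (lv p l).real.erase b
      else (lv q i).real := by
    intro q i; rw [hlv]; split <;> rfl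
  have hrsub : ∀ q i, (lv' q i).real ⊆ (lv q i).real := by
    intro q i; rw [hr]; split
    · rename_i hqi; rw [hqi.1, hqi.2]; exact Finset.erase_subset _ _
    · exact subset_rfl
  have hpl : pendingReal lv cur p l = (lv p l).real := by
    unfold pendingReal
    split
    · rfl
    · rename_i c; rw [if_neg (hcov c rfl)]
  have hpend : ∀ q i, pendingReal lv' cur q i =
      if q = p ∧ i = l then (pendingReal lv cur p l).erase b else pendingReal lv cur q i := by
    intro q i
    by_cases hqi : q = p ∧ i = l
    · rw [if_pos hqi, hpl]
      obtain ⟨rfl, rfl⟩ := hqi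
      unfold pendingReal
      split
      · simp [hr]
      · rename_i c; rw [if_neg (hcov c rfl)]; simp [hr]
    · rw [if_neg hqi]
      unfold pendingReal
      split <;> simp [hr, hqi]
  have hpsub : ∀ q i, pendingReal lv' cur q i ⊆ pendingReal lv cur q i := by
    intro q i; rw [hpend]; split
    · rename_i hqi; rw [hqi.1, hqi.2]; exact Finset.erase_subset _ _
    · exact subset_rfl
  have hbA : b ∈ A p := h.real_sub p l hb
  have hcle : ∀ q i, pendingCount lv' cur q i ≤ pendingCount lv cur q i := fun q i =>
    Finset.sum_le_sum fun x _ => Finset.card_le_card (hpsub q x)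
  have hclt : ∀ i : ℕ, (l : ℕ) ≤ i → pendingCount lv' cur p i + 1 ≤ pendingCount lv cur p i := by
    intro i hi
    apply Nat.succ_le_of_lt
    apply Finset.sum_lt_sum (fun x _ => Finset.card_le_card (hpsub p x))
    refine ⟨l, by simpa using hi, ?_⟩
    rw [hpend, if_pos ⟨rfl, rfl⟩]
    exact Finset.card_erase_lt_of_mem (hpl ▸ hb)
  have hmem : ∀ j ∈ Q.map (fun j => if j.part = p then { j with blocks := insert b j.blocks }
      else j), ∃ j' ∈ Q, j.part = j'.part ∧ j.top = j'.top ∧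
        (j'.part = p ∧ j.blocks = insert b j'.blocks ∨ j'.part ≠ p ∧ j.blocks = j'.blocks) := by
    intro j hj
    obtain ⟨j', hj', rfl⟩ := List.mem_map.1 hj
    refine ⟨j', hj', ?_⟩
    by_cases hp : j'.part = p <;> simp [hp]
  constructor
  · exact fun q i => (hpsub q i).trans (h.pend_sub q i)
  · exact fun q i => (hrsub q i).trans (h.real_sub q i)
  · intro j hj
    obtain ⟨j', hj', h1, h2, ⟨h3, h4⟩ | ⟨h3, h4⟩⟩ := hmem j hj
    · rw [h4, h1]
      exact Finset.insert_subset (h3 ▸ hbA) (h.queue_sub j' hj')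
    · rw [h4, h1]; exact h.queue_sub j' hj'
  · exact fun q i i' hne => (h.pend_disj q i i' hne).mono (hpsub q i) (hpsub q i')
  · exact fun q i i' hne => (h.real_disj q i i' hne).mono (hrsub q i) (hrsub q i')
  · intro j hj i
    obtain ⟨j', hj', h1, h2, ⟨h3, h4⟩ | ⟨h3, h4⟩⟩ := hmem j hj
    · rw [h4, h1, Finset.disjoint_insert_left]
      refine ⟨?_, (h.queue_disj j' hj' i).mono_right (hpsub _ i)⟩
      rw [h3, hpend]
      by_cases hi : i = l
      · simp [hi]
      · simp only [hi, and_false, if_false]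
        exact Finset.disjoint_left.1 (h.pend_disj p l i (Ne.symm hi)) (hpl ▸ hb)
    · rw [h4, h1]; exact (h.queue_disj j' hj' i).mono_right (hpsub _ i)
  · have : (Q.map (fun j => if j.part = p then { j with blocks := insert b j.blocks }
      else j)).map Job.part = Q.map Job.part := by
      rw [List.map_map]
      apply List.map_congr_left
      intro j _
      by_cases hp : j.part = p <;> simp [hp]
    rw [this]; exact h.nodup
  · intro q i hf
    have : (lv q i).filled = false := by
      rw [hlv] at hf
      split at hf
      · rename_i hqi; rw [hqi.1, hqi.2]; exact hf
      · exact hf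
    exact Finset.subset_empty.1 (h.unfilled q i this ▸ hrsub q i)
  · intro q i
    rw [hlv]; split
    · rename_i hqi; rw [hqi.2]; exact h.size_le p l
    · exact h.size_le q i
  · exact fun q i => (Finset.card_le_card (hrsub q i)).trans (h.card_le q i)
  · exact h.cur_card
  · exact h.cur_upload
  · intro c hc i hi hf
    exact Finset.subset_empty.1 (h.cur_fetched c hc i hi hf ▸ hrsub _ i)
  · intro q i hi hq
    refine (hcle q i).trans (h.count_none q i hi fun j hj => ?_)
    have := hq _ (List.mem_map.2 ⟨j, hj, rfl⟩)
    by_cases hp : j.part = p <;> simpa [hp] using this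
  -- The block moves from level `l` to the job. As `l ≤ top ≤ i`, the level count loses one while
  -- the job gains at most one, so the sum does not grow.
  · intro j hj i hi ht
    obtain ⟨j', hj', h1, h2, ⟨h3, h4⟩ | ⟨h3, h4⟩⟩ := hmem j hj
    · have hjj : j' = j₀ := h.job_unique hj' hj₀ (h3.trans hp₀.symm)
      have hli : (l : ℕ) ≤ i := by
        rw [h2, hjj] at ht
        exact le_trans (by exact_mod_cast hl₀) ht
      have e1 := h.count_job j' hj' i hi (h2 ▸ ht)
      have e2 := hclt i hli
      rw [h4, h1]
      have e3 := Finset.card_insert_le b j'.blocks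
      rw [h3] at e1 ⊢
      omega
    · rw [h4, h1]
      exact (Nat.add_le_add_left (hcle _ i) _).trans (h.count_job j' hj' i hi (h2 ▸ ht))

/-- The invariant when block `u` is removed from partition `p`. -/
theorem Inv.remove {s : State P} (h : Inv A g s.level s.queue s.current) (p : Part P)
    (u : Block P) :
    Inv (fun q => if q = p then (A q).erase u else A q) g (s.remove p u).level
      (s.remove p u).queue (s.remove p u).current := by
  set s' := s.remove p u with hs'
  have hr : ∀ q i, (s'.level q i).real = if q = p then (s.level q i).real.erase u
      else (s.level q i).real := by
    intro q i
    by_cases hq : q = p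
    · subst hq; simp [hs', State.remove]
    · simp [hs', State.remove, hq]
  have hff : ∀ q i, (s'.level q i).filled = (s.level q i).filled ∧
      (s'.level q i).size = (s.level q i).size := by
    intro q i
    by_cases hq : q = p
    · subst hq; simp [hs', State.remove]
    · simp [hs', State.remove, hq]
  have hpend : ∀ q i, pendingReal s'.level s'.current q i =
      if q = p then (pendingReal s.level s.current q i).erase u
      else pendingReal s.level s.current q i := by
    intro q i
    cases hc : s.current with
    | none =>
      have : s'.current = none := by simp [hs', State.remove, hc]
      simp [pendingReal, this, hr]
    | some c =>
      by_cases hcp : c.job.part = p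
      · have : s'.current = some { c with
          job := { c.job with blocks := c.job.blocks.erase u }
          availReal := fun l => (c.availReal l).erase u } := by
          simp [hs', State.remove, hc, hcp]
        by_cases hq : q = p
        · subst hq
          simp only [pendingReal, this, hr, if_true, hcp, true_and]
          split
          · split <;> simp
          · rfl
        · have hne : p ≠ q := Ne.symm hq
          simp [pendingReal, this, hr, hcp, hq, hne]
      · have : s'.current = some c := by simp [hs', State.remove, hc, hcp]
        by_cases hq : q = p
        · subst hq; simp [pendingReal, this, hr, hcp]
        · simp [pendingReal, this, hr, hq]
  have hpsub : ∀ q i, pendingReal s'.level s'.current q i ⊆ pendingReal s.level s.current q i := by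
    intro q i; rw [hpend]; split
    · exact Finset.erase_subset _ _
    · exact subset_rfl
  have hrsub : ∀ q i, (s'.level q i).real ⊆ (s.level q i).real := by
    intro q i; rw [hr]; split
    · exact Finset.erase_subset _ _
    · exact subset_rfl
  have hcle : ∀ q i, pendingCount s'.level s'.current q i ≤ pendingCount s.level s.current q i :=
    fun q i => Finset.sum_le_sum fun x _ => Finset.card_le_card (hpsub q x)
  have hmem : ∀ j ∈ s'.queue, ∃ j' ∈ s.queue, j.part = j'.part ∧ j.top = j'.top ∧
        (j'.part = p ∧ j.blocks = j'.blocks.erase u ∨ j'.part ≠ p ∧ j.blocks = j'.blocks) := by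
    intro j hj
    obtain ⟨j', hj', rfl⟩ := List.mem_map.1 hj
    refine ⟨j', hj', ?_⟩
    by_cases hp : j'.part = p <;> simp [hp]
  have hmem' : ∀ j ∈ s'.queue, ∃ j' ∈ s.queue, j.part = j'.part ∧ j.top = j'.top ∧
        j.blocks ⊆ j'.blocks := by
    intro j hj
    obtain ⟨j', hj', h1, h2, ⟨h3, h4⟩ | ⟨h3, h4⟩⟩ := hmem j hj
    · exact ⟨j', hj', h1, h2, h4 ▸ Finset.erase_subset _ _⟩
    · exact ⟨j', hj', h1, h2, h4 ▸ subset_rfl⟩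
  have hcur : ∀ c' ∈ s'.current, ∃ c ∈ s.current, c'.job.part = c.job.part ∧
      c'.job.top = c.job.top ∧ c'.job.blocks ⊆ c.job.blocks ∧ c'.fetch = c.fetch ∧
      c'.upload = c.upload := by
    intro c' hc'
    obtain ⟨c, hc, rfl⟩ := Option.mem_map.1 hc'
    refine ⟨c, hc, ?_⟩
    by_cases hp : c.job.part = p
    · simp only [hp, if_true, true_and, and_true]; exact Finset.erase_subset _ _
    · simp [hp]
  have herase : ∀ (q : Part P) (B : Finset (Block P)), B ⊆ A q → B.erase u ⊆ (A q).erase u :=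
    fun q B hB => Finset.erase_subset_erase u hB
  constructor
  · intro q i
    rw [hpend]
    split
    · exact herase q _ (h.pend_sub q i)
    · exact h.pend_sub q i
  · intro q i
    rw [hr]
    split
    · exact herase q _ (h.real_sub q i)
    · exact h.real_sub q i
  · intro j hj
    obtain ⟨j', hj', h1, h2, ⟨h3, h4⟩ | ⟨h3, h4⟩⟩ := hmem j hj
    · rw [h1, if_pos h3, h4]; exact herase _ _ (h.queue_sub j' hj')
    · rw [h1, if_neg h3, h4]; exact h.queue_sub j' hj'
  · exact fun q i i' hne => (h.pend_disj q i i' hne).mono (hpsub q i) (hpsub q i')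
  · exact fun q i i' hne => (h.real_disj q i i' hne).mono (hrsub q i) (hrsub q i')
  · intro j hj i
    obtain ⟨j', hj', h1, h2, h3⟩ := hmem' j hj
    rw [h1]
    exact (h.queue_disj j' hj' i).mono h3 (hpsub _ i)
  · have : s'.queue.map Job.part = s.queue.map Job.part := by
      simp only [hs', State.remove, List.map_map]
      apply List.map_congr_left
      intro j _
      by_cases hp : j.part = p <;> simp [hp]
    rw [this]; exact h.nodup
  · intro q i hf
    rw [(hff q i).1] at hf
    exact Finset.subset_empty.1 (h.unfilled q i hf ▸ hrsub q i)
  · intro q i; rw [(hff q i).2]; exact h.size_le q i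
  · exact fun q i => (Finset.card_le_card (hrsub q i)).trans (h.card_le q i)
  · intro c' hc'
    obtain ⟨c, hc, h1, h2, h3, h4, h5⟩ := hcur c' hc'
    rw [h2]
    exact (Finset.card_le_card h3).trans (h.cur_card c hc)
  · intro c' hc'
    obtain ⟨c, hc, h1, h2, h3, h4, h5⟩ := hcur c' hc'
    rw [h5]; exact h.cur_upload c hc
  · intro c' hc' i hi hf
    obtain ⟨c, hc, h1, h2, h3, h4, h5⟩ := hcur c' hc'
    rw [h1]
    exact Finset.subset_empty.1 (h.cur_fetched c hc i (h2 ▸ hi) (h4 ▸ hf) ▸ hrsub _ i)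
  · intro q i hi hq
    refine (hcle q i).trans (h.count_none q i hi fun j hj => ?_)
    have := hq _ (List.mem_map.2 ⟨j, hj, rfl⟩)
    by_cases hp : j.part = p <;> simpa [hp] using this
  · intro j hj i hi ht
    obtain ⟨j', hj', h1, h2, h3⟩ := hmem' j hj
    rw [h1]
    exact (Nat.add_le_add (Finset.card_le_card h3) (hcle _ i)).trans
      (h.count_job j' hj' i hi (h2 ▸ ht))

end PartitionORAM

/-! ### Scheduling, beginning and performing jobs preserves the structural invariant. -/

namespace PartitionORAM
variable {P : Params}
variable {A A' : Part P → Finset (Block P)} {g : Part P → ℕ} {lv lv' : Part P → Lvl P → Level P}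
  {Q Q' : List (Job P)} {cur cur' : Option (CurrentJob P)}

theorem le_jobLevel_iff {C i : ℕ} (hi : i ≤ P.m) : i ≤ (jobLevel P C : ℕ) ↔ 2 ^ i ∣ C := by
  constructor
  · intro h
    have h0 : 2 ^ (Nat.findGreatest (fun i => 2 ^ i ∣ C) P.m) ∣ C :=
      Nat.findGreatest_spec (P := fun i => 2 ^ i ∣ C) (Nat.zero_le P.m) (by simp)
    exact (pow_dvd_pow 2 h).trans h0
  · exact fun h => Nat.le_findGreatest hi h

/-- If the counter wraps around at `S`, its new value is `0`, which every `d` divides. So a value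
not divisible by `d` comes from a plain increment without carry. This is why a capacity that is not
a power of two does no harm. -/
theorem succ_mod_of_not_dvd {S a C d : ℕ} (ha : a < S) (hC : C = (a + 1) % S) (hd : ¬ d ∣ C) :
    C % d = a % d + 1 := by
  have h1 : a + 1 ≠ S := by
    rintro rfl
    simp [hC] at hd
  have h2 : C = a + 1 := by rw [hC, Nat.mod_eq_of_lt (by omega)]
  rw [h2] at hd ⊢
  rw [Nat.add_mod]
  have hd1 : d ≠ 1 := by rintro rfl; simp at hd
  rcases Nat.eq_zero_or_pos d with rfl | hpos
  · simp
  · have h3 : a % d + 1 ≠ d := by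
      intro h
      apply hd
      apply Nat.dvd_of_mod_eq_zero
      rw [Nat.add_mod, Nat.mod_eq_of_lt (show 1 < d by omega), h, Nat.mod_self]
    have := Nat.mod_lt a hpos
    rw [Nat.mod_eq_of_lt (show 1 < d by omega), Nat.mod_eq_of_lt (by omega)]

/-- The queue after a job of `p` has been added. -/
theorem enqueue_queue (s : State P) (p : Part P) (top : Lvl P) (B : Finset (Block P)) :
    ∃ J : Job P, (s.enqueue p top B).queue = s.queue.filter (fun j => j.part ≠ p) ++ [J] ∧
      J.part = p ∧
      (((∀ j ∈ s.queue, j.part ≠ p) ∧ J.top = top ∧ J.blocks = B ∧ J.cachedDummies = 0) ∨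
        ∃ j ∈ s.queue, j.part = p ∧ J.top = max top j.top ∧ J.blocks = j.blocks ∪ B ∧
          J.cachedDummies = j.cachedDummies) := by
  unfold State.enqueue
  cases hf : s.queue.find? (fun j => j.part = p) with
  | none =>
    have h0 : ∀ j ∈ s.queue, j.part ≠ p := by simpa using hf
    refine ⟨⟨p, top, B, 0⟩, ?_, rfl, Or.inl ⟨h0, rfl, rfl, rfl⟩⟩
    rw [List.filter_eq_self.2]
    simpa using h0
  | some j =>
    have h1 := List.mem_of_find?_eq_some hf
    have h2 : j.part = p := by simpa using List.find?_some hf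
    exact ⟨_, rfl, rfl, Or.inr ⟨j, h1, h2, rfl, rfl, rfl⟩⟩

@[simp] theorem enqueue_level (s : State P) (p : Part P) (top : Lvl P) (B : Finset (Block P)) :
    (s.enqueue p top B).level = s.level := by
  unfold State.enqueue; split <;> rfl

@[simp] theorem enqueue_current (s : State P) (p : Part P) (top : Lvl P) (B : Finset (Block P)) :
    (s.enqueue p top B).current = s.current := by
  unfold State.enqueue; split <;> rfl

@[simp] theorem enqueue_work (s : State P) (p : Part P) (top : Lvl P) (B : Finset (Block P)) :
    (s.enqueue p top B).work = s.work := by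
  unfold State.enqueue; split <;> rfl

@[simp] theorem enqueue_slot (s : State P) (p : Part P) (top : Lvl P) (B : Finset (Block P)) :
    (s.enqueue p top B).slot = s.slot := by
  unfold State.enqueue; split <;> rfl

@[simp] theorem enqueue_position (s : State P) (p : Part P) (top : Lvl P)
    (B : Finset (Block P)) : (s.enqueue p top B).position = s.position := by
  unfold State.enqueue; split <;> rfl

@[simp] theorem enqueue_scan (s : State P) (p : Part P) (top : Lvl P)
    (B : Finset (Block P)) : (s.enqueue p top B).scan = s.scan := by
  unfold State.enqueue; split <;> rfl

/-- The invariant when a write to `p` is scheduled. -/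
theorem Inv.enqueue {s : State P} (h : Inv A g s.level s.queue s.current) (p : Part P)
    (b : Option (Block P)) (hb : ∀ v ∈ b, v ∉ A p) (hg : g p < P.capacity)
    (hC : s.counter p = (g p + 1) % P.capacity) (hA : ∀ q, A q ⊆ A' q) (hbA : ∀ v ∈ b, v ∈ A' p) :
    Inv A' (Function.update g p (s.counter p)) s.level
      (s.enqueue p (jobLevel P (s.counter p)) b.toFinset).queue s.current := by
  obtain ⟨J, hQ, hJp, hJ⟩ := enqueue_queue s p (jobLevel P (s.counter p)) b.toFinset
  rw [hQ]
  have hbc : b.toFinset.card ≤ 1 := by cases b <;> simp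
  have hbsub : b.toFinset ⊆ A' p := fun v hv => hbA v (by simpa using hv)
  have hbd : ∀ l, Disjoint b.toFinset (pendingReal s.level s.current p l) := by
    intro l
    rw [Finset.disjoint_left]
    intro v hv hv'
    exact hb v (by simpa using hv) (h.pend_sub p l hv')
  have hJsub : J.blocks ⊆ A' p := by
    rcases hJ with ⟨_, _, h2, _⟩ | ⟨j, hj, h1, _, h2, _⟩
    · rw [h2]; exact hbsub
    · rw [h2]; exact Finset.union_subset ((h.queue_sub j hj).trans (h1 ▸ hA _)) hbsub
  have hJd : ∀ l, Disjoint J.blocks (pendingReal s.level s.current p l) := by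
    intro l
    rcases hJ with ⟨_, _, h2, _⟩ | ⟨j, hj, h1, _, h2, _⟩
    · rw [h2]; exact hbd l
    · rw [h2]; exact Finset.disjoint_union_left.2 ⟨h1 ▸ h.queue_disj j hj l, hbd l⟩
  have hmem : ∀ j ∈ s.queue.filter (fun j => j.part ≠ p) ++ [J],
      (j ∈ s.queue ∧ j.part ≠ p) ∨ j = J := by
    intro j hj
    simpa using hj
  constructor
  · exact fun q l => (h.pend_sub q l).trans (hA q)
  · exact fun q l => (h.real_sub q l).trans (hA q)
  · intro j hj
    rcases hmem j hj with ⟨h1, _⟩ | rfl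
    · exact (h.queue_sub j h1).trans (hA _)
    · rw [hJp]; exact hJsub
  · exact h.pend_disj
  · exact h.real_disj
  · intro j hj
    rcases hmem j hj with ⟨h1, _⟩ | rfl
    · exact h.queue_disj j h1
    · rw [hJp]; exact hJd
  · rw [List.map_append, List.nodup_append]
    refine ⟨h.nodup.sublist (List.filter_sublist.map _), by simp, ?_⟩
    intro a ha c hc
    obtain ⟨j, hj, rfl⟩ := List.mem_map.1 ha
    have : j.part ≠ p := by simpa using (List.mem_filter.1 hj).2
    simp only [List.map_cons, List.map_nil, List.mem_singleton] at hc
    rw [hc, hJp]; exact this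
  · exact h.unfilled
  · exact h.size_le
  · exact h.card_le
  · exact h.cur_card
  · exact h.cur_upload
  · exact h.cur_fetched
  · intro q i hi hq
    have hqp : q ≠ p := by
      rintro rfl
      exact hq J (by simp) hJp
    rw [Function.update_of_ne hqp]
    refine h.count_none q i hi fun j hj => ?_
    by_cases hjp : j.part = p
    · rw [hjp]; exact hqp.symm
    · exact hq j (List.mem_append_left _ (List.mem_filter.2 ⟨hj, by simpa using hjp⟩))
  · intro j hj i hi ht
    rcases hmem j hj with ⟨h1, h2⟩ | rfl
    · rw [Function.update_of_ne h2]; exact h.count_job j h1 i hi ht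
    · rw [hJp, Function.update_self]
      have hlev : (jobLevel P (s.counter p) : ℕ) ≤ i := by
        rcases hJ with ⟨_, h2, _⟩ | ⟨j', hj', h1, h2, _⟩
        · rw [← h2]; exact ht
        · refine le_trans ?_ ht
          rw [h2]; exact_mod_cast le_max_left _ _
      -- The claim concerns only `i` at or above the merged top, hence at or above the level of this
      -- write: the counter does not carry beyond bit `i`, and its residue grows by one, which pays
      -- for the new block.
      have hnd : ¬ 2 ^ (i + 1) ∣ s.counter p := by
        rw [← le_jobLevel_iff (P := P) (by omega)]
        omega
      rw [succ_mod_of_not_dvd hg hC hnd]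
      rcases hJ with ⟨h0, _, h2, _⟩ | ⟨j', hj', h1, h2, h3, _⟩
      · have := h.count_none p i hi h0
        rw [h2]; omega
      · have ht' : (j'.top : ℕ) ≤ i := by
          refine le_trans ?_ ht
          rw [h2]; exact_mod_cast le_max_right _ _
        have e1 := h.count_job j' hj' i hi ht'
        have e2 := Finset.card_union_le j'.blocks b.toFinset
        rw [h1] at e1
        rw [h3]; omega

theorem half_pos (l : Lvl P) : 1 ≤ half P l := by
  unfold half Params.capacity
  have := Nat.one_le_two_pow (n := P.m)
  have := Nat.one_le_two_pow (n := (l : ℕ))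
  split <;> omega

theorem sweep_level (s : State P) (c : CurrentJob P) (q : Part P) (i : Lvl P) :
    (s.sweep c).level q i = if q = c.job.part ∧ i ≤ c.job.top ∧ c.fetch i = 0 then Level.empty P
      else s.level q i := by
  unfold State.sweep
  by_cases hq : q = c.job.part
  · subst hq; simp
  · simp [hq]

/-- The invariant when levels from which everything has been fetched become unfilled. -/
theorem Inv.sweep {s : State P} {c c' : CurrentJob P} (h : Inv A g s.level Q (some c))
    (hj : c'.job = c.job) (hu : 1 ≤ c'.upload) : Inv A g (s.sweep c').level Q (some c') := by
  have hr : ∀ q i, ((s.sweep c').level q i).real =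
      if q = c.job.part ∧ i ≤ c.job.top ∧ c'.fetch i = 0 then ∅ else (s.level q i).real := by
    intro q i
    rw [sweep_level, hj]
    split <;> rfl
  have hrsub : ∀ q i, ((s.sweep c').level q i).real ⊆ (s.level q i).real := by
    intro q i
    rw [hr]; split
    · exact Finset.empty_subset _
    · exact subset_rfl
  have hp : ∀ p l, pendingReal (s.sweep c').level (some c') p l =
      pendingReal s.level (some c) p l := by
    intro p l
    simp only [pendingReal, hj, hr]
    by_cases h1 : c.job.part = p ∧ l ≤ c.job.top
    · simp [h1]
    · rw [if_neg h1, if_neg h1, if_neg]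
      rintro ⟨h2, h3, _⟩
      exact h1 ⟨h2.symm, h3⟩
  have hc : ∀ p i, pendingCount (s.sweep c').level (some c') p i =
      pendingCount s.level (some c) p i := by
    intro p i
    simp [pendingCount, hp]
  constructor
  · simpa [hp] using h.pend_sub
  · exact fun q i => (hrsub q i).trans (h.real_sub q i)
  · exact h.queue_sub
  · simpa [hp] using h.pend_disj
  · exact fun q i i' hne => (h.real_disj q i i' hne).mono (hrsub q i) (hrsub q i')
  · simpa [hp] using h.queue_disj
  · exact h.nodup
  · intro q i hf
    rw [sweep_level] at hf
    rw [hr, ← hj]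
    split at hf
    · rename_i h1; rw [if_pos h1]
    · rename_i h1; rw [if_neg h1]; exact h.unfilled q i hf
  · intro q i
    rw [sweep_level]; split
    · exact Nat.zero_le _
    · exact h.size_le q i
  · exact fun q i => (Finset.card_le_card (hrsub q i)).trans (h.card_le q i)
  · simpa [hj] using h.cur_card
  · simpa using hu
  · intro d hd l hl hf
    obtain rfl : c' = d := by simpa using hd
    rw [hr, if_pos ⟨by rw [hj], hj ▸ hl, hf⟩]
  · simpa [hc] using h.count_none
  · simpa [hc] using h.count_job

/-- The job in progress right after job `j` has been begun. -/
def startJob (lv : Part P → Lvl P → Level P) (j : Job P) : CurrentJob P :=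
  let real : Lvl P → Finset (Block P) := fun l =>
    if l ≤ j.top ∧ (lv j.part l).filled = true then (lv j.part l).real else ∅
  let dummy : Lvl P → ℕ := fun l =>
    if l ≤ j.top ∧ (lv j.part l).filled = true then
      min (half P l - (lv j.part l).real.card) (lv j.part l).dummies else 0
  let buffer : Finset (Block P) := j.blocks ∪ Finset.univ.biUnion real
  { job := { j with blocks := buffer }
    availReal := real
    availDummy := dummy
    fetch := fun l => (real l).card + dummy l
    upload := max (slots P j.top) buffer.card }

theorem start_eq (s : State P) (j : Job P) :
    s.start j = ({ s with current := some (startJob s.level j) } : State P).sweep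
      (startJob s.level j) := rfl

theorem startJob_blocks_card (lv : Part P → Lvl P → Level P) (j : Job P) :
    (startJob lv j).job.blocks.card ≤ j.blocks.card +
      ∑ l ∈ Finset.univ.filter (fun l : Lvl P => l ≤ j.top), (lv j.part l).real.card := by
  refine (Finset.card_union_le _ _).trans (Nat.add_le_add_left ?_ _)
  refine Finset.card_biUnion_le.trans ?_
  rw [Finset.sum_filter]
  apply Finset.sum_le_sum
  intro l _
  by_cases h1 : l ≤ j.top <;> by_cases h2 : (lv j.part l).filled = true <;> simp [h1, h2]

/-- For the top level the buffer lies in `A`, which respects the capacity. Below, `count_job` at `i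
= top` bounds it by a residue modulo `2 ^ (top + 1)`, and `2 ^ (top + 1)` is exactly the space of
that level. -/
theorem Inv.startJob_card_le {j : Job P} (h : Inv A g lv (j :: Q) none)
    (hA : ∀ p, (A p).card ≤ P.capacity) : (startJob lv j).job.blocks.card ≤ slots P j.top := by
  by_cases ht : (j.top : ℕ) = P.m
  · have : (startJob lv j).job.blocks ⊆ A j.part := by
      apply Finset.union_subset (h.queue_sub j (by simp))
      rw [Finset.biUnion_subset]
      intro l _
      split
      · exact h.real_sub _ _
      · exact Finset.empty_subset _
    have h2 := (Finset.card_le_card this).trans (hA _)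
    simp only [slots, half, ht, if_true]
    omega
  · have hlt : (j.top : ℕ) < P.m := by have := j.top.2; omega
    have h1 := h.count_job j (by simp) j.top hlt le_rfl
    have h2 := startJob_blocks_card lv j
    have h3 : g j.part % 2 ^ ((j.top : ℕ) + 1) < 2 ^ ((j.top : ℕ) + 1) :=
      Nat.mod_lt _ (by positivity)
    simp only [slots, half, ht, if_false]
    simp only [pendingCount, pendingReal] at h1
    have h4 : (Finset.univ.filter fun l : Lvl P => (l : ℕ) ≤ (j.top : ℕ)) =
        Finset.univ.filter fun l : Lvl P => l ≤ j.top := rfl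
    rw [h4] at h1
    rw [pow_succ] at h3 h1
    omega

/-- The invariant when the first job of the queue is begun. -/
theorem Inv.start_aux {j : Job P} (h : Inv A g lv (j :: Q) none)
    (hA : ∀ p, (A p).card ≤ P.capacity) : Inv A g lv Q (some (startJob lv j)) := by
  set c := startJob lv j with hc
  have hcp : c.job.part = j.part := rfl
  have hct : c.job.top = j.top := rfl
  have hb : c.job.blocks ⊆ j.blocks ∪
      (Finset.univ.filter fun l : Lvl P => l ≤ j.top).biUnion fun l => (lv j.part l).real := by
    apply Finset.union_subset_union subset_rfl
    intro v hv
    obtain ⟨l, _, hl⟩ := Finset.mem_biUnion.1 hv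
    split at hl
    · rename_i h1
      exact Finset.mem_biUnion.2 ⟨l, by simpa using h1.1, hl⟩
    · simp at hl
  have hbA : c.job.blocks ⊆ A j.part := by
    refine hb.trans (Finset.union_subset (h.queue_sub j (by simp)) ?_)
    rw [Finset.biUnion_subset]
    exact fun l _ => h.real_sub _ _
  have hnone : ∀ p l, pendingReal lv none p l = (lv p l).real := fun p l => rfl
  have hpend : ∀ p l, pendingReal lv (some c) p l = if j.part = p ∧ l ≤ j.top then
      (if l = j.top then c.job.blocks else ∅) else (lv p l).real := fun p l => rfl
  have hother : ∀ p l, p ≠ j.part → pendingReal lv (some c) p l = (lv p l).real := by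
    intro p l hp
    rw [hpend, if_neg]
    rintro ⟨h1, _⟩
    exact hp h1.symm
  have hcother : ∀ p i, p ≠ j.part → pendingCount lv (some c) p i = pendingCount lv none p i := by
    intro p i hp
    simp [pendingCount, hother _ _ hp, hnone]
  have hbdisj : ∀ l, j.top < l → Disjoint c.job.blocks (lv j.part l).real := by
    intro l hl
    refine Disjoint.mono_left hb ?_
    rw [Finset.disjoint_union_left]
    refine ⟨h.queue_disj j (by simp) l, ?_⟩
    rw [Finset.disjoint_biUnion_left]
    intro l' hl'
    have : l' ≤ j.top := by simpa using hl'
    exact h.real_disj _ _ _ (this.trans_lt hl).ne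
  have hsub1 : ∀ k ∈ Q, k ∈ j :: Q := fun k hk => List.mem_cons_of_mem _ hk
  have hne : ∀ k ∈ Q, k.part ≠ j.part := by
    intro k hk he
    have := h.nodup
    rw [List.map_cons, List.nodup_cons] at this
    exact this.1 (he ▸ List.mem_map_of_mem hk)
  -- For `i` at or above the top the job merely moves blocks within the levels `0, …, i` and adds
  -- its own, which `count_job` already included; for smaller `i` all levels become empty.
  have hcount : ∀ i, i < P.m → pendingCount lv (some c) j.part i ≤ g j.part % 2 ^ (i + 1) := by
    intro i hi
    by_cases ht : (j.top : ℕ) ≤ i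
    · refine le_trans ?_ (h.count_job j (by simp) i hi ht)
      unfold pendingCount
      have h1 : ∀ l ∈ Finset.univ.filter (fun l : Lvl P => (l : ℕ) ≤ i),
          (pendingReal lv (some c) j.part l).card ≤ (if l = j.top then c.job.blocks.card else 0) +
            (if ¬ l ≤ j.top then (lv j.part l).real.card else 0) := by
        intro l _
        rw [hpend]
        by_cases h2 : l ≤ j.top <;> by_cases h3 : l = j.top <;> simp [h2, h3]
      refine (Finset.sum_le_sum h1).trans ?_
      rw [Finset.sum_add_distrib, Finset.sum_ite_eq', if_pos (by simpa using ht),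
        ← Finset.sum_filter]
      have h4 := startJob_blocks_card lv j
      have h5 := Finset.sum_filter_add_sum_filter_not
        (Finset.univ.filter fun l : Lvl P => (l : ℕ) ≤ i) (fun l => l ≤ j.top)
        (fun l => (lv j.part l).real.card)
      have h6 : (Finset.univ.filter fun l : Lvl P => (l : ℕ) ≤ i).filter (fun l => l ≤ j.top) =
          Finset.univ.filter fun l : Lvl P => l ≤ j.top := by
        ext l
        simp only [Finset.mem_filter, Finset.mem_univ, true_and, and_iff_right_iff_imp]
        exact fun hl => le_trans (by exact_mod_cast hl) ht
      rw [h6] at h5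
      simp only [hnone]
      rw [← hc] at h4
      omega
    · refine le_trans (le_of_eq ?_) (Nat.zero_le _)
      unfold pendingCount
      apply Finset.sum_eq_zero
      intro l hl
      have hl' : (l : ℕ) ≤ i := by simpa using hl
      have h2 : l < j.top := by
        rw [Fin.lt_def]; omega
      rw [hpend, if_pos ⟨rfl, h2.le⟩, if_neg h2.ne, Finset.card_empty]
  constructor
  · intro p l
    rw [hpend]
    split
    · rename_i h1
      split
      · rw [← h1.1]; exact hbA
      · exact Finset.empty_subset _
    · exact h.real_sub p l
  · exact h.real_sub
  · exact fun k hk => h.queue_sub k (hsub1 k hk)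
  · intro p l l' hll
    by_cases hp : p = j.part
    · subst hp
      rw [hpend, hpend]
      by_cases h1 : l ≤ j.top <;> by_cases h2 : l' ≤ j.top
      · by_cases h3 : l = j.top
        · have h4 : l' ≠ j.top := fun h => hll (h3.trans h.symm)
          simp [h2, h4]
        · simp [h1, h3]
      · simp only [true_and, h1, h2, if_true, if_false]
        split
        · exact hbdisj l' (not_le.1 h2)
        · simp
      · simp only [true_and, h1, h2, if_true, if_false]
        split
        · exact (hbdisj l (not_le.1 h1)).symm
        · simp
      · simp only [true_and, h1, h2, if_false]
        exact h.real_disj _ _ _ hll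
    · rw [hother p l hp, hother p l' hp]; exact h.real_disj _ _ _ hll
  · exact h.real_disj
  · intro k hk l
    rw [hother _ _ (hne k hk)]
    exact h.queue_disj k (hsub1 k hk) l
  · have := h.nodup
    rw [List.map_cons, List.nodup_cons] at this
    exact this.2
  · exact h.unfilled
  · exact h.size_le
  · exact h.card_le
  · intro d hd
    obtain rfl : c = d := by simpa using hd
    exact h.startJob_card_le hA
  · intro d hd
    obtain rfl : c = d := by simpa using hd
    have := half_pos j.top
    show 1 ≤ max (slots P j.top) _
    exact le_max_of_le_left (by unfold slots; omega)
  · intro d hd l hl hf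
    obtain rfl : c = d := by simpa using hd
    have hl' : l ≤ j.top := hl
    by_cases hfil : (lv j.part l).filled = true
    · have hf' : (if l ≤ j.top ∧ (lv j.part l).filled = true then (lv j.part l).real else ∅).card +
        _ = 0 := hf
      rw [if_pos ⟨hl', hfil⟩] at hf'
      exact Finset.card_eq_zero.1 (Nat.eq_zero_of_add_eq_zero_right hf')
    · exact h.unfilled j.part l (by simpa using hfil)
  · intro p i hi hp
    by_cases hpj : p = j.part
    · subst hpj; exact hcount i hi
    · rw [hcother p i hpj]
      refine h.count_none p i hi fun k hk => ?_
      rcases List.mem_cons.1 hk with rfl | hk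
      · exact Ne.symm hpj
      · exact hp k hk
  · intro k hk i hi ht
    rw [hcother _ i (hne k hk)]
    exact h.count_job k (hsub1 k hk) i hi ht

theorem Inv.start {s : State P} {j : Job P} (h : Inv A g s.level (j :: s.queue) none)
    (hA : ∀ p, (A p).card ≤ P.capacity) :
    Inv A g (s.start j).level (s.start j).queue (s.start j).current := by
  rw [start_eq]
  have h1 := h.start_aux hA
  exact Inv.sweep (s := { s with current := some (startJob s.level j) }) h1 rfl
    (h1.cur_upload _ rfl)

/-- The invariant when one block of the job in progress is transferred. -/
theorem Inv.advance {s : State P} {c : CurrentJob P} (h : Inv A g s.level s.queue (some c)) :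
    Inv A g (s.advance c).level (s.advance c).queue (s.advance c).current := by
  unfold State.advance
  split
  · exact Inv.sweep (s := { s.charge with current := _ }) h rfl (h.cur_upload c rfl)
  · rename_i hfind
    have hf : ∀ l, c.fetch l = 0 := by
      intro l
      have := List.find?_eq_none.1 hfind l (List.mem_finRange l)
      simpa using this
    split
    · set lv' := (s.setLevel c.job.part c.job.top
        (Level.build P c.job.top c.job.blocks)).level with hlv'
      have hl : ∀ q i, lv' q i = if q = c.job.part ∧ i = c.job.top then
          Level.build P c.job.top c.job.blocks else s.level q i := fun q i =>
            setLevel_level s c.job.part q c.job.top i _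
      -- At completion the promised contents become the actual ones: everything has been fetched, so
      -- the levels below the top are empty by `cur_fetched`.
      have hr : ∀ q i, (lv' q i).real = pendingReal s.level (some c) q i := by
        intro q i
        rw [hl]
        unfold pendingReal
        by_cases h1 : q = c.job.part
        · subst h1
          by_cases h2 : i = c.job.top
          · simp [h2, Level.build]
          · by_cases h3 : i ≤ c.job.top
            · simp [h2, h3, h.cur_fetched c rfl i h3 (hf i)]
            · simp [h2, h3]
        · simp [h1, Ne.symm h1]
      have hp : ∀ q i, pendingReal lv' none q i = pendingReal s.level (some c) q i := hr
      have hc : ∀ p i, pendingCount lv' none p i = pendingCount s.level (some c) p i := by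
        intro p i
        simp [pendingCount, hp]
      have hcard := h.cur_card c rfl
      show Inv A g lv' s.queue none
      constructor
      · simpa [hp] using h.pend_sub
      · simpa [hr] using h.pend_sub
      · exact h.queue_sub
      · simpa [hp] using h.pend_disj
      · simpa [hr] using h.pend_disj
      · simpa [hp] using h.queue_disj
      · exact h.nodup
      · intro q i hfil
        rw [hl] at hfil ⊢
        split at hfil
        · simp [Level.build] at hfil
        · rename_i h1; rw [if_neg h1]; exact h.unfilled q i hfil
      · intro q i
        rw [hl]
        split
        · rename_i h1; rw [h1.2]; exact max_le le_rfl hcard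
        · exact h.size_le q i
      · intro q i
        rw [hl]
        split
        · rename_i h1; rw [h1.2]; exact hcard
        · exact h.card_le q i
      · simp
      · simp
      · simp
      · simpa [hc] using h.count_none
      · simpa [hc] using h.count_job
    · exact h.congr_current rfl rfl (by dsimp only; omega)

theorem Inv.workUnit {s : State P} (h : Inv A g s.level s.queue s.current)
    (hA : ∀ p, (A p).card ≤ P.capacity) :
    Inv A g s.workUnit.level s.workUnit.queue s.workUnit.current := by
  unfold State.workUnit
  cases hc : s.current with
  | some c => rw [hc] at h; exact h.advance
  | none =>
    cases hq : s.queue with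
    | nil => rw [hc, hq] at h; simpa [hc, hq] using h
    | cons j rest =>
      rw [hc, hq] at h
      have h1 : Inv A g _ _ _ := Inv.start (s := { s with queue := rest }) h hA
      exact Inv.advance (s := ({ s with queue := rest } : State P).start j) h1

theorem Inv.perform {s : State P} (h : Inv A g s.level s.queue s.current)
    (hA : ∀ p, (A p).card ≤ P.capacity) (n : ℕ) :
    Inv A g (s.perform n).level (s.perform n).queue (s.perform n).current := by
  induction n with
  | zero => exact h
  | succ n ih =>
    have : s.perform (n + 1) = (s.perform n).workUnit := Function.iterate_succ_apply' _ _ _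
    rw [this]
    exact ih.workUnit hA

/-- The invariant implies that the reserved layout suffices. -/
theorem Inv.layoutSuffices {s : State P} (h : Inv A g s.level s.queue s.current)
    (hA : ∀ p, (A p).card ≤ P.capacity) : s.LayoutSuffices := by
  refine ⟨h.size_le, fun p => ?_⟩
  rw [← Finset.card_biUnion fun l _ l' _ hll => h.real_disj p l l' hll]
  refine (Finset.card_le_card ?_).trans (hA p)
  rw [Finset.biUnion_subset]
  exact fun l _ => h.real_sub p l

end PartitionORAM

namespace PartitionORAM
variable {P : Params}
variable {A A' : Part P → Finset (Block P)} {g : Part P → ℕ} {lv lv' : Part P → Lvl P → Level P}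
  {Q Q' : List (Job P)} {cur cur' : Option (CurrentJob P)}

/-! ### Work of the job queue -/

/-- The number of blocks that the job in progress has still to transfer. -/
def curWork (cur : Option (CurrentJob P)) : ℕ :=
  (cur.map fun c => (∑ l, c.fetch l) + c.upload).getD 0

/-- The number of dummy blocks cached with the job in progress. -/
def curDummies (cur : Option (CurrentJob P)) : ℕ := (cur.map fun c => c.job.cachedDummies).getD 0

/-- The number of blocks held by the client for a queued job. -/
def Job.size (j : Job P) : ℕ := j.blocks.card + j.cachedDummies

/-- `PrefixAll F a Q`: every job `j` of `Q` satisfies `F w j`, where `w` is `a` plus the work of the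
jobs up to and including `j`. -/
def PrefixAll (F : ℕ → Job P → Prop) : ℕ → List (Job P) → Prop
  | _, [] => True
  | a, j :: r => F (a + jobWork P j.top) j ∧ PrefixAll F (a + jobWork P j.top) r

/-- Replacing the initial work `a` by a smaller `b` lowers every prefix sum by `a - b`; `hFG` may
use that its second value has dropped by at least this amount. -/
theorem PrefixAll.imp {F G : ℕ → Job P → Prop} {a b : ℕ} {L : List (Job P)}
    (h : PrefixAll F a L) (hba : b ≤ a)
    (hFG : ∀ w w' j, j ∈ L → w' + a ≤ w + b → F w j → G w' j) : PrefixAll G b L := by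
  induction L generalizing a b with
  | nil => trivial
  | cons j r ih =>
    refine ⟨hFG _ _ j (by simp) (by omega) h.1, ih h.2 (by omega) ?_⟩
    exact fun w w' k hk hw => hFG w w' k (by simp [hk]) (by omega)

theorem PrefixAll.forall {F : ℕ → Job P → Prop} {a : ℕ} {L : List (Job P)}
    (h : PrefixAll F a L) : ∀ j ∈ L, ∃ w, F w j := by
  induction L generalizing a with
  | nil => simp
  | cons j r ih =>
    intro k hk
    rcases List.mem_cons.1 hk with rfl | hk
    · exact ⟨_, h.1⟩
    · exact ih h.2 k hk

theorem PrefixAll.map {F G : ℕ → Job P → Prop} {a : ℕ} {L : List (Job P)} (f : Job P → Job P)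
    (h : PrefixAll F a L) (hf : ∀ w, ∀ j ∈ L, F w j → (f j).top = j.top ∧ G w (f j)) :
    PrefixAll G a (L.map f) := by
  induction L generalizing a with
  | nil => trivial
  | cons j r ih =>
    have h1 := hf _ j (by simp) h.1
    simp only [List.map_cons, PrefixAll, h1.1]
    exact ⟨h1.2, ih h.2 fun w k hk => hf w k (by simp [hk])⟩

/-- Deleting jobs only shortens the work in front of the others, so a property that is downward
closed in the work survives. -/
theorem PrefixAll.filter {F : ℕ → Job P → Prop} {a b : ℕ} {L : List (Job P)} (q : Job P → Bool)
    (hF : ∀ w w' j, w' ≤ w → F w j → F w' j) (hba : b ≤ a)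
    (h : PrefixAll F a L) : PrefixAll F b (L.filter q) := by
  induction L generalizing a b with
  | nil => trivial
  | cons j r ih =>
    rw [List.filter_cons]
    split
    · exact ⟨hF _ _ j (by omega) h.1, ih (by omega) h.2⟩
    · exact ih (by omega) h.2

theorem PrefixAll.append_singleton {F : ℕ → Job P → Prop} {a : ℕ} {L : List (Job P)} {J : Job P}
    (h : PrefixAll F a L) (hJ : F (a + (L.map fun j => jobWork P j.top).sum + jobWork P J.top) J) :
    PrefixAll F a (L ++ [J]) := by
  induction L generalizing a with
  | nil => exact ⟨by simpa using hJ, trivial⟩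
  | cons j r ih =>
    refine ⟨h.1, ih h.2 ?_⟩
    simp only [List.map_cons, List.sum_cons] at hJ
    rwa [← add_assoc] at hJ

theorem backlog_eq (s : State P) :
    s.backlog = (s.queue.map fun j => jobWork P j.top).sum + curWork s.current := rfl

theorem find_fetch_sum {c : CurrentJob P} {l : Lvl P} (hl : 0 < c.fetch l) :
    (∑ i, Function.update c.fetch l (c.fetch l - 1) i) + 1 = ∑ i, c.fetch i := by
  rw [Finset.sum_update_of_mem (Finset.mem_univ l), ← Finset.add_sum_erase _ _ (Finset.mem_univ l),
    Finset.sdiff_singleton_eq_erase]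
  omega

/-- The part of the state that is not changed by reshuffling work. -/
structure SameClient (s t : State P) : Prop where
  position : t.position = s.position
  slot : t.slot = s.slot
  counter : t.counter = s.counter
  scan : t.scan = s.scan

theorem SameClient.trans {s t r : State P} (h : SameClient s t) (h' : SameClient t r) :
    SameClient s r :=
  ⟨h'.position.trans h.position, h'.slot.trans h.slot, h'.counter.trans h.counter,
    h'.scan.trans h.scan⟩

theorem advance_spec (s : State P) (c : CurrentJob P) (hu : 1 ≤ c.upload) :
    SameClient s (s.advance c) ∧ (s.advance c).queue = s.queue ∧
      (s.advance c).work = s.work + 1 ∧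
      curWork (s.advance c).current + 1 ≤ (∑ l, c.fetch l) + c.upload ∧
      curDummies (s.advance c).current ≤ c.job.cachedDummies := by
  unfold State.advance
  split
  · rename_i l hl
    have h1 : 0 < c.fetch l := by simpa using List.find?_some hl
    refine ⟨⟨rfl, rfl, rfl, rfl⟩, rfl, rfl, ?_, le_rfl⟩
    have := find_fetch_sum h1
    show (∑ i, Function.update c.fetch l (c.fetch l - 1) i) + c.upload + 1 ≤ _
    omega
  · split
    · refine ⟨⟨rfl, rfl, rfl, rfl⟩, rfl, rfl, ?_, Nat.zero_le _⟩
      show 0 + 1 ≤ _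
      omega
    · refine ⟨⟨rfl, rfl, rfl, rfl⟩, rfl, rfl, ?_, le_rfl⟩
      show (∑ i, c.fetch i) + (c.upload - 1) + 1 ≤ _
      omega

/-- A level delivers its real blocks, filled up to the nominal number, which is at most the reserved
space; the upload is exactly the space of the target level because the buffer fits. So the actual
work of a job never exceeds what was charged for it when it was queued. -/
theorem startJob_curWork {j : Job P} (h : Inv A g lv (j :: Q) none)
    (hA : ∀ p, (A p).card ≤ P.capacity) :
    curWork (some (startJob lv j)) ≤ jobWork P j.top := by
  have h1 : (startJob lv j).upload = slots P j.top := max_eq_left (h.startJob_card_le hA)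
  have h2 : ∀ l, (startJob lv j).fetch l ≤ if l ∈ Finset.Iic j.top then slots P l else 0 := by
    intro l
    have h3 := h.card_le j.part l
    simp only [startJob]
    by_cases h4 : l ≤ j.top <;> by_cases h5 : (lv j.part l).filled = true
    · simp only [h4, h5, and_self, if_true, Finset.mem_Iic]
      unfold slots at h3 ⊢
      omega
    all_goals simp [h4, h5]
  have h6 := Finset.sum_le_sum fun l (_ : l ∈ Finset.univ) => h2 l
  rw [Finset.sum_ite_mem, Finset.univ_inter] at h6
  show (∑ l, (startJob lv j).fetch l) + (startJob lv j).upload ≤ _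
  rw [h1]
  exact Nat.add_le_add_right h6 _

/-- The queue is first in, first out, so each unit performed brings every remaining job one unit
closer to completion: a property known at prefix work `w + 1` becomes available at `w`. Beginning a
job replaces its charge `jobWork` by its actual work, which is no larger. -/
theorem workUnit_spec {s : State P} (h : Inv A g s.level s.queue s.current)
    (hA : ∀ p, (A p).card ≤ P.capacity) :
    SameClient s s.workUnit ∧ s.workUnit.queue ⊆ s.queue ∧ s.workUnit.work ≤ s.work + 1 ∧
      s.workUnit.backlog ≤ s.backlog - 1 ∧
      (∀ D, (∀ j ∈ s.queue, j.cachedDummies ≤ D) → curDummies s.current ≤ D →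
        curDummies s.workUnit.current ≤ D) ∧
      ∀ F : ℕ → Job P → Prop, (∀ w w' j, w' ≤ w → F w j → F w' j) →
        PrefixAll F (curWork s.current) s.queue →
        PrefixAll (fun w j => F (w + 1) j) (curWork s.workUnit.current) s.workUnit.queue := by
  cases hc : s.current with
  | some c =>
    rw [hc] at h
    have e : s.workUnit = s.advance c := by unfold State.workUnit; simp [hc]
    obtain ⟨h1, h2, h3, h4, h5⟩ := advance_spec s c (h.cur_upload c rfl)
    have h6 : curWork s.current = (∑ l, c.fetch l) + c.upload := by rw [hc]; rfl
    have h7 : curWork (some c) = (∑ l, c.fetch l) + c.upload := rfl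
    rw [e]
    refine ⟨h1, by rw [h2]; exact List.Subset.refl _, h3.le, ?_, ?_, ?_⟩
    · rw [backlog_eq, backlog_eq, h2, h6]; omega
    · intro D _ h8
      exact h5.trans h8
    · intro F hF hP
      rw [h2]
      exact hP.imp (by omega) fun w w' j _ hw hFw => hF _ _ j (by omega) hFw
  | none =>
    cases hq : s.queue with
    | nil =>
      have e : s.workUnit = s := by unfold State.workUnit; simp [hc, hq]
      rw [e]
      refine ⟨⟨rfl, rfl, rfl, rfl⟩, by simp [hq], by omega, ?_, ?_, ?_⟩
      · rw [backlog_eq, hq, hc]; exact Nat.zero_le _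
      · intro D _ h8; rw [hc]; exact h8
      · intro F hF hP; rw [hq]; trivial
    | cons j rest =>
      rw [hc, hq] at h
      set t : State P := ({ s with queue := rest } : State P).start j with ht
      have hs := Inv.start (s := { s with queue := rest }) h hA
      have e : s.workUnit = t.advance (startJob s.level j) := by
        unfold State.workUnit
        simp only [hc, hq]
        rfl
      have hcur : t.current = some (startJob s.level j) := rfl
      rw [← ht, hcur] at hs
      obtain ⟨h1, h2, h3, h4, h5⟩ := advance_spec t _ (hs.cur_upload _ rfl)
      have h6 : (∑ l, (startJob s.level j).fetch l) + (startJob s.level j).upload ≤ _ :=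
        startJob_curWork h hA
      have htq : t.queue = rest := rfl
      rw [e]
      refine ⟨SameClient.trans (t := t) ⟨rfl, rfl, rfl, rfl⟩ h1, ?_, h3.le, ?_, ?_, ?_⟩
      · rw [h2, htq]; exact List.subset_cons_self j rest
      · rw [backlog_eq, backlog_eq, h2, htq, hq, List.map_cons, List.sum_cons, hc]
        have : curWork (none : Option (CurrentJob P)) = 0 := rfl
        omega
      · intro D h7 _
        exact h5.trans (h7 j (by simp))
      · intro F hF hP
        rw [h2, htq]
        refine hP.2.imp ?_ ?_
        · omega
        · intro w w' k _ hw hFw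
          exact hF _ _ k (by omega) hFw

theorem perform_spec {s : State P} (h : Inv A g s.level s.queue s.current)
    (hA : ∀ p, (A p).card ≤ P.capacity) (n : ℕ) :
    SameClient s (s.perform n) ∧ (s.perform n).queue ⊆ s.queue ∧
      (s.perform n).work ≤ s.work + n ∧ (s.perform n).backlog ≤ s.backlog - n ∧
      (∀ D, (∀ j ∈ s.queue, j.cachedDummies ≤ D) → curDummies s.current ≤ D →
        curDummies (s.perform n).current ≤ D) ∧
      ∀ F : ℕ → Job P → Prop, (∀ w w' j, w' ≤ w → F w j → F w' j) →
        PrefixAll F (curWork s.current) s.queue →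
        PrefixAll (fun w j => F (w + n) j) (curWork (s.perform n).current) (s.perform n).queue := by
  induction n with
  | zero =>
    exact ⟨⟨rfl, rfl, rfl, rfl⟩, List.Subset.refl _, le_rfl, le_rfl, fun D _ h => h,
      fun F hF h => h⟩
  | succ n ih =>
    obtain ⟨h1, h2, h3, h4, h5, h6⟩ := ih
    obtain ⟨k1, k2, k3, k4, k5, k6⟩ := workUnit_spec (h.perform hA n) hA
    have e : s.perform (n + 1) = (s.perform n).workUnit := Function.iterate_succ_apply' _ _ _
    rw [e]
    refine ⟨h1.trans k1, List.Subset.trans k2 h2, by omega, by omega, ?_, ?_⟩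
    · exact fun D hD hc => k5 D (fun j hj => hD j (h2 hj)) (h5 D hD hc)
    · intro F hF hP
      refine (k6 _ ?_ (h6 F hF hP)).imp le_rfl ?_
      · exact fun w w' j hw => hF _ _ j (by omega)
      · exact fun w w' j _ hw hFw => hF _ _ j (by omega) hFw

/-! ### Concurrent reads -/

/-- The effect of (part of) a concurrent read: a queued job of partition `q` with top level `t`
receives at most `e q t` blocks. -/
structure ReadRel (e : Part P → Lvl P → ℕ) (s t : State P) : Prop where
  same : SameClient s t
  work_le : s.work ≤ t.work
  cur_work : curWork t.current = curWork s.current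
  cur_dummies : curDummies t.current = curDummies s.current
  queue : ∃ f : Job P → Job P, t.queue = s.queue.map f ∧ ∀ j ∈ s.queue,
    (f j).part = j.part ∧ (f j).top = j.top ∧ (f j).size ≤ j.size + e j.part j.top

theorem ReadRel.refl (e : Part P → Lvl P → ℕ) (s : State P) : ReadRel e s s :=
  ⟨⟨rfl, rfl, rfl, rfl⟩, le_rfl, rfl, rfl, id, by simp, fun j _ => ⟨rfl, rfl, by simp⟩⟩

theorem ReadRel.trans {e e' : Part P → Lvl P → ℕ} {s t r : State P} (h : ReadRel e s t)
    (h' : ReadRel e' t r) : ReadRel (fun p l => e p l + e' p l) s r := by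
  obtain ⟨f, hf, hf'⟩ := h.queue
  obtain ⟨k, hk, hk'⟩ := h'.queue
  refine ⟨h.same.trans h'.same, h.work_le.trans h'.work_le, h'.cur_work.trans h.cur_work,
    h'.cur_dummies.trans h.cur_dummies, k ∘ f, by rw [hk, hf, List.map_map], ?_⟩
  intro j hj
  obtain ⟨a1, a2, a3⟩ := hf' j hj
  obtain ⟨b1, b2, b3⟩ := hk' (f j) (by rw [hf]; exact List.mem_map_of_mem hj)
  refine ⟨b1.trans a1, b2.trans a2, ?_⟩
  rw [a1, a2] at b3
  show (k (f j)).size ≤ j.size + (e j.part j.top + e' j.part j.top)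
  omega

theorem pickUnread_inl {real : Finset (Block P)} {d : ℕ} {b : Block P}
    (h : some (Sum.inl b) ∈ (pickUnread real d).support) : b ∈ real := by
  unfold pickUnread at h
  split at h
  · rw [PMF.mem_support_map_iff] at h
    obtain ⟨x, hx, hx'⟩ := h
    simp only [Option.some.injEq] at hx'
    subst hx'
    simpa using hx
  · simp at h

/-- A queued job receives a block only from a level that it covers, hence the condition `l ≤ i`. A
read in the job in progress shrinks the sets `S'` only; `fetch` and `upload` stay, so reads do not
change the scheduled work. -/
theorem readLevel_spec {p : Part P} {target : Option (Block P)} {s t : State P} {l : Lvl P}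
    (h : Inv A g s.level s.queue s.current) (ht : t ∈ (readLevel p target s l).support) :
    Inv A g t.level t.queue t.current ∧ t.work ≤ s.work + 1 ∧
      ReadRel (fun q i => if q = p ∧ l ≤ i then 1 else 0) s t := by
  have hcharge : Inv A g s.charge.level s.charge.queue s.charge.current ∧
      s.charge.work ≤ s.work + 1 ∧
      ReadRel (fun q i => if q = p ∧ l ≤ i then 1 else 0) s s.charge :=
    ⟨h, le_rfl, ⟨rfl, rfl, rfl, rfl⟩, Nat.le_succ _, rfl, rfl, id, by simp [State.charge],
      fun j _ => ⟨rfl, rfl, by simp⟩⟩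
  have hsame : Inv A g s.level s.queue s.current ∧ s.work ≤ s.work + 1 ∧
      ReadRel (fun q i => if q = p ∧ l ≤ i then 1 else 0) s s :=
    ⟨h, Nat.le_succ _, ReadRel.refl _ s⟩
  unfold readLevel at ht
  split at ht
  · obtain rfl : t = s := by simpa using ht
    exact hsame
  · split at ht
    · rename_i c hc
      have hc' : s.current = some c := by
        rw [Option.filter_eq_some_iff] at hc
        exact hc.1
      rw [hc'] at h
      unfold readInJob at ht
      split at ht
      · obtain rfl : t = s.charge := by simpa using ht
        exact hcharge
      · obtain ⟨x, hx, ht⟩ := (PMF.mem_support_bind_iff _ _ _).1 ht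
        split at ht
        · obtain rfl : t = s := by simpa using ht
          exact hsame
        · rename_i b
          obtain rfl := (PMF.mem_support_pure_iff _ _).1 ht
          refine ⟨h.congr_current rfl rfl (h.cur_upload c rfl), le_rfl, ⟨rfl, rfl, rfl, rfl⟩,
            Nat.le_succ _, ?_, ?_, id, by simp [State.charge], fun j _ => ⟨rfl, rfl, by simp⟩⟩
          · rw [hc']; rfl
          · rw [hc']; rfl
        · obtain rfl := (PMF.mem_support_pure_iff _ _).1 ht
          refine ⟨h.congr_current rfl rfl (h.cur_upload c rfl), le_rfl, ⟨rfl, rfl, rfl, rfl⟩,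
            Nat.le_succ _, ?_, ?_, id, by simp [State.charge], fun j _ => ⟨rfl, rfl, by simp⟩⟩
          · rw [hc']; rfl
          · rw [hc']; rfl
    · rename_i hnone
      have hcov : ∀ c ∈ s.current, ¬ (c.job.part = p ∧ l ≤ c.job.top) := by
        intro c hc hcc
        rw [Option.filter_eq_none_iff] at hnone
        exact hnone c hc (by simpa using hcc)
      have hreal : ∀ d : ℕ, ∀ q i, ((s.setLevel p l { s.level p l with dummies := d }).level q i).real =
          (s.level q i).real ∧ ((s.setLevel p l { s.level p l with dummies := d }).level q i).filled =
          (s.level q i).filled ∧ ((s.setLevel p l { s.level p l with dummies := d }).level q i).size =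
          (s.level q i).size := by
        intro d q i
        rw [setLevel_level]
        split
        · rename_i hqi; rw [hqi.1, hqi.2]; exact ⟨rfl, rfl, rfl⟩
        · exact ⟨rfl, rfl, rfl⟩
      split at ht
      · obtain rfl : t = s.charge := by simpa using ht
        exact hcharge
      · split at ht
        · rename_i hj
          obtain ⟨j₀, hj₀, hp₀, hl₀⟩ := hj
          obtain ⟨x, hx, ht⟩ := (PMF.mem_support_bind_iff _ _ _).1 ht
          have huniq : ∀ j ∈ s.queue, j.part = p → l ≤ j.top := by
            intro j hj hjp
            rw [h.job_unique hj hj₀ (hjp.trans hp₀.symm)]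
            exact hl₀
          split at ht
          · obtain rfl : t = s := by simpa using ht
            exact hsame
          · rename_i b
            obtain rfl := (PMF.mem_support_pure_iff _ _).1 ht
            refine ⟨h.moveToQueue (pickUnread_inl hx) hcov hj₀ hp₀ hl₀
              (fun q i => setLevel_level _ _ _ _ _ _), le_rfl, ⟨rfl, rfl, rfl, rfl⟩,
              Nat.le_succ _, rfl, rfl, _, rfl, ?_⟩
            intro j hj
            by_cases hjp : j.part = p
            · have := Finset.card_insert_le b j.blocks
              simp only [hjp, if_true, Job.size, huniq j hj hjp, and_self, true_and]
              omega
            · simp [hjp]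
          · obtain rfl := (PMF.mem_support_pure_iff _ _).1 ht
            have h2 := h.congr_real (hreal ((s.level p l).dummies - 1))
            refine ⟨?_, le_rfl, ⟨rfl, rfl, rfl, rfl⟩, Nat.le_succ _, rfl, rfl, _, rfl, ?_⟩
            · have hf : ∀ j : Job P, (if j.part = p then
                  { j with cachedDummies := j.cachedDummies + 1 } else j).part = j.part ∧
                  (if j.part = p then
                  { j with cachedDummies := j.cachedDummies + 1 } else j).top = j.top ∧
                  (if j.part = p then
                  { j with cachedDummies := j.cachedDummies + 1 } else j).blocks = j.blocks := by
                intro j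
                by_cases hjp : j.part = p <;> simp [hjp]
              show Inv A g _ (s.queue.map _) s.current
              refine { h2 with
                queue_sub := ?_, queue_disj := ?_, nodup := ?_, count_none := ?_, count_job := ?_ }
              · intro j hj
                obtain ⟨j', hj', rfl⟩ := List.mem_map.1 hj
                rw [(hf j').1, (hf j').2.2]; exact h2.queue_sub j' hj'
              · intro j hj
                obtain ⟨j', hj', rfl⟩ := List.mem_map.1 hj
                rw [(hf j').1, (hf j').2.2]; exact h2.queue_disj j' hj'
              · rw [List.map_map]
                have : (Job.part ∘ fun j : Job P => if j.part = p then
                  { j with cachedDummies := j.cachedDummies + 1 } else j) = Job.part :=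
                  funext fun j => (hf j).1
                rw [this]; exact h2.nodup
              · intro q i hi hq
                refine h2.count_none q i hi fun j hj => ?_
                rw [← (hf j).1]
                exact hq _ (List.mem_map_of_mem hj)
              · intro j hj i hi ht
                obtain ⟨j', hj', rfl⟩ := List.mem_map.1 hj
                rw [(hf j').2.1] at ht
                rw [(hf j').1, (hf j').2.2]; exact h2.count_job j' hj' i hi ht
            · intro j hj
              by_cases hjp : j.part = p
              · simp only [hjp, if_true, Job.size, huniq j hj hjp, and_self, true_and]
                omega
              · simp [hjp]
        · obtain rfl := (PMF.mem_support_pure_iff _ _).1 ht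
          unfold readDummy
          split
          · exact ⟨h.congr_real (hreal _), le_rfl, ⟨rfl, rfl, rfl, rfl⟩,
              Nat.le_succ _, rfl, rfl, id, by simp [State.charge, State.setLevel],
              fun j _ => ⟨rfl, rfl, by simp⟩⟩
          · exact hsame

theorem readLevels_spec {p : Part P} {target : Option (Block P)} (L : List (Lvl P))
    {s t : State P} (h : Inv A g s.level s.queue s.current)
    (ht : t ∈ (L.foldlM (readLevel p target) s : PMF (State P)).support) :
    Inv A g t.level t.queue t.current ∧ t.work ≤ s.work + L.length ∧
      ReadRel (fun q i => if q = p then L.countP (fun l => l ≤ i) else 0) s t := by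
  induction L generalizing s with
  | nil =>
    obtain rfl : t = s := by simpa using (PMF.mem_support_pure_iff s t).1 ht
    exact ⟨h, le_rfl, ReadRel.refl _ _⟩
  | cons l L ih =>
    rw [List.foldlM_cons] at ht
    obtain ⟨r, hr, ht⟩ := (PMF.mem_support_bind_iff _ _ _).1 ht
    obtain ⟨h1, h2, h3⟩ := readLevel_spec h hr
    obtain ⟨k1, k2, k3⟩ := ih h1 ht
    refine ⟨k1, by simp only [List.length_cons]; omega, ?_⟩
    have : (fun q i => if q = p then (l :: L).countP (fun l => l ≤ i) else 0) =
        fun (q : Part P) (i : Lvl P) => (if q = p ∧ l ≤ i then 1 else 0) +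
          (if q = p then L.countP (fun l => l ≤ i) else 0) := by
      funext q i
      by_cases hq : q = p <;> by_cases hi : l ≤ i <;> simp [hq, hi, add_comm]
    rw [this]
    exact h3.trans k3

theorem countP_finRange_le {n : ℕ} (i : Fin n) :
    (List.finRange n).countP (fun l => l ≤ i) = (i : ℕ) + 1 := by
  rw [List.countP_eq_length_filter, ← List.toFinset_card_of_nodup
    ((List.nodup_finRange n).filter _)]
  have : ((List.finRange n).filter (fun l => l ≤ i)).toFinset = Finset.Iic i := by
    ext l; simp
  rw [this, Fin.card_Iic]

theorem remove_readRel (p : Part P) (u : Block P) (s : State P) :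
    ReadRel (fun _ _ => 0) s (s.remove p u) := by
  refine ⟨⟨rfl, rfl, rfl, rfl⟩, le_rfl, ?_, ?_, _, rfl, ?_⟩
  · cases hc : s.current with
    | none => simp [State.remove, hc, curWork]
    | some c => by_cases hp : c.job.part = p <;> simp [State.remove, hc, curWork, hp]
  · cases hc : s.current with
    | none => simp [State.remove, hc, curDummies]
    | some c => by_cases hp : c.job.part = p <;> simp [State.remove, hc, curDummies, hp]
  · intro j _
    by_cases hp : j.part = p
    · simpa [hp, Job.size] using Finset.card_erase_le
    · simp [hp]

/-- The blocks of the partitions after a read of `target` from `p`. -/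
def eraseTarget (A : Part P → Finset (Block P)) (p : Part P) (target : Option (Block P)) :
    Part P → Finset (Block P) :=
  match target with
  | none => A
  | some u => fun q => if q = p then (A q).erase u else A q

theorem cReadPartition_spec {p : Part P} {target : Option (Block P)} {s t : State P}
    (h : Inv A g s.level s.queue s.current) (ht : t ∈ (cReadPartition p target s).support) :
    Inv (eraseTarget A p target) g t.level t.queue t.current ∧ t.work ≤ s.work + (P.m + 1) ∧
      ReadRel (fun q i => if q = p then (i : ℕ) + 1 else 0) s t := by
  obtain ⟨r, hr, ht⟩ := (PMF.mem_support_bind_iff _ _ _).1 ht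
  obtain ⟨h1, h2, h3⟩ := readLevels_spec _ h hr
  simp only [countP_finRange_le, List.length_finRange] at h2 h3
  cases target with
  | none =>
    obtain rfl := (PMF.mem_support_pure_iff _ _).1 ht
    exact ⟨h1, h2, h3⟩
  | some u =>
    obtain rfl := (PMF.mem_support_pure_iff _ _).1 ht
    exact ⟨h1.remove p u, h2, h3.trans (remove_readRel p u r)⟩

end PartitionORAM

namespace PartitionORAM
variable {P : Params}

/-! ### The schedule of reads and writes -/

/-- The choices that determine which partitions are read and written: the requested blocks, the
initial positions, the new positions, the numbers of sequential evictions and the initial fillings.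
-/
structure Schedule (P : Params) where
  req : ℕ → Block P
  pos : Block P → Part P
  rho : ℕ → Part P
  eta : ℕ → ℕ
  fill : Part P → ℕ

namespace Schedule

variable (σ : Schedule P)

/-- The position map after `t` requests. -/
def posAt : ℕ → Block P → Part P
  | 0 => σ.pos
  | t + 1 => Function.update (posAt t) (σ.req t) (σ.rho t)

/-- The partition read by request `t`. -/
def reads (t : ℕ) : Part P := σ.posAt t (σ.req t)

/-- The number of piggy-backed evictions from `p` during the first `T` requests. -/
def pig (p : Part P) (T : ℕ) : ℕ := Nat.count (fun s => σ.reads s = p) T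

/-- The number of blocks assigned to `p` by the first `R` requests. -/
def arr (p : Part P) (R : ℕ) : ℕ := Nat.count (fun s => σ.rho s = p) R

/-- The number of sequential evictions of the first `t` requests. -/
def evs (t : ℕ) : ℕ := ∑ s ∈ Finset.range t, σ.eta s

end Schedule

/-- The number of evictions from `p` among the first `E` sequential evictions. -/
def seqCount (p : Part P) (E : ℕ) : ℕ := Nat.count (fun e => (e + 1) % 2 ^ P.m = (p : ℕ)) E

namespace Schedule

variable (σ : Schedule P)

/-- The number of writes to `p` after `T` piggy-backed and `E` sequential evictions. -/
def cnt (p : Part P) (T E : ℕ) : ℕ := σ.pig p T + seqCount p E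

/-- The level of write number `i` to partition `p`. -/
def lev (p : Part P) (i : ℕ) : Lvl P := jobLevel P ((σ.fill p + 1 + i) % P.capacity)

/-- The work scheduled between times `(T₀, E₀)` and `(T, E)`. -/
def sched (T₀ E₀ T E : ℕ) : ℕ :=
  ∑ p, ∑ i ∈ Finset.Ico (σ.cnt p T₀ E₀) (σ.cnt p T E), jobWork P (σ.lev p i)

/-- A schedule of `M` requests for which neither partitions, nor cache slots, nor the job queue
overflow: `β` bounds the scheduled work, `τ` the waiting time of a job, `δ` the number of blocks of
the queued jobs, and `γ` the number of blocks in the cache slots. -/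
structure Good (M β τ δ γ : ℕ) : Prop where
  budget_ge : P.m + 1 ≤ P.budget
  wait : β ≤ P.budget * τ
  load : ∀ t ≤ M, ∀ p, (Finset.univ.filter fun v => σ.posAt t v = p).card ≤ P.capacity
  -- Leaky-bucket condition: in no window does the scheduled work exceed the budget of its write
  -- steps by more than `β - budget`.
  work : ∀ T₀ E₀ T E, T₀ ≤ T → T ≤ M → E₀ ≤ E → E ≤ σ.evs M →
    σ.sched T₀ E₀ T E + P.budget + P.budget * (T₀ + E₀) ≤ P.budget * (T + E) + β
  -- Here `b p` stands for the size of the queued job of `p`, which merges `h` writes and has top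
  -- level `t`: `h` written blocks and at most `h * (t + 1)` cached ones. The window from `(T₀, E₀)`
  -- contains exactly these writes and lasts at most `τ` steps per write.
  chain : ∀ T ≤ M, ∀ E ≤ σ.evs M, ∀ b : Part P → ℕ,
    (∀ p, b p = 0 ∨ ∃ h t T₀ E₀, T₀ ≤ T ∧ E₀ ≤ E ∧ b p ≤ h + h * (t + 1) ∧
      T + E ≤ T₀ + E₀ + h * τ ∧ σ.cnt p T E = σ.cnt p T₀ E₀ + h ∧
      ∃ i < h, t ≤ (σ.lev p (σ.cnt p T₀ E₀ + i) : ℕ)) → ∑ p, b p ≤ δ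
  -- Here `L p` stands for the length of slot `p`: either zero or at most the arrivals minus the
  -- evictions since some time `t₀`.
  cache : ∀ t ≤ M, ∀ L : Part P → ℕ,
    (∀ p, L p = 0 ∨ ∃ t₀ ≤ t, L p + σ.cnt p t (σ.evs t) + σ.arr p t₀ ≤
      σ.arr p t + σ.cnt p t₀ (σ.evs t₀)) → ∑ p, L p ≤ γ

end Schedule

/-! ### The invariant of the execution and the effect of an eviction. -/

/-- The blocks of partition `p` that are not in its cache slot. -/
def srvBlocks (position : Block P → Part P) (slot : Part P → List (Block P)) (p : Part P) :
    Finset (Block P) :=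
  Finset.univ.filter fun v => position v = p ∧ v ∉ slot p

/-- The invariant of a queued job with `w` units of work up to its completion. -/
def JobOK (σ : Schedule P) (β τ : ℕ) (e : Part P → Lvl P → ℕ) (T E w : ℕ) (j : Job P) : Prop :=
  -- The job merges `k + 1` writes, the first one right after `(T₀, E₀)`, and has waited `age` write
  -- steps since the last merge. It had at most `β` work up to its completion when it was last moved
  -- to the tail, and each write step removes one budget. The `k` earlier waits took at most `τ`
  -- steps each. Between consecutive merges its partition is read at most once, whence `k * (top +
  -- 1)` cached blocks; `e` accounts for a read whose piggy-backed write is still to come.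
  ∃ age k T₀ E₀, T₀ ≤ T ∧ E₀ ≤ E ∧ w + P.budget * (age + 1) ≤ β ∧
    T + E ≤ T₀ + E₀ + k * τ + 1 + age ∧ σ.cnt j.part T E = σ.cnt j.part T₀ E₀ + (k + 1) ∧
    j.size ≤ k + 1 + k * (j.top + 1) + e j.part j.top ∧
    ∃ i < k + 1, (j.top : ℕ) ≤ σ.lev j.part (σ.cnt j.part T₀ E₀ + i)

/-- The invariant of the execution after `R` arrivals in the cache slots, `T` piggy-backed and `E`
sequential evictions. -/
structure Ghost (σ : Schedule P) (β τ δ γ : ℕ) (e : Part P → Lvl P → ℕ) (R T E : ℕ)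
    (s : State P) : Prop where
  position : s.position = σ.posAt R
  slot_nodup : ∀ p, (s.slot p).Nodup
  slot_pos : ∀ p, ∀ v ∈ s.slot p, s.position v = p
  inv : Inv (srvBlocks s.position s.slot) (fun p => (σ.fill p + σ.cnt p T E) % P.capacity)
    s.level s.queue s.current
  counter : ∀ p, s.counter p = (σ.fill p + 1 + σ.cnt p T E) % P.capacity
  -- The time `t₀` is one at which the slot was empty, so that no eviction since then has been
  -- wasted.
  slot_len : ∀ p, (s.slot p).length = 0 ∨ ∃ t₀ ≤ T, (s.slot p).length + σ.cnt p T E + σ.arr p t₀ ≤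
    σ.arr p R + σ.cnt p t₀ (σ.evs t₀)
  -- The extra one is the requested block between its insertion and the piggy-backed eviction.
  total : ∑ p, (s.slot p).length ≤ γ + 1
  -- A busy period starts at `(T₀, E₀)`: since then the full budget of every write step has been
  -- spent on scheduled work.
  backlog : ∃ T₀ ≤ T, ∃ E₀ ≤ E,
    s.backlog + P.budget * (T + E) ≤ P.budget * (T₀ + E₀) + σ.sched T₀ E₀ T E
  jobs : PrefixAll (JobOK σ β τ e T E) (curWork s.current) s.queue
  dummies : curDummies s.current ≤ δ

/-- The properties of a state that the cost and storage bounds need. -/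
structure Fine (β δ γ : ℕ) (s : State P) : Prop where
  backlog : s.backlog ≤ β
  client : s.clientBlocks ≤ γ + 1 + 2 * δ + 2 * slots P (Fin.last P.m)
  queue : s.queue.length ≤ 2 ^ P.m
  layout : s.LayoutSuffices

variable {σ : Schedule P} {M β τ δ γ : ℕ} {e : Part P → Lvl P → ℕ} {R T E : ℕ} {s : State P}

theorem capacity_pos : 0 < P.capacity := by
  have := Nat.one_le_two_pow (n := P.m)
  unfold Params.capacity; omega

theorem Schedule.Good.srvBlocks_card (hσ : σ.Good M β τ δ γ) (hR : R ≤ M)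
    (hpos : s.position = σ.posAt R) (sl : Part P → List (Block P)) (p : Part P) :
    (srvBlocks s.position sl p).card ≤ P.capacity := by
  refine (Finset.card_le_card ?_).trans (hσ.load R hR p)
  rw [hpos]
  intro v
  simp only [srvBlocks, Finset.mem_filter, Finset.mem_univ, true_and]
  exact And.left

/-- The remaining work is nonnegative, so `budget * (age + 1) ≤ β ≤ budget * τ`, and the wait since
the last merge is shorter than `τ` as well. -/
theorem jobOK_chain (hσ : σ.Good M β τ δ γ) (he : ∀ p i, e p i ≤ (i : ℕ) + 1) {w : ℕ} {j : Job P}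
    (h : JobOK σ β τ e T E w j) : ∃ h t T₀ E₀, T₀ ≤ T ∧ E₀ ≤ E ∧ j.size ≤ h + h * (t + 1) ∧
      T + E ≤ T₀ + E₀ + h * τ ∧ σ.cnt j.part T E = σ.cnt j.part T₀ E₀ + h ∧
      ∃ i < h, t ≤ (σ.lev j.part (σ.cnt j.part T₀ E₀ + i) : ℕ) := by
  obtain ⟨age, k, T₀, E₀, h1, h2, h3, h4, h5, h6, h7⟩ := h
  have hb : 0 < P.budget := by have := hσ.budget_ge; omega
  have hage : age + 1 ≤ τ :=
    Nat.le_of_mul_le_mul_left (by have := hσ.wait; omega) hb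
  refine ⟨k + 1, j.top, T₀, E₀, h1, h2, ?_, ?_, h5, h7⟩
  · have := he j.part j.top
    rw [add_mul, one_mul]; omega
  · rw [add_mul, one_mul]; omega

/-- A partition has at most one queued job, so the queue gives a function `b` on partitions to which
`Schedule.Good.chain` applies. -/
theorem Ghost.job_size_le (h : Ghost σ β τ δ γ e R T E s) (hσ : σ.Good M β τ δ γ) (hT : T ≤ M)
    (hE : E ≤ σ.evs M) (he : ∀ p i, e p i ≤ (i : ℕ) + 1) :
    (s.queue.map Job.size).sum ≤ δ := by
  set b : Part P → ℕ := fun p => ((s.queue.find? fun j => j.part = p).map Job.size).getD 0 with hb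
  have h1 : ∀ j ∈ s.queue, j.size = b j.part := by
    intro j hj
    cases hf : s.queue.find? (fun i => i.part = j.part) with
    | none =>
      have := List.find?_eq_none.1 hf j hj
      simp at this
    | some i =>
      have h2 : i.part = j.part := by simpa using List.find?_some hf
      have h3 := h.inv.job_unique (List.mem_of_find?_eq_some hf) hj h2
      simp [hb, hf, h3]
  have h2 : (s.queue.map Job.size) = (s.queue.map Job.part).map b := by
    rw [List.map_map]
    exact List.map_congr_left h1
  rw [h2, ← List.sum_toFinset b h.inv.nodup]
  refine (Finset.sum_le_univ_sum_of_nonneg fun p => Nat.zero_le _).trans ?_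
  refine hσ.chain T hT E hE b fun p => ?_
  cases hf : s.queue.find? (fun i => i.part = p) with
  | none => left; simp [hb, hf]
  | some j =>
    right
    have h3 : j.part = p := by simpa using List.find?_some hf
    have h4 := List.mem_of_find?_eq_some hf
    obtain ⟨w, hw⟩ := h.jobs.forall j h4
    have := jobOK_chain hσ he hw
    rw [h1 j h4, h3] at this
    exact this

theorem Ghost.dummies_le (h : Ghost σ β τ δ γ e R T E s) (hσ : σ.Good M β τ δ γ) (hT : T ≤ M)
    (hE : E ≤ σ.evs M) (he : ∀ p i, e p i ≤ (i : ℕ) + 1) :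
    ∀ j ∈ s.queue, j.cachedDummies ≤ δ := by
  intro j hj
  refine le_trans ?_ (h.job_size_le hσ hT hE he)
  refine le_trans ?_ (List.single_le_sum (fun _ _ => Nat.zero_le _) _ (List.mem_map_of_mem hj))
  unfold Job.size; omega

theorem Ghost.backlog_le (h : Ghost σ β τ δ γ e R T E s) (hσ : σ.Good M β τ δ γ) (hT : T ≤ M)
    (hE : E ≤ σ.evs M) : s.backlog + P.budget ≤ β := by
  obtain ⟨T₀, hT₀, E₀, hE₀, h1⟩ := h.backlog
  have := hσ.work T₀ E₀ T E hT₀ hT hE₀ hE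
  omega

theorem slots_le_last (l : Lvl P) : slots P l ≤ slots P (Fin.last P.m) := by
  unfold slots half Params.capacity
  have h1 : 2 ^ (l : ℕ) ≤ 2 ^ P.m := Nat.pow_le_pow_right (by norm_num) (by have := l.2; omega)
  simp only [Fin.val_last, if_true]
  split <;> omega

theorem Ghost.fine (h : Ghost σ β τ δ γ e R T E s) (hσ : σ.Good M β τ δ γ) (hR : R ≤ M)
    (hT : T ≤ M) (hE : E ≤ σ.evs M) (he : ∀ p i, e p i ≤ (i : ℕ) + 1) : Fine β δ γ s := by
  constructor
  · have := h.backlog_le hσ hT hE; omega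
  · have h1 := h.total
    have h2 := h.job_size_le hσ hT hE he
    have h3 := h.dummies
    have h4 : (s.current.map fun c => c.job.blocks.card + c.job.cachedDummies).getD 0 ≤
        slots P (Fin.last P.m) + δ := by
      cases hc : s.current with
      | none => simp
      | some c =>
        rw [hc] at h3
        have h5 := (h.inv.cur_card c hc).trans (slots_le_last _)
        exact Nat.add_le_add h5 h3
    have h6 : (s.queue.map fun j => j.blocks.card + j.cachedDummies) = s.queue.map Job.size := rfl
    unfold State.clientBlocks
    rw [h6]
    omega
  · have := List.Nodup.length_le_card h.inv.nodup
    simpa using this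
  · exact h.inv.layoutSuffices fun p => hσ.srvBlocks_card hR h.position _ p

theorem evict_eq (p : Part P) (s : State P) : evict p s = stepWrite p (s.slot p).head?
    { s with slot := Function.update s.slot p (s.slot p).tail } := by
  unfold evict
  cases h : s.slot p with
  | nil =>
    have : Function.update s.slot p [] = s.slot := by rw [← h, Function.update_eq_self]
    simp [this]
  | cons b r => rfl

theorem sum_filter_add_le (L : List (Job P)) (p : Part P) {j : Job P} (hj : j ∈ L)
    (hp : j.part = p) (f : Job P → ℕ) :
    ((L.filter fun j => j.part ≠ p).map f).sum + f j ≤ (L.map f).sum := by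
  induction L with
  | nil => simp at hj
  | cons i r ih =>
    have hle : ((r.filter fun j => j.part ≠ p).map f).sum ≤ (r.map f).sum :=
      (List.filter_sublist.map f).sum_le_sum (by simp)
    rcases List.mem_cons.1 hj with rfl | hj
    · rw [List.filter_cons_of_neg (by simpa using hp), List.map_cons, List.sum_cons]; omega
    · have := ih hj
      by_cases hi : i.part = p
      · rw [List.filter_cons_of_neg (by simpa using hi), List.map_cons, List.sum_cons]; omega
      · rw [List.filter_cons_of_pos (by simpa using hi), List.map_cons, List.map_cons,
          List.sum_cons, List.sum_cons]; omega

/-- The effect of an eviction on the invariant. -/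
theorem Ghost.evict (h : Ghost σ β τ δ γ e R T E s) (hσ : σ.Good M β τ δ γ) {p : Part P}
    {T' E' : ℕ} (hR : R ≤ M) (hTT : T ≤ T') (hEE : E ≤ E') (hT : T' ≤ M) (hE : E' ≤ σ.evs M)
    (he : ∀ q i, e q i ≤ if q = p then (i : ℕ) + 1 else 0) (hsum : T' + E' = T + E + 1)
    (hcnt : ∀ q, σ.cnt q T' E' = σ.cnt q T E + if q = p then 1 else 0) :
    Ghost σ β τ δ γ (fun _ _ => 0) R T' E' (evict p s) ∧ (evict p s).scan = s.scan ∧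
      (evict p s).work ≤ s.work + P.budget := by
  have he' : ∀ q i, e q i ≤ (i : ℕ) + 1 := fun q i => (he q i).trans (by split <;> omega)
  have hTM : T ≤ M := hTT.trans hT
  have hEM : E ≤ σ.evs M := hEE.trans hE
  rw [evict_eq]
  set b := (s.slot p).head? with hb
  set s₁ : State P := { s with slot := Function.update s.slot p (s.slot p).tail } with hs₁
  have hslot : ∀ q, s₁.slot q = if q = p then (s.slot p).tail else s.slot q := by
    intro q
    by_cases hq : q = p
    · subst hq; simp [hs₁]
    · simp [hs₁, hq]
  have htailsub : ∀ q, s₁.slot q ⊆ s.slot q := by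
    intro q; rw [hslot]; split
    · rename_i hq; rw [hq]; exact List.tail_subset _
    · exact List.Subset.refl _
  have hbs : ∀ v ∈ b, v ∈ s.slot p ∧ v ∉ (s.slot p).tail := by
    intro v hv
    have hv' : (s.slot p).head? = some v := hv
    have hnd := h.slot_nodup p
    cases hl : s.slot p with
    | nil => simp [hl] at hv'
    | cons a r =>
      rw [hl] at hv' hnd
      simp only [List.head?_cons, Option.some.injEq] at hv'
      subst hv'
      exact ⟨by simp, (List.nodup_cons.1 hnd).1⟩
  set lam := jobLevel P (s.counter p) with hlam
  have hlev : lam = σ.lev p (σ.cnt p T E) := by rw [hlam, h.counter]; rfl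
  set t₀ : State P := s₁.enqueue p lam b.toFinset with ht₀
  set t₁ : State P := { t₀ with counter := Function.update s₁.counter p ((s₁.counter p + 1) %
    P.capacity) } with ht₁
  have hstep : stepWrite p b s₁ = t₁.perform P.budget := rfl
  rw [hstep]
  have hInv : Inv (srvBlocks s.position s₁.slot)
      (fun q => (σ.fill q + σ.cnt q T' E') % P.capacity) t₁.level t₁.queue t₁.current := by
    have h1 := Inv.enqueue (s := s₁) (A' := srvBlocks s.position s₁.slot) h.inv p b ?_
      (Nat.mod_lt _ capacity_pos) ?_ ?_ ?_
    · have h2 : Function.update (fun q => (σ.fill q + σ.cnt q T E) % P.capacity) p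
          (s₁.counter p) = fun q => (σ.fill q + σ.cnt q T' E') % P.capacity := by
        funext q
        by_cases hq : q = p
        · subst hq
          rw [Function.update_self, hcnt, if_pos rfl]
          show s.counter q = _
          rw [h.counter]; congr 1; omega
        · rw [Function.update_of_ne hq, hcnt, if_neg hq, add_zero]
      rw [h2] at h1
      show Inv _ _ t₀.level t₀.queue t₀.current
      rw [ht₀, enqueue_level, enqueue_current]
      exact h1
    · intro v hv hvA
      simp only [srvBlocks, Finset.mem_filter, Finset.mem_univ, true_and] at hvA
      exact hvA.2 (hbs v hv).1
    · show s.counter p = _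
      rw [h.counter, Nat.mod_add_mod]; congr 1; omega
    · intro q v
      simp only [srvBlocks, Finset.mem_filter, Finset.mem_univ, true_and]
      exact fun ⟨h1, h2⟩ => ⟨h1, fun h3 => h2 (htailsub q h3)⟩
    · intro v hv
      simp only [srvBlocks, Finset.mem_filter, Finset.mem_univ, true_and, hslot, if_true]
      exact ⟨h.slot_pos p v (hbs v hv).1, (hbs v hv).2⟩
  have hA : ∀ q, (srvBlocks s.position s₁.slot q).card ≤ P.capacity :=
    fun q => hσ.srvBlocks_card hR h.position _ q
  obtain ⟨J, hQ, hJp, hJ⟩ := enqueue_queue s₁ p lam b.toFinset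
  have hQ' : t₁.queue = s.queue.filter (fun j => j.part ≠ p) ++ [J] := hQ
  have ht₁c : t₁.current = s.current := enqueue_current _ _ _ _
  have hbc : b.toFinset.card ≤ 1 := by cases b <;> simp
  have hblog : t₁.backlog ≤ s.backlog + jobWork P lam := by
    rw [backlog_eq, backlog_eq, hQ', ht₁c, List.map_append, List.sum_append, List.map_singleton,
      List.sum_singleton]
    rcases hJ with ⟨h0, h2, _⟩ | ⟨j, hj, h1, h2, _⟩
    · rw [h2]
      have : ((s.queue.filter fun j => j.part ≠ p).map fun j => jobWork P j.top).sum ≤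
          (s.queue.map fun j => jobWork P j.top).sum :=
        (List.filter_sublist.map _).sum_le_sum (by simp)
      omega
    · have := sum_filter_add_le s.queue p hj h1 (fun j => jobWork P j.top)
      rw [h2]
      rcases max_choice lam j.top with h3 | h3 <;> rw [h3] <;> omega
  have hschedstep : ∀ T₀ E₀, T₀ ≤ T → E₀ ≤ E →
      σ.sched T₀ E₀ T' E' = σ.sched T₀ E₀ T E + jobWork P lam := by
    intro T₀ E₀ hT₀ hE₀
    unfold Schedule.sched
    have hmono : ∀ q, σ.cnt q T₀ E₀ ≤ σ.cnt q T E := fun q =>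
      Nat.add_le_add (Nat.count_monotone _ hT₀) (Nat.count_monotone _ hE₀)
    have : ∀ q, ∑ i ∈ Finset.Ico (σ.cnt q T₀ E₀) (σ.cnt q T' E'), jobWork P (σ.lev q i) =
        (∑ i ∈ Finset.Ico (σ.cnt q T₀ E₀) (σ.cnt q T E), jobWork P (σ.lev q i)) +
          if q = p then jobWork P lam else 0 := by
      intro q
      rw [hcnt]
      by_cases hq : q = p
      · subst hq
        simp only [if_true]
        rw [Finset.sum_Ico_succ_top (hmono q), hlev]
      · simp [hq]
    rw [Finset.sum_congr rfl fun q _ => this q, Finset.sum_add_distrib, Finset.sum_ite_eq']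
    simp
  have hmulsum : P.budget * (T' + E') = P.budget * (T + E) + P.budget := by
    rw [hsum, mul_add, mul_one]
  have ht₁β : t₁.backlog ≤ β := by
    obtain ⟨T₀, hT₀, E₀, hE₀, h1⟩ := h.backlog
    have h2 := hσ.work T₀ E₀ T' E' (hT₀.trans hTT) hT (hE₀.trans hEE) hE
    rw [hschedstep T₀ E₀ hT₀ hE₀] at h2
    omega
  obtain ⟨k1, k2, k3, k4, k5, k6⟩ := perform_spec hInv hA P.budget
  have hpos : (t₁.perform P.budget).position = s.position := k1.position.trans (enqueue_position _ _ _ _)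
  have hsl : (t₁.perform P.budget).slot = s₁.slot := k1.slot.trans (enqueue_slot _ _ _ _)
  refine ⟨?_, k1.scan.trans (enqueue_scan _ _ _ _), ?_⟩
  swap
  · refine k3.trans (Nat.add_le_add_right (le_of_eq ?_) _)
    exact enqueue_work _ _ _ _
  constructor
  · rw [hpos, h.position]
  · intro q
    rw [hsl, hslot]
    split
    · exact (h.slot_nodup p).tail
    · exact h.slot_nodup q
  · intro q v hv
    rw [hpos]
    rw [hsl] at hv
    exact h.slot_pos q v (htailsub q hv)
  · rw [hpos, hsl]
    exact hInv.perform hA _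
  · intro q
    rw [k1.counter]
    show Function.update s.counter p ((s.counter p + 1) % P.capacity) q = _
    by_cases hq : q = p
    · subst hq
      rw [Function.update_self, h.counter, Nat.mod_add_mod, hcnt, if_pos rfl]
      congr 1
    · rw [Function.update_of_ne hq, h.counter, hcnt, if_neg hq, add_zero]
  · intro q
    rw [hsl, hslot, hcnt]
    by_cases hq : q = p
    · subst hq
      simp only [if_true, List.length_tail]
      rcases h.slot_len q with h1 | ⟨u, hu, h1⟩
      · left; omega
      · rcases Nat.eq_zero_or_pos (s.slot q).length with h2 | h2
        · left; omega
        · right; exact ⟨u, hu.trans hTT, by omega⟩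
    · simp only [hq, if_false, add_zero]
      rcases h.slot_len q with h1 | ⟨u, hu, h1⟩
      · exact Or.inl h1
      · exact Or.inr ⟨u, hu.trans hTT, h1⟩
  · refine le_trans (Finset.sum_le_sum fun q _ => ?_) h.total
    rw [hsl, hslot]
    split
    · rename_i hq; rw [hq, List.length_tail]; omega
    · exact le_rfl
  -- If this step can clear the whole backlog, the busy period ends and a new one starts at `(T',
  -- E')`; otherwise the full budget is spent and the old one goes on.
  · by_cases hz : t₁.backlog ≤ P.budget
    · refine ⟨T', le_rfl, E', le_rfl, ?_⟩
      omega
    · obtain ⟨T₀, hT₀, E₀, hE₀, h1⟩ := h.backlog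
      refine ⟨T₀, hT₀.trans hTT, E₀, hE₀.trans hEE, ?_⟩
      rw [hschedstep T₀ E₀ hT₀ hE₀]
      omega
  -- The property of jobs after enqueueing and before the work of this step. The job of `p` is now
  -- last, so its prefix work is the whole backlog, at most `β`; all others are unchanged. The work
  -- of the step then pays for raising `age` by one, or for giving the job of `p` its `age = 0`.
  · set F : ℕ → Job P → Prop := fun w j => (j.part ≠ p ∧ JobOK σ β τ e T E w j) ∨
      (j.part = p ∧ w ≤ β ∧ ∃ k T₀ E₀, T₀ ≤ T' ∧ E₀ ≤ E' ∧
        T' + E' ≤ T₀ + E₀ + k * τ + 1 ∧ σ.cnt j.part T' E' = σ.cnt j.part T₀ E₀ + (k + 1) ∧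
        j.size ≤ k + 1 + k * (j.top + 1) ∧
        ∃ i < k + 1, (j.top : ℕ) ≤ σ.lev j.part (σ.cnt j.part T₀ E₀ + i)) with hF
    have hOKdc : ∀ w w' j, w' ≤ w → JobOK σ β τ e T E w j → JobOK σ β τ e T E w' j := by
      rintro w w' j hw ⟨age, k, T₀, E₀, h1, h2, h3, h4⟩
      exact ⟨age, k, T₀, E₀, h1, h2, by omega, h4⟩
    have hFdc : ∀ w w' j, w' ≤ w → F w j → F w' j := by
      rintro w w' j hw (⟨h1, h2⟩ | ⟨h1, h2, h3⟩)
      · exact Or.inl ⟨h1, hOKdc w w' j hw h2⟩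
      · exact Or.inr ⟨h1, by omega, h3⟩
    have hb0 : 0 < P.budget := by have := hσ.budget_ge; omega
    have hP1 : PrefixAll F (curWork t₁.current) t₁.queue := by
      rw [hQ', ht₁c]
      refine PrefixAll.append_singleton ?_ ?_
      · refine (h.jobs.filter _ hOKdc le_rfl).imp le_rfl ?_
        intro w w' j hj hw hok
        have : j.part ≠ p := by simpa using (List.mem_filter.1 hj).2
        exact Or.inl ⟨this, hOKdc w w' j (by omega) hok⟩
      · refine Or.inr ⟨hJp, ?_, ?_⟩
        · refine le_trans (le_of_eq ?_) ht₁β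
          rw [backlog_eq, hQ', ht₁c, List.map_append, List.sum_append, List.map_singleton,
            List.sum_singleton]
          omega
        · rw [hJp]
          rcases hJ with ⟨h0, h2, h3, h4⟩ | ⟨j, hj, h1, h2, h3, h4⟩
          · refine ⟨0, T, E, hTT, hEE, by omega, by rw [hcnt, if_pos rfl], ?_, 0, by omega, ?_⟩
            · unfold Job.size; rw [h3, h4]; omega
            · rw [h2, hlev, add_zero]
          · obtain ⟨w, hw⟩ := h.jobs.forall j hj
            obtain ⟨age, k, T₀, E₀, l1, l2, l3, l4, l5, l6, i, l7, l8⟩ := hw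
            have hage : age + 1 ≤ τ :=
              Nat.le_of_mul_le_mul_left (by have := hσ.wait; omega) hb0
            rw [h1] at l5 l6 l8
            have hec := he p j.top
            rw [if_pos rfl] at hec
            have htop : (j.top : ℕ) ≤ J.top := by
              rw [h2]; exact_mod_cast le_max_right lam j.top
            refine ⟨k + 1, T₀, E₀, l1.trans hTT, l2.trans hEE, ?_, ?_, ?_, ?_⟩
            · rw [add_mul, one_mul]; omega
            · rw [hcnt, if_pos rfl]; omega
            · have hcu := Finset.card_union_le j.blocks b.toFinset
              have hm : k * ((j.top : ℕ) + 1) ≤ k * ((J.top : ℕ) + 1) :=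
                Nat.mul_le_mul_left _ (by omega)
              unfold Job.size at l6 ⊢
              rw [h3, h4, add_mul, one_mul]
              omega
            · rcases max_choice lam j.top with hm | hm
              · refine ⟨k + 1, by omega, ?_⟩
                rw [h2, hm, hlev, l5]
              · exact ⟨i, by omega, by rw [h2, hm]; exact l8⟩
    refine (k6 F hFdc hP1).imp le_rfl ?_
    rintro w w' j _ hw (⟨h1, age, k, T₀, E₀, l1, l2, l3, l4, l5, l6, l7⟩ |
      ⟨h1, h2, k, T₀, E₀, l1, l2, l4, l5, l6, l7⟩)
    · refine ⟨age + 1, k, T₀, E₀, l1.trans hTT, l2.trans hEE, ?_, by omega, ?_, ?_, l7⟩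
      · rw [mul_add, mul_one]; omega
      · rw [hcnt, if_neg h1, l5, add_zero]
      · have := he j.part j.top
        rw [if_neg h1] at this
        omega
    · exact ⟨0, k, T₀, E₀, l1, l2, by simp only [zero_add, mul_one]; omega, l4, l5, l6, l7⟩
  · refine k5 δ ?_ (by rw [ht₁c]; exact h.dummies)
    intro j hj
    rw [hQ'] at hj
    have hd := h.dummies_le hσ hTM hEM he'
    rcases List.mem_append.1 hj with hj | hj
    · exact hd j (List.mem_of_mem_filter hj)
    · rw [List.mem_singleton.1 hj]
      rcases hJ with ⟨_, _, _, h4⟩ | ⟨i, hi, _, _, _, h4⟩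
      · rw [h4]; exact Nat.zero_le _
      · rw [h4]; exact hd i hi

end PartitionORAM

/-! ### Requests preserve the invariant of the execution. -/

namespace PartitionORAM
variable {P : Params}
variable {σ : Schedule P} {M β τ δ γ : ℕ} {e : Part P → Lvl P → ℕ} {R T E : ℕ} {s : State P}

/-- The states after the read of request `u`, whose new partition is `r`. -/
noncomputable def readStep (u : Block P) (r : Part P) (s : State P) : PMF (State P) :=
  let p := s.position u
  let s₁ : State P := { s with position := Function.update s.position u r, work := 0 }
  if u ∈ s.slot p then
    stepRead p none { s₁ with slot := Function.update s.slot p ((s.slot p).erase u) }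
  else stepRead p (some u) s₁

/-- A data request with given random choices of the new partition and of the number of sequential
evictions. -/
noncomputable def accessWith (u : Block P) (r : Part P) (num : ℕ) (s : State P) :
    PMF (List (State P)) :=
  (readStep u r s).bind fun s₂ =>
    let s₃ : State P := { s₂ with slot := Function.update s₂.slot r (s₂.slot r ++ [u]) }
    let s₄ := evict (s.position u) s₃
    PMF.pure (s₃ :: s₄ :: seqEvict num s₄)

/-- A read leaves the scheduled work unchanged, and the rest of its step can only reduce it. No
credit is taken for this work: `F` keeps its argument, which is why time can be measured in write
steps alone. As a read costs at most `m + 1 ≤ budget`, the step stays within its budget. -/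
theorem stepRead_spec {A : Part P → Finset (Block P)} {g : Part P → ℕ} {p : Part P}
    {target : Option (Block P)} {s t : State P}
    (h : Inv A g s.level s.queue s.current) (hA : ∀ p, (A p).card ≤ P.capacity)
    (hbud : P.m + 1 ≤ P.budget) (ht : t ∈ (stepRead p target s).support) :
    SameClient s t ∧ Inv (eraseTarget A p target) g t.level t.queue t.current ∧
      t.work ≤ s.work + P.budget ∧ t.backlog ≤ s.backlog ∧
      ∃ r : State P, ReadRel (fun q i => if q = p then (i : ℕ) + 1 else 0) s r ∧
        (∀ D, (∀ j ∈ r.queue, j.cachedDummies ≤ D) → curDummies r.current ≤ D →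
          curDummies t.current ≤ D) ∧
        ∀ F : ℕ → Job P → Prop, (∀ w w' j, w' ≤ w → F w j → F w' j) →
          PrefixAll F (curWork r.current) r.queue →
          PrefixAll F (curWork t.current) t.queue := by
  obtain ⟨r, hr, ht⟩ := (PMF.mem_support_bind_iff _ _ _).1 ht
  obtain rfl := (PMF.mem_support_pure_iff _ _).1 ht
  obtain ⟨h1, h2, h3⟩ := cReadPartition_spec h hr
  have hA' : ∀ q, (eraseTarget A p target q).card ≤ P.capacity := by
    intro q
    refine (Finset.card_le_card ?_).trans (hA q)
    unfold eraseTarget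
    split
    · exact subset_rfl
    · split
      · exact Finset.erase_subset _ _
      · exact subset_rfl
  obtain ⟨k1, k2, k3, k4, k5, k6⟩ := perform_spec h1 hA' (P.budget - (r.work - s.work))
  have hw := h3.work_le
  have hb : r.backlog = s.backlog := by
    obtain ⟨f, hf, hf'⟩ := h3.queue
    rw [backlog_eq, backlog_eq, h3.cur_work, hf, List.map_map]
    congr 2
    apply List.map_congr_left
    intro j hj
    simp [(hf' j hj).2.1]
  refine ⟨h3.same.trans k1, h1.perform hA' _, by omega, by omega,
    r, h3, k5, ?_⟩
  intro F hF hP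
  exact (k6 F hF hP).imp le_rfl fun w w' j _ hw hFw => hF _ _ j (by omega) hFw

theorem seqCount_succ (p : Part P) (E : ℕ) :
    seqCount p (E + 1) = seqCount p E + if (E + 1) % 2 ^ P.m = (p : ℕ) then 1 else 0 :=
  Nat.count_succ _ _

theorem Schedule.cnt_succ_left (σ : Schedule P) (q : Part P) (t E : ℕ) :
    σ.cnt q (t + 1) E = σ.cnt q t E + if q = σ.reads t then 1 else 0 := by
  unfold Schedule.cnt Schedule.pig
  rw [Nat.count_succ]
  by_cases h : q = σ.reads t
  · rw [if_pos h, if_pos h.symm]; omega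
  · rw [if_neg h, if_neg (Ne.symm h)]; omega

theorem Schedule.evs_succ (σ : Schedule P) (t : ℕ) : σ.evs (t + 1) = σ.evs t + σ.eta t :=
  Finset.sum_range_succ _ _

theorem Schedule.evs_mono (σ : Schedule P) {t t' : ℕ} (h : t ≤ t') : σ.evs t ≤ σ.evs t' :=
  Finset.sum_le_sum_of_subset (Finset.range_mono h)

/-- The invariant after the read of a request. -/
theorem Ghost.read {t : ℕ} (h : Ghost σ β τ δ γ (fun _ _ => 0) t t (σ.evs t) s)
    (hσ : σ.Good M β τ δ γ) (ht : t < M) {s₂ : State P}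
    (hs : s₂ ∈ (readStep (σ.req t) (σ.rho t) s).support) :
    Ghost σ β τ δ γ (fun q i => if q = σ.reads t then (i : ℕ) + 1 else 0) (t + 1) t (σ.evs t)
      { s₂ with slot := Function.update s₂.slot (σ.rho t) (s₂.slot (σ.rho t) ++ [σ.req t]) } ∧
    s₂.scan = s.scan ∧ s₂.work ≤ P.budget := by
  set u := σ.req t with hu
  set r := σ.rho t with hr
  set p := σ.reads t with hp
  have hpu : s.position u = p := by rw [h.position]; rfl
  have hE : σ.evs t ≤ σ.evs M := σ.evs_mono ht.le
  have htot : ∑ p, (s.slot p).length ≤ γ := hσ.cache t ht.le _ fun p => h.slot_len p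
  -- the slots after `u` has been taken out
  obtain ⟨sl, target, hstep, hsl1, hsl2, hsl3, hsub⟩ : ∃ (sl : Part P → List (Block P))
      (target : Option (Block P)),
      s₂ ∈ (stepRead p target { s with
        position := Function.update s.position u r, work := 0, slot := sl }).support ∧
      (∀ q, (sl q).Sublist (s.slot q)) ∧ (∀ q, u ∉ sl q) ∧
      (∀ q v, v ≠ u → v ∉ s.slot q → v ∉ sl q) ∧
      (∀ q v, v ∈ eraseTarget (srvBlocks s.position s.slot) p target q →
        v ≠ u ∧ s.position v = q ∧ v ∉ s.slot q) := by
    have hother : ∀ q, q ≠ p → u ∉ s.slot q := by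
      intro q hq hmem
      exact hq ((h.slot_pos q u hmem).symm.trans hpu)
    unfold readStep at hs
    simp only [hpu] at hs
    by_cases hmem : u ∈ s.slot p
    · rw [if_pos hmem] at hs
      refine ⟨_, none, hs, ?_, ?_, ?_, ?_⟩
      · intro q
        by_cases hq : q = p
        · subst hq; simpa using List.erase_sublist
        · simp [hq]
      · intro q
        by_cases hq : q = p
        · rw [hq]; simpa using (h.slot_nodup p).not_mem_erase
        · simpa [hq] using hother q hq
      · intro q v hv hvs
        by_cases hq : q = p
        · subst hq
          simp only [Function.update_self]
          exact fun h1 => hvs (List.mem_of_mem_erase h1)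
        · simpa [hq] using hvs
      · intro q v hv
        simp only [eraseTarget, srvBlocks, Finset.mem_filter, Finset.mem_univ, true_and] at hv
        refine ⟨?_, hv.1, hv.2⟩
        rintro rfl
        rw [hpu] at hv
        exact hv.2 (hv.1 ▸ hmem)
    · rw [if_neg hmem] at hs
      have hno : ∀ q, u ∉ s.slot q := by
        intro q
        by_cases hq : q = p
        · rw [hq]; exact hmem
        · exact hother q hq
      refine ⟨s.slot, some u, hs, fun q => List.Sublist.refl _, hno, fun q v _ h => h, ?_⟩
      intro q v hv
      simp only [eraseTarget] at hv
      split at hv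
      · rw [Finset.mem_erase] at hv
        simp only [srvBlocks, Finset.mem_filter, Finset.mem_univ, true_and] at hv
        exact hv
      · rename_i hq
        simp only [srvBlocks, Finset.mem_filter, Finset.mem_univ, true_and] at hv
        refine ⟨?_, hv⟩
        rintro rfl
        exact hq (hv.1.symm.trans hpu)
  have hA : ∀ q, (srvBlocks s.position s.slot q).card ≤ P.capacity :=
    fun q => hσ.srvBlocks_card ht.le h.position _ q
  obtain ⟨k1, k2, k3, k4, rr, k5, k6, k7⟩ := stepRead_spec (s := { s with
        position := Function.update s.position u r, work := 0, slot := sl })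
        h.inv hA hσ.budget_ge hstep
  have hposn : s₂.position = Function.update s.position u r := k1.position
  have hslot : s₂.slot = sl := k1.slot
  refine ⟨?_, k1.scan, k3.trans (by show 0 + P.budget ≤ _; omega)⟩
  have hnew : ∀ q, Function.update s₂.slot r (s₂.slot r ++ [u]) q =
      if q = r then sl r ++ [u] else sl q := by
    intro q
    rw [hslot]
    by_cases hq : q = r
    · subst hq; simp
    · simp [hq]
  have hlen : ∀ q, (Function.update s₂.slot r (s₂.slot r ++ [u]) q).length ≤
      (s.slot q).length + if r = q then 1 else 0 := by
    intro q
    rw [hnew]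
    have := (hsl1 q).length_le
    by_cases hq : q = r
    · subst hq; simpa using this
    · simpa [hq, Ne.symm hq] using this
  have harr : ∀ q, σ.arr q (t + 1) = σ.arr q t + if r = q then 1 else 0 :=
    fun q => Nat.count_succ _ _
  have hP : PrefixAll (JobOK σ β τ (fun q i => if q = p then (i : ℕ) + 1 else 0) t (σ.evs t))
      (curWork rr.current) rr.queue := by
    obtain ⟨f, hf, hf'⟩ := k5.queue
    rw [k5.cur_work, hf]
    refine h.jobs.map f ?_
    rintro w j hj ⟨age, k, T₀, E₀, h1, h2, h3, h4, h5, h6, h7⟩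
    obtain ⟨b1, b2, b3⟩ := hf' j hj
    refine ⟨b2, age, k, T₀, E₀, h1, h2, h3, h4, b1 ▸ h5, ?_, ?_⟩
    · rw [b1, b2]
      dsimp only at b3 h6 ⊢
      omega
    · rw [b1, b2]; exact h7
  constructor
  · show s₂.position = _
    rw [hposn, h.position]; rfl
  · intro q
    show (Function.update s₂.slot r (s₂.slot r ++ [u]) q).Nodup
    rw [hnew]
    split
    · rw [List.nodup_append]
      refine ⟨(h.slot_nodup r).sublist (hsl1 r), by simp, ?_⟩
      intro a ha b hb
      rw [List.mem_singleton.1 hb]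
      rintro rfl
      exact hsl2 r ha
    · exact (h.slot_nodup q).sublist (hsl1 q)
  · intro q v hv
    change v ∈ Function.update s₂.slot r (s₂.slot r ++ [u]) q at hv
    show s₂.position v = q
    rw [hnew] at hv
    rw [hposn]
    have hold : ∀ q, v ∈ sl q → Function.update s.position u r v = q := by
      intro q hv
      have hvu : v ≠ u := by rintro rfl; exact hsl2 q hv
      rw [Function.update_of_ne hvu]
      exact h.slot_pos q v ((hsl1 q).subset hv)
    split at hv
    · rename_i hq
      rcases List.mem_append.1 hv with hv | hv
      · rw [hq]; exact hold r hv
      · rw [List.mem_singleton.1 hv, Function.update_self, hq]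
    · exact hold q hv
  · refine k2.mono fun q v hv => ?_
    obtain ⟨a1, a2, a3⟩ := hsub q v hv
    show v ∈ srvBlocks s₂.position (Function.update s₂.slot r (s₂.slot r ++ [u])) q
    simp only [srvBlocks, Finset.mem_filter, Finset.mem_univ, true_and, hnew, hposn,
      Function.update_of_ne a1]
    refine ⟨a2, ?_⟩
    split
    · rename_i hq
      rw [List.mem_append, List.mem_singleton]
      rintro (h1 | h1)
      · exact hsl3 r v a1 (hq ▸ a3) h1
      · exact a1 h1
    · exact hsl3 q v a1 a3
  · intro q
    show s₂.counter q = _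
    rw [k1.counter]
    exact h.counter q
  · intro q
    have h1 := hlen q
    show (Function.update s₂.slot r (s₂.slot r ++ [u]) q).length = 0 ∨ ∃ t₀ ≤ t,
      (Function.update s₂.slot r (s₂.slot r ++ [u]) q).length + _ + _ ≤ _
    rw [harr]
    rcases h.slot_len q with h2 | ⟨t₀, h2, h3⟩
    -- If the slot was empty, counting restarts at `t₀ = t`, with the new block as the only possible
    -- arrival.
    · right; exact ⟨t, le_rfl, by omega⟩
    · right; exact ⟨t₀, h2, by omega⟩
  · show ∑ q, (Function.update s₂.slot r (s₂.slot r ++ [u]) q).length ≤ _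
    refine (Finset.sum_le_sum fun q _ => hlen q).trans ?_
    rw [Finset.sum_add_distrib, Finset.sum_ite_eq]
    simpa using htot
  · obtain ⟨T₀, hT₀, E₀, hE₀, h1⟩ := h.backlog
    refine ⟨T₀, hT₀, E₀, hE₀, le_trans (Nat.add_le_add_right ?_ _) h1⟩
    exact k4
  · refine k7 _ ?_ ?_
    · rintro w w' j hw ⟨age, k, T₀, E₀, h1, h2, h3, h4⟩
      exact ⟨age, k, T₀, E₀, h1, h2, by omega, h4⟩
    · exact hP
  · refine k6 δ ?_ ?_
    -- Every cached dummy is part of the size of its job, and a single job is bounded by `chain`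
    -- with `b` supported on its partition.
    · intro j hj
      obtain ⟨w, hw⟩ := hP.forall j hj
      have hch := jobOK_chain hσ (fun q i => by split <;> omega) hw
      have := hσ.chain t ht.le (σ.evs t) hE (fun q => if q = j.part then j.size else 0) ?_
      · rw [Finset.sum_ite_eq'] at this
        simp only [Finset.mem_univ, if_true] at this
        exact (Nat.le_add_left _ _).trans this
      · intro q
        by_cases hq : q = j.part
        · right; subst hq; simpa using hch
        · left; simp [hq]
    · rw [k5.cur_dummies]; exact h.dummies

theorem finRotate_val {n : ℕ} (i : Fin n) : (finRotate n i : ℕ) = ((i : ℕ) + 1) % n := by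
  cases n with
  | zero => exact i.elim0
  | succ n => rw [finRotate_apply, Fin.val_add, Fin.val_one', Nat.add_mod_mod]

/-- The scan pointer advances before each eviction, so eviction number `e`, counted from zero, hits
the partition `(e + 1) % 2 ^ m`, as in `seqCount`. -/
theorem seqEvict_spec (hσ : σ.Good M β τ δ γ) (n : ℕ) {R T E : ℕ} {s : State P}
    (h : Ghost σ β τ δ γ (fun _ _ => 0) R T E s) (hscan : (s.scan : ℕ) = E % 2 ^ P.m)
    (hR : R ≤ M) (hT : T ≤ M) (hE : E + n ≤ σ.evs M) :
    (∀ t ∈ seqEvict n s, Fine β δ γ t) ∧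
      Ghost σ β τ δ γ (fun _ _ => 0) R T (E + n) ((seqEvict n s).getLast?.getD s) ∧
      (((seqEvict n s).getLast?.getD s).scan : ℕ) = (E + n) % 2 ^ P.m ∧
      ((seqEvict n s).getLast?.getD s).work ≤ s.work + n * P.budget := by
  induction n generalizing E s with
  | zero => exact ⟨by simp [seqEvict], by simpa [seqEvict] using h, by simpa [seqEvict] using hscan,
      by simp [seqEvict]⟩
  | succ n ih =>
    set p := finRotate (2 ^ P.m) s.scan with hp
    have hpv : (p : ℕ) = (E + 1) % 2 ^ P.m := by
      rw [hp, finRotate_val, hscan, Nat.mod_add_mod]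
    set s₁ : State P := { s with scan := p } with hs₁
    have h1 : Ghost σ β τ δ γ (fun _ _ => 0) R T E s₁ :=
      ⟨h.position, h.slot_nodup, h.slot_pos, h.inv, h.counter, h.slot_len, h.total, h.backlog,
        h.jobs, h.dummies⟩
    obtain ⟨h2, h3, h4⟩ := h1.evict hσ (p := p) (T' := T) (E' := E + 1) hR le_rfl (Nat.le_succ _)
      hT (by omega) (fun q i => Nat.zero_le _) (by omega) (by
        intro q
        unfold Schedule.cnt
        rw [seqCount_succ, ← hpv]
        by_cases hq : q = p
        · subst hq; simp [add_assoc]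
        · have : ¬ (p : ℕ) = q := fun h => hq (Fin.ext h.symm)
          simp [hq, this])
    have hfine := h2.fine hσ hR hT (by omega) (fun _ _ => Nat.zero_le _)
    obtain ⟨k1, k2, k3, k4⟩ := ih h2 (by rw [h3]; exact hpv) (by omega)
    have hseq : seqEvict (n + 1) s = evict p s₁ :: seqEvict n (evict p s₁) := rfl
    rw [hseq, List.getLast?_cons, Option.getD_some]
    refine ⟨?_, by rw [show E + (n + 1) = E + 1 + n by omega]; exact k2,
      by rw [show E + (n + 1) = E + 1 + n by omega]; exact k3, ?_⟩
    · intro t ht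
      rcases List.mem_cons.1 ht with rfl | ht
      · exact hfine
      · exact k1 t ht
    · have : s₁.work = s.work := rfl
      rw [add_mul, one_mul]; omega

theorem accessWith_spec (hσ : σ.Good M β τ δ γ) {t : ℕ} (ht : t < M)
    (h : Ghost σ β τ δ γ (fun _ _ => 0) t t (σ.evs t) s)
    (hscan : (s.scan : ℕ) = σ.evs t % 2 ^ P.m) {seg : List (State P)}
    (hseg : seg ∈ (accessWith (σ.req t) (σ.rho t) (σ.eta t) s).support) :
    (∀ s' ∈ seg, Fine β δ γ s') ∧ requestCost seg ≤ (2 + σ.eta t) * P.budget ∧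
      Ghost σ β τ δ γ (fun _ _ => 0) (t + 1) (t + 1) (σ.evs (t + 1)) (seg.getLast?.getD s) ∧
      ((seg.getLast?.getD s).scan : ℕ) = σ.evs (t + 1) % 2 ^ P.m := by
  obtain ⟨s₂, hs₂, hseg⟩ := (PMF.mem_support_bind_iff _ _ _).1 hseg
  obtain ⟨h1, h2, h3⟩ := h.read hσ ht hs₂
  set s₃ : State P := { s₂ with
    slot := Function.update s₂.slot (σ.rho t) (s₂.slot (σ.rho t) ++ [σ.req t]) } with hs₃
  have hp : s.position (σ.req t) = σ.reads t := by rw [h.position]; rfl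
  have hseg' : seg = s₃ :: evict (σ.reads t) s₃ :: seqEvict (σ.eta t) (evict (σ.reads t) s₃) := by
    rw [← hp]; exact (PMF.mem_support_pure_iff _ _).1 hseg
  have hE : σ.evs t + σ.eta t ≤ σ.evs M := by rw [← σ.evs_succ]; exact σ.evs_mono ht
  have hE' : σ.evs t ≤ σ.evs M := by omega
  have hf3 := h1.fine hσ ht ht.le hE' (fun q i => by split <;> omega)
  obtain ⟨k1, k2, k3⟩ := h1.evict hσ (p := σ.reads t) (T' := t + 1) (E' := σ.evs t) ht
    (Nat.le_succ t) le_rfl ht hE' (fun q i => le_rfl) (by omega) (fun q => σ.cnt_succ_left q t _)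
  have hf4 := k1.fine hσ ht ht hE' (fun _ _ => Nat.zero_le _)
  obtain ⟨l1, l2, l3, l4⟩ := seqEvict_spec hσ (σ.eta t) k1 (by rw [k2]; exact h2 ▸ hscan) ht ht hE
  have hlast : ∀ d, seg.getLast?.getD d =
      (seqEvict (σ.eta t) (evict (σ.reads t) s₃)).getLast?.getD (evict (σ.reads t) s₃) := by
    intro d
    rw [hseg', List.getLast?_cons_cons, List.getLast?_cons, Option.getD_some]
  refine ⟨?_, ?_, ?_, ?_⟩
  · intro s' hs'
    rw [hseg'] at hs'
    rcases List.mem_cons.1 hs' with rfl | hs'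
    · exact hf3
    rcases List.mem_cons.1 hs' with rfl | hs'
    · exact hf4
    · exact l1 s' hs'
  · have hcost : requestCost seg = (seg.getLast?.getD s₃).work := by
      unfold requestCost
      rw [hseg', List.getLast?_cons_cons, List.getLast?_cons]
      rfl
    have : s₃.work = s₂.work := rfl
    rw [hcost, hlast, add_mul]
    omega
  · rw [hlast, σ.evs_succ]; exact l2
  · rw [hlast, σ.evs_succ]; exact l3

/-- `n` requests of the schedule from request `t` on. -/
noncomputable def runFrom (σ : Schedule P) : ℕ → ℕ → State P → PMF (List (List (State P)))
  | 0, _, _ => PMF.pure []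
  | n + 1, t, s =>
    (accessWith (σ.req t) (σ.rho t) (σ.eta t) s).bind fun seg =>
      (runFrom σ n (t + 1) (seg.getLast?.getD s)).bind fun rest => PMF.pure (seg :: rest)

theorem runFrom_spec (hσ : σ.Good M β τ δ γ) {c : ℕ} (hη : ∀ t, σ.eta t ≤ c) (n : ℕ) {t : ℕ}
    {s : State P} (ht : t + n ≤ M)
    (h : Ghost σ β τ δ γ (fun _ _ => 0) t t (σ.evs t) s)
    (hscan : (s.scan : ℕ) = σ.evs t % 2 ^ P.m) {tr : List (List (State P))}
    (htr : tr ∈ (runFrom σ n t s).support) :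
    tr.length = n ∧ ∀ seg ∈ tr, (∀ s' ∈ seg, Fine β δ γ s') ∧
      requestCost seg ≤ (2 + c) * P.budget := by
  induction n generalizing t s tr with
  | zero =>
    obtain rfl := (PMF.mem_support_pure_iff _ _).1 htr
    simp
  | succ n ih =>
    obtain ⟨seg, hseg, htr⟩ := (PMF.mem_support_bind_iff _ _ _).1 htr
    obtain ⟨rest, hrest, htr⟩ := (PMF.mem_support_bind_iff _ _ _).1 htr
    obtain rfl := (PMF.mem_support_pure_iff _ _).1 htr
    obtain ⟨h1, h2, h3, h4⟩ := accessWith_spec hσ (by omega) h hscan hseg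
    obtain ⟨k1, k2⟩ := ih (by omega) h3 h4 hrest
    refine ⟨by simp [k1], ?_⟩
    intro seg' hseg'
    rcases List.mem_cons.1 hseg' with rfl | hseg'
    · exact ⟨h1, h2.trans (Nat.mul_le_mul_right _ (by have := hη t; omega))⟩
    · exact k2 seg' hseg'

/-- At the start all real blocks are in the top levels, so the bounds for low levels hold whatever
the counters are; the load condition at time `0` makes the top levels fit. -/
theorem ghost_initial (hσ : σ.Good M β τ δ γ) (fill : Part P → Fin (2 ^ P.m))
    (hfill : ∀ p, σ.fill p = fill p) :
    Ghost σ β τ δ γ (fun _ _ => 0) 0 0 (σ.evs 0) (initialState P σ.pos fill) := by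
  have hev : σ.evs 0 = 0 := rfl
  have hcnt : ∀ p, σ.cnt p 0 0 = 0 := fun p => by simp [Schedule.cnt, Schedule.pig, seqCount]
  have hreal : ∀ p l, ((initialState P σ.pos fill).level p l).real =
      if (l : ℕ) = P.m then Finset.univ.filter (fun u => σ.pos u = p) else ∅ := by
    intro p l
    simp only [initialState]
    split
    · rfl
    · split <;> rfl
  have hsub : ∀ p l, ((initialState P σ.pos fill).level p l).real ⊆
      Finset.univ.filter (fun u => σ.pos u = p) := by
    intro p l
    rw [hreal]; split
    · exact subset_rfl
    · exact Finset.empty_subset _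
  have hload := hσ.load 0 (Nat.zero_le _)
  have hcard : ∀ p l, ((initialState P σ.pos fill).level p l).real.card ≤ slots P l := by
    intro p l
    rw [hreal]; split
    · rename_i hl
      refine (hload p).trans ?_
      simp only [slots, half, hl, if_true]
      omega
    · simp
  have hdisj : ∀ p l l', l ≠ l' → Disjoint ((initialState P σ.pos fill).level p l).real
      ((initialState P σ.pos fill).level p l').real := by
    intro p l l' hll
    rw [hreal, hreal]
    by_cases h1 : (l : ℕ) = P.m
    · have : ¬ (l' : ℕ) = P.m := fun h2 => hll (Fin.ext (h1.trans h2.symm))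
      simp [this]
    · simp [h1]
  constructor
  · rfl
  · intro p; exact List.nodup_nil
  · intro p v hv; simp [initialState] at hv
  · have hA : ∀ p, srvBlocks (initialState P σ.pos fill).position
        (initialState P σ.pos fill).slot p = Finset.univ.filter (fun u => σ.pos u = p) := by
      intro p; simp [srvBlocks, initialState]
    constructor
    · intro p l; rw [hA]; exact hsub p l
    · intro p l; rw [hA]; exact hsub p l
    · intro j hj; simp [initialState] at hj
    · exact hdisj
    · exact hdisj
    · intro j hj; simp [initialState] at hj
    · exact List.nodup_nil
    · intro p l hf
      rw [hreal, if_neg]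
      intro hl
      simp [initialState, hl, Level.build] at hf
    · intro p l
      simp only [initialState]
      split
      · rename_i hl
        refine max_le le_rfl ((hload p).trans ?_)
        simp only [slots, half, hl, if_true]
        omega
      · split
        · exact max_le le_rfl (by simp)
        · exact Nat.zero_le _
    · exact hcard
    · intro c hc; simp [initialState] at hc
    · intro c hc; simp [initialState] at hc
    · intro c hc; simp [initialState] at hc
    · intro p i hi _
      refine le_trans (le_of_eq ?_) (Nat.zero_le _)
      apply Finset.sum_eq_zero
      intro l hl
      have h1 : (l : ℕ) ≤ i := by simpa using hl
      show ((initialState P σ.pos fill).level p l).real.card = 0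
      rw [hreal, if_neg (by omega), Finset.card_empty]
    · intro j hj; simp [initialState] at hj
  · intro p
    rw [hev, hcnt, add_zero, hfill]
    rfl
  · intro p; left; rfl
  · simp [initialState]
  · refine ⟨0, le_rfl, 0, le_rfl, ?_⟩
    simp [hev, backlog_eq, initialState, curWork]
  · trivial
  · exact Nat.zero_le _

/-- Every execution of a good schedule meets the cost and storage bounds. -/
theorem runFrom_initial (hσ : σ.Good M β τ δ γ) {c : ℕ} (hη : ∀ t, σ.eta t ≤ c)
    (fill : Part P → Fin (2 ^ P.m)) (hfill : ∀ p, σ.fill p = fill p)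
    {tr : List (List (State P))}
    (htr : tr ∈ (runFrom σ M 0 (initialState P σ.pos fill)).support) :
    tr.length = M ∧ ∀ seg ∈ tr, (∀ s' ∈ seg, Fine β δ γ s') ∧
      requestCost seg ≤ (2 + c) * P.budget :=
  runFrom_spec hσ hη M (by omega) (ghost_initial hσ fill hfill) rfl htr

end PartitionORAM

namespace PartitionORAM

/-! ### Finite product distributions -/

section PMFs

variable {α β ι : Type*}

theorem toOuterMeasure_le_one (p : PMF α) (S : Set α) : p.toOuterMeasure S ≤ 1 := by
  rw [PMF.toOuterMeasure_apply, ← p.tsum_coe]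
  exact ENNReal.tsum_le_tsum fun a => Set.indicator_le_self' (fun _ _ => zero_le) a

/-- A union bound: an event has small probability if it has small conditional probability outside
of an event of small probability. -/
theorem toOuterMeasure_bind_le (p : PMF α) (q : α → PMF β) (S : Set β) (B : Set α) (ε : ℝ≥0∞)
    (h : ∀ a ∉ B, (q a).toOuterMeasure S ≤ ε) :
    (p.bind q).toOuterMeasure S ≤ p.toOuterMeasure B + ε := by
  rw [PMF.toOuterMeasure_bind_apply, PMF.toOuterMeasure_apply]
  calc ∑' a, p a * (q a).toOuterMeasure S ≤ ∑' a, (B.indicator p a + p a * ε) := by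
        refine ENNReal.tsum_le_tsum fun a => ?_
        by_cases ha : a ∈ B
        · rw [Set.indicator_of_mem ha]
          calc p a * (q a).toOuterMeasure S ≤ p a * 1 := by gcongr; exact toOuterMeasure_le_one _ _
            _ ≤ _ := by rw [mul_one]; exact le_self_add
        · rw [Set.indicator_of_notMem ha, zero_add]
          gcongr
          exact h a ha
    _ = _ := by rw [ENNReal.tsum_add, ENNReal.tsum_mul_right, p.tsum_coe, one_mul]

theorem toOuterMeasure_eq_zero_of_support {p : PMF α} {S : Set α} (h : ∀ a ∈ p.support, a ∉ S) :
    p.toOuterMeasure S = 0 := by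
  rw [PMF.toOuterMeasure_apply_eq_zero_iff, Set.disjoint_left]
  exact h

theorem le_toOuterMeasure_of_compl {p : PMF α} {S : Set α} {ε : ℝ} (hε : 0 ≤ ε)
    (h : p.toOuterMeasure Sᶜ ≤ ENNReal.ofReal ε) :
    ENNReal.ofReal (1 - ε) ≤ p.toOuterMeasure S := by
  rw [ENNReal.ofReal_sub _ hε, ENNReal.ofReal_one, tsub_le_iff_right]
  calc (1 : ℝ≥0∞) = ∑' a, p a := p.tsum_coe.symm
    _ = ∑' a, (S.indicator p a + Sᶜ.indicator p a) := by
        simp_rw [Set.indicator_self_add_compl_apply]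
    _ = p.toOuterMeasure S + p.toOuterMeasure Sᶜ := by
        rw [ENNReal.tsum_add, PMF.toOuterMeasure_apply, PMF.toOuterMeasure_apply]
    _ ≤ _ := by gcongr

/-- The expectation of a real function on a finite type. -/
noncomputable def mean [Fintype α] (p : PMF α) (F : α → ℝ) : ℝ := ∑ a, (p a).toReal * F a

theorem mean_mono [Fintype α] (p : PMF α) {F G : α → ℝ} (h : ∀ a, F a ≤ G a) :
    mean p F ≤ mean p G :=
  Finset.sum_le_sum fun a _ => mul_le_mul_of_nonneg_left (h a) ENNReal.toReal_nonneg

theorem mean_nonneg [Fintype α] (p : PMF α) {F : α → ℝ} (h : ∀ a, 0 ≤ F a) : 0 ≤ mean p F :=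
  Finset.sum_nonneg fun a _ => mul_nonneg ENNReal.toReal_nonneg (h a)

theorem sum_coe_fintype [Fintype α] (p : PMF α) : ∑ a, p a = 1 := by
  have := p.tsum_coe
  rwa [tsum_fintype] at this

theorem mean_const [Fintype α] (p : PMF α) (c : ℝ) : mean p (fun _ => c) = c := by
  unfold mean
  rw [← Finset.sum_mul, ← ENNReal.toReal_sum fun a _ => p.apply_ne_top a,
    sum_coe_fintype, ENNReal.toReal_one, one_mul]

theorem mean_sum [Fintype α] {κ : Type*} (p : PMF α) (s : Finset κ) (F : κ → α → ℝ) :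
    mean p (fun a => ∑ k ∈ s, F k a) = ∑ k ∈ s, mean p (F k) := by
  unfold mean
  simp_rw [Finset.mul_sum]
  exact Finset.sum_comm

theorem mean_const_mul [Fintype α] (p : PMF α) (c : ℝ) (F : α → ℝ) :
    mean p (fun a => c * F a) = c * mean p F := by
  unfold mean
  rw [Finset.mul_sum]
  exact Finset.sum_congr rfl fun a _ => by ring

theorem mean_add [Fintype α] (p : PMF α) (F G : α → ℝ) :
    mean p (fun a => F a + G a) = mean p F + mean p G := by
  unfold mean
  rw [← Finset.sum_add_distrib]
  exact Finset.sum_congr rfl fun a _ => by ring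

/-- Markov's inequality. -/
theorem toOuterMeasure_le_mean [Fintype α] (p : PMF α) {F : α → ℝ} (hF : ∀ a, 0 ≤ F a)
    {B : Set α} (hB : ∀ a ∈ B, 1 ≤ F a) : p.toOuterMeasure B ≤ ENNReal.ofReal (mean p F) := by
  rw [PMF.toOuterMeasure_apply, tsum_fintype, mean,
    ENNReal.ofReal_sum_of_nonneg fun a _ => mul_nonneg ENNReal.toReal_nonneg (hF a)]
  refine Finset.sum_le_sum fun a _ => ?_
  by_cases ha : a ∈ B
  · rw [Set.indicator_of_mem ha, ENNReal.ofReal_mul ENNReal.toReal_nonneg,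
      ENNReal.ofReal_toReal (p.apply_ne_top a)]
    calc p a = p a * 1 := (mul_one _).symm
      _ ≤ _ := by gcongr; exact ENNReal.one_le_ofReal.2 (hB a ha)
  · rw [Set.indicator_of_notMem ha]; exact zero_le

theorem toOuterMeasure_iUnion_le [Fintype α] {κ : Type*} (p : PMF α) (s : Finset κ)
    (B : κ → Set α) {ε : ℝ} (hB : ∀ k ∈ s, p.toOuterMeasure (B k) ≤ ENNReal.ofReal ε) :
    p.toOuterMeasure {a | ∃ k ∈ s, a ∈ B k} ≤ ENNReal.ofReal (s.card * ε) := by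
  have h1 : {a | ∃ k ∈ s, a ∈ B k} = ⋃ k ∈ s, B k := by ext; simp
  rw [h1]
  refine (MeasureTheory.measure_biUnion_finset_le s B).trans ?_
  refine (Finset.sum_le_sum hB).trans ?_
  rw [Finset.sum_const, nsmul_eq_mul, ENNReal.ofReal_mul (Nat.cast_nonneg _), ENNReal.ofReal_natCast]

/-- The product of copies of a distribution. -/
noncomputable def piPMF [Fintype ι] [DecidableEq ι] [Fintype α] (D : PMF α) : PMF (ι → α) :=
  PMF.ofFintype (fun f => ∏ i, D (f i)) (by
    rw [← Fintype.piFinset_univ, ← Finset.prod_univ_sum, sum_coe_fintype,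
      Finset.prod_const_one])

theorem piPMF_apply [Fintype ι] [DecidableEq ι] [Fintype α] (D : PMF α) (f : ι → α) :
    piPMF D f = ∏ i, D (f i) := by
  rw [piPMF, PMF.ofFintype_apply]

theorem mean_piPMF [Fintype ι] [DecidableEq ι] [Fintype α] (D : PMF α) (F : ι → α → ℝ) :
    mean (piPMF D) (fun f => ∏ i, F i (f i)) = ∏ i, mean D (F i) := by
  unfold mean
  rw [Finset.prod_univ_sum, Fintype.piFinset_univ]
  refine Finset.sum_congr rfl fun f _ => ?_
  rw [piPMF_apply, ENNReal.toReal_prod, ← Finset.prod_mul_distrib]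

/-- Two independent draws, regrouped by a bijection, have law `W` as soon as the point masses agree.
Product distributions are split in this way below. -/
theorem bind_bind_pure_equiv {γ : Type*} (p : PMF α) (q : PMF β) (e : α × β ≃ γ) (W : PMF γ)
    (h : ∀ a b, W (e (a, b)) = p a * q b) :
    (p.bind fun a => q.bind fun b => PMF.pure (e (a, b))) = W := by
  ext z
  obtain ⟨⟨a₀, b₀⟩, rfl⟩ := e.surjective z
  rw [PMF.bind_apply, tsum_eq_single a₀, PMF.bind_apply, tsum_eq_single b₀, h]
  · simp
  · intro b hb
    simp [Ne.symm hb]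
  · intro a ha
    rw [PMF.bind_apply]
    simp [Ne.symm ha]

theorem piPMF_fin_succ [Fintype α] (D : PMF α) (n : ℕ) :
    (piPMF D : PMF (Fin (n + 1) → α)) =
      D.bind fun x => (piPMF D : PMF (Fin n → α)).bind fun f => PMF.pure (Fin.cons x f) := by
  refine (bind_bind_pure_equiv D (piPMF D : PMF (Fin n → α))
    (Fin.consEquiv fun _ => α) (piPMF D) fun a b => ?_).symm
  rw [piPMF_apply, piPMF_apply, Fin.prod_univ_succ]
  simp [Fin.consEquiv]

theorem piPMF_sum {κ : Type*} [Fintype ι] [Fintype κ] [DecidableEq ι] [DecidableEq κ] [Fintype α] (D : PMF α) :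
    (piPMF D : PMF (ι ⊕ κ → α)) = (piPMF D : PMF (ι → α)).bind fun f =>
      (piPMF D : PMF (κ → α)).bind fun k => PMF.pure (Sum.elim f k) := by
  refine (bind_bind_pure_equiv _ (piPMF D : PMF (κ → α))
    (Equiv.sumArrowEquivProdArrow ι κ α).symm (piPMF D) fun a b => ?_).symm
  rw [piPMF_apply, piPMF_apply, piPMF_apply, Fintype.prod_sum_type]
  simp [Equiv.sumArrowEquivProdArrow]

theorem uniformOfFintype_eq_piPMF [Fintype ι] [DecidableEq ι] [Fintype α] [Nonempty α] :
    PMF.uniformOfFintype (ι → α) = piPMF (PMF.uniformOfFintype α) := by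
  ext f
  rw [piPMF_apply]
  simp only [PMF.uniformOfFintype_apply, Finset.prod_const, Finset.card_univ, Fintype.card_fun]
  rw [← ENNReal.inv_pow]
  norm_cast

end PMFs

/-! ### The execution as a mixture over schedules -/

variable {P : Params}

/-- The schedule determined by the request sequence and the random choices. -/
def schedule (P : Params) (requests : List (Block P)) (d : Block P ⊕ Fin requests.length → Part P)
    (fill : Part P → Fin (2 ^ P.m)) (η : Fin requests.length → Fin (P.maxEvict + 1)) :
    Schedule P where
  req t := requests.getD t ⟨0, by positivity⟩
  pos u := d (Sum.inl u)
  rho t := if h : t < requests.length then d (Sum.inr ⟨t, h⟩) else ⟨0, by positivity⟩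
  eta t := if h : t < requests.length then η ⟨t, h⟩ else 0
  fill p := fill p

/-- The number of sequential evictions does not depend on the outcome of the read, so it can be
drawn before the read. -/
theorem access_eq (u : Block P) (s : State P) :
    access u s = (PMF.uniformOfFintype (Part P)).bind fun r =>
      (boundedGeometric P.maxEvict P.ratio).bind fun num => accessWith u r num s := by
  unfold access accessWith
  refine congrArg _ (funext fun r => ?_)
  rw [PMF.bind_comm]
  unfold readStep
  by_cases h : u ∈ s.slot (s.position u)
  · simp only [h, if_true]; rfl
  · simp only [h, if_false]; rfl

theorem runFrom_congr {σ σ' : Schedule P} (n : ℕ) {t t' : ℕ} (s : State P)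
    (h : ∀ i < n, σ.req (t + i) = σ'.req (t' + i) ∧ σ.rho (t + i) = σ'.rho (t' + i) ∧
      σ.eta (t + i) = σ'.eta (t' + i)) : runFrom σ n t s = runFrom σ' n t' s := by
  induction n generalizing t t' s with
  | zero => rfl
  | succ n ih =>
    obtain ⟨h1, h2, h3⟩ := h 0 (Nat.succ_pos n)
    simp only [add_zero] at h1 h2 h3
    unfold runFrom
    rw [h1, h2, h3]
    refine congrArg _ (funext fun seg => ?_)
    rw [ih (t := t + 1) (t' := t' + 1)]
    intro i hi
    have := h (i + 1) (by omega)
    rwa [show t + 1 + i = t + (i + 1) by omega, show t' + 1 + i = t' + (i + 1) by omega]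

/-- All draws that determine the schedule are moved to the front; the random picks of the concurrent
reads remain inside `runFrom`. `pos` and `fill` are arbitrary here because `runFrom` uses only the
requests, new positions and eviction numbers of its schedule. -/
theorem run_eq (us : List (Block P)) (pos : Block P → Part P) (fill : Part P → Fin (2 ^ P.m))
    (s : State P) :
    run us s = (piPMF (PMF.uniformOfFintype (Part P)) : PMF (Fin us.length → Part P)).bind fun ρ =>
      (piPMF (boundedGeometric P.maxEvict P.ratio)).bind fun η =>
        runFrom (schedule P us (Sum.elim pos ρ) fill η) us.length 0 s := by
  induction us generalizing s with
  | nil =>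
    show PMF.pure [] = _
    simp only [List.length_nil, runFrom, PMF.bind_const]
  | cons u us ih =>
    have hstep : ∀ (r : Part P) (num : Fin (P.maxEvict + 1)) (ρ : Fin us.length → Part P)
        (η : Fin us.length → Fin (P.maxEvict + 1)),
        runFrom (schedule P (u :: us) (Sum.elim pos (Fin.cons r ρ : Fin (us.length + 1) → Part P))
          fill (Fin.cons num η : Fin (us.length + 1) → _)) (us.length + 1) 0 s =
        (accessWith u r num s).bind fun seg =>
          (runFrom (schedule P us (Sum.elim pos ρ) fill η) us.length 0
            (seg.getLast?.getD s)).bind fun rest => PMF.pure (seg :: rest) := by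
      intro r num ρ η
      have h0 : (schedule P (u :: us) (Sum.elim pos (Fin.cons r ρ : Fin (us.length + 1) → Part P))
          fill (Fin.cons num η : Fin (us.length + 1) → _)).rho 0 = r := by
        simp [schedule]
      have h1 : (schedule P (u :: us) (Sum.elim pos (Fin.cons r ρ : Fin (us.length + 1) → Part P))
          fill (Fin.cons num η : Fin (us.length + 1) → _)).eta 0 = num := by
        simp [schedule]
      have h2 : (schedule P (u :: us) (Sum.elim pos (Fin.cons r ρ : Fin (us.length + 1) → Part P))
          fill (Fin.cons num η : Fin (us.length + 1) → _)).req 0 = u := by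
        simp [schedule]
      rw [runFrom, h0, h1, h2]
      refine congrArg _ (funext fun seg => ?_)
      rw [runFrom_congr us.length (t := 0 + 1) (t' := 0)
        (σ' := schedule P us (Sum.elim pos ρ) fill η)]
      intro i hi
      refine ⟨?_, ?_, ?_⟩
      · simp only [schedule, zero_add, add_comm 1 i, List.getD_cons_succ]
      · have h3 : i + 1 < (u :: us).length := by simpa using hi
        simp only [schedule, zero_add, add_comm 1 i, hi, h3, dif_pos, Sum.elim_inr]
        exact Fin.cons_succ (α := fun _ => Part P) r ρ ⟨i, hi⟩
      · have h3 : i + 1 < (u :: us).length := by simpa using hi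
        simp only [schedule, zero_add, add_comm 1 i, hi, h3, dif_pos]
        exact congrArg Fin.val (Fin.cons_succ (α := fun _ => Fin (P.maxEvict + 1)) num η ⟨i, hi⟩)
    have hrun : run (u :: us) s = (access u s).bind fun seg =>
        (run us (seg.getLast?.getD s)).bind fun rest => PMF.pure (seg :: rest) := rfl
    rw [hrun, access_eq]
    simp only [List.length_cons]
    rw [piPMF_fin_succ, piPMF_fin_succ]
    simp only [PMF.bind_bind, PMF.pure_bind, hstep]
    refine congrArg _ (funext fun r => ?_)
    rw [PMF.bind_comm (piPMF _ : PMF (Fin us.length → Part P))]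
    refine congrArg _ (funext fun num => ?_)
    simp only [ih]
    simp only [PMF.bind_bind]
    rw [PMF.bind_comm]
    refine congrArg _ (funext fun ρ => ?_)
    rw [PMF.bind_comm]

theorem execution_eq (requests : List (Block P)) :
    execution P requests =
      (piPMF (PMF.uniformOfFintype (Part P)) :
        PMF (Block P ⊕ Fin requests.length → Part P)).bind fun d =>
      (piPMF (PMF.uniformOfFintype (Fin (2 ^ P.m))) : PMF (Part P → _)).bind fun fill =>
      (piPMF (boundedGeometric P.maxEvict P.ratio)).bind fun η =>
        runFrom (schedule P requests d fill η) requests.length 0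
          (initialState P (fun u => d (Sum.inl u)) fill) := by
  have h : execution P requests = (PMF.uniformOfFintype (Block P → Part P)).bind fun pos =>
      (PMF.uniformOfFintype (Part P → Fin (2 ^ P.m))).bind fun fill =>
        run requests (initialState P pos fill) := rfl
  rw [h, piPMF_sum, uniformOfFintype_eq_piPMF, uniformOfFintype_eq_piPMF]
  simp only [PMF.bind_bind, PMF.pure_bind, Sum.elim_inl]
  refine congrArg _ (funext fun pos => ?_)
  rw [PMF.bind_comm]
  refine congrArg _ (funext fun fill => ?_)
  exact run_eq requests pos fill _

end PartitionORAM

namespace PartitionORAM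

/-! ### Exponential moments of occupancy numbers -/

section Occupancy

theorem mean_uniform {κ : Type*} [Fintype κ] [Nonempty κ] (F : κ → ℝ) :
    mean (PMF.uniformOfFintype κ) F = (∑ p, F p) / Fintype.card κ := by
  unfold mean
  simp only [PMF.uniformOfFintype_apply, ENNReal.toReal_inv, ENNReal.toReal_natCast]
  rw [← Finset.mul_sum, div_eq_inv_mul]

/-- The number of balls of `X` in box `p`. -/
def hit {κ ι : Type*} [DecidableEq κ] (X : Finset ι) (d : ι → κ) (p : κ) : ℕ := (X.filter fun x => d x = p).card

theorem hit_eq_sum {κ ι : Type*} [DecidableEq κ] [Fintype ι] [DecidableEq ι] (X : Finset ι) (d : ι → κ) (p : κ) (θ : ℝ) :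
    θ * hit X d p = ∑ x, if d x = p then (if x ∈ X then θ else 0) else 0 := by
  unfold hit
  rw [Finset.card_filter]
  push_cast
  rw [Finset.mul_sum, ← Finset.sum_filter_add_sum_filter_not Finset.univ (fun x => x ∈ X)]
  rw [Finset.filter_mem_eq_inter, Finset.univ_inter]
  have h1 : ∑ x ∈ Finset.univ.filter (fun x => x ∉ X),
      (if d x = p then (if x ∈ X then θ else 0) else 0) = 0 := by
    refine Finset.sum_eq_zero fun x hx => ?_
    have : x ∉ X := by simpa using hx
    simp [this]
  rw [h1, add_zero]
  refine Finset.sum_congr rfl fun x hx => ?_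
  simp [hx]

variable {κ ι : Type*} [Fintype κ] [DecidableEq κ] [Nonempty κ] [Fintype ι] [DecidableEq ι]

/-- Functions of the occupancy numbers of independent balls behave at most as if the numbers were
independent Poisson variables. -/
theorem mean_prod_sum_exp_le {J : Type*} [DecidableEq J] (s : Finset J) (c : κ → J → ℝ)
    (hc : ∀ p j, 0 ≤ c p j) (f : κ → J → ι → ℝ) :
    mean (piPMF (PMF.uniformOfFintype κ)) (fun d : ι → κ =>
      ∏ p, ∑ j ∈ s, c p j * Real.exp (∑ x, if d x = p then f p j x else 0)) ≤
    ∏ p, ∑ j ∈ s, c p j * Real.exp ((∑ x, (Real.exp (f p j x) - 1)) / Fintype.card κ) := by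
  have hcard : (0 : ℝ) < Fintype.card κ := by exact_mod_cast Fintype.card_pos
  -- Expanding the product of sums gives one term per choice `w` of an index for each box. In such a
  -- term every ball contributes a factor that depends on its own box only, so independence applies.
  simp_rw [Finset.prod_univ_sum]
  rw [mean_sum]
  refine Finset.sum_le_sum fun w _ => ?_
  simp_rw [Finset.prod_mul_distrib]
  rw [mean_const_mul]
  refine mul_le_mul_of_nonneg_left ?_ (Finset.prod_nonneg fun p _ => hc p _)
  have h1 : ∀ d : ι → κ, ∏ p, Real.exp (∑ x, if d x = p then f p (w p) x else 0) =
      ∏ x, Real.exp (f (d x) (w (d x)) x) := by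
    intro d
    rw [← Real.exp_sum, Finset.sum_comm, Real.exp_sum]
    refine Finset.prod_congr rfl fun x _ => ?_
    rw [Finset.sum_ite_eq Finset.univ (d x), if_pos (Finset.mem_univ _)]
  simp_rw [h1]
  rw [mean_piPMF (PMF.uniformOfFintype κ) fun x p => Real.exp (f p (w p) x), ← Real.exp_sum,
    ← Finset.sum_div, Finset.sum_comm, Finset.sum_div, Real.exp_sum]
  refine Finset.prod_le_prod (fun x _ => mean_nonneg _ fun _ => (Real.exp_pos _).le) fun x _ => ?_
  -- For one ball the mean of `exp f` is `1` plus the mean of `exp f - 1`; this and `1 + x ≤ exp x`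
  -- give the Poisson-type bound.
  refine le_trans (le_of_eq ?_) (Real.add_one_le_exp _)
  rw [mean_uniform, Finset.sum_sub_distrib, Finset.sum_const, Finset.card_univ, nsmul_eq_mul,
    mul_one, sub_div, div_self hcard.ne', sub_add_cancel]

theorem sum_exp_indicator (X : Finset ι) (θ : ℝ) :
    ∑ x, (Real.exp (if x ∈ X then θ else 0) - 1) = X.card * (Real.exp θ - 1) := by
  have : ∀ x, Real.exp (if x ∈ X then θ else 0) - 1 = if x ∈ X then Real.exp θ - 1 else 0 := by
    intro x; split <;> simp
  simp_rw [this]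
  rw [Finset.sum_ite_mem, Finset.univ_inter, Finset.sum_const, nsmul_eq_mul]

theorem mean_exp_hit_le (X : Finset ι) (p : κ) (θ : ℝ) :
    mean (piPMF (PMF.uniformOfFintype κ)) (fun d : ι → κ => Real.exp (θ * hit X d p)) ≤
      Real.exp (X.card * (Real.exp θ - 1) / Fintype.card κ) := by
  have h := mean_prod_sum_exp_le (ι := ι) ({()} : Finset Unit) (fun (_ : κ) _ => (1 : ℝ))
    (fun _ _ => zero_le_one) (fun q _ x => if q = p then (if x ∈ X then θ else 0) else 0)
  simp only [Finset.sum_singleton, one_mul] at h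
  have h1 : ∀ d : ι → κ, ∏ q, Real.exp (∑ x, if d x = q then
      (if q = p then (if x ∈ X then θ else 0) else 0) else 0) = Real.exp (θ * hit X d p) := by
    intro d
    rw [Finset.prod_eq_single p, hit_eq_sum]
    · simp
    · intro q _ hq; simp [hq]
    · simp
  have h2 : ∏ q, Real.exp ((∑ x, (Real.exp (if q = p then (if x ∈ X then θ else 0) else 0) - 1)) /
      Fintype.card κ) = Real.exp (X.card * (Real.exp θ - 1) / Fintype.card κ) := by
    rw [Finset.prod_eq_single p]
    · simp only [if_true, sum_exp_indicator]
    · intro q _ hq; simp [hq]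
    · simp
  rw [h2] at h
  simpa only [h1] using h

/-- Upper tail of an occupancy number. -/
theorem hit_tail (X : Finset ι) (p : κ) {θ : ℝ} (a : ℝ) (hθ : 0 ≤ θ) :
    (piPMF (PMF.uniformOfFintype κ)).toOuterMeasure {d : ι → κ | a ≤ hit X d p} ≤
      ENNReal.ofReal (Real.exp (X.card * (Real.exp θ - 1) / Fintype.card κ - θ * a)) := by
  refine (toOuterMeasure_le_mean _ (F := fun d => Real.exp (-(θ * a)) *
    Real.exp (θ * hit X d p)) (fun d => by positivity) fun d hd => ?_).trans ?_
  · rw [← Real.exp_add]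
    apply Real.one_le_exp
    have : θ * a ≤ θ * hit X d p := mul_le_mul_of_nonneg_left hd hθ
    linarith
  · apply ENNReal.ofReal_le_ofReal
    rw [mean_const_mul, sub_eq_add_neg, add_comm, Real.exp_add]
    exact mul_le_mul_of_nonneg_left (mean_exp_hit_le X p θ) (Real.exp_pos _).le

/-- Chernoff's bound for the load of a box when `n ^ 2` balls are thrown into `n` boxes. -/
theorem load_tail (X : Finset ι) (p : κ) (hX : X.card = Fintype.card κ ^ 2) {ε : ℝ} (h0 : 0 ≤ ε)
    (h1 : ε ≤ 2 * Fintype.card κ) :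
    (piPMF (PMF.uniformOfFintype κ)).toOuterMeasure
      {d : ι → κ | Fintype.card κ + ε ≤ hit X d p} ≤
      ENNReal.ofReal (Real.exp (-(ε ^ 2 / (4 * Fintype.card κ)))) := by
  set n : ℝ := (Fintype.card κ : ℝ) with hn
  have hcard : 0 < n := by rw [hn]; exact_mod_cast Fintype.card_pos
  -- With `exp θ - 1 ≤ θ + θ ^ 2` the exponent is at most `n * θ ^ 2 - θ * ε`, which is minimal at
  -- `θ = ε / (2 * n)`.
  have hθ0 : 0 ≤ ε / (2 * n) := by positivity
  have hθ1 : ε / (2 * n) ≤ 1 := by rw [div_le_one (by positivity)]; exact h1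
  refine (hit_tail X p (n + ε) hθ0).trans (ENNReal.ofReal_le_ofReal (Real.exp_le_exp.2 ?_))
  have hXr : (X.card : ℝ) = n ^ 2 := by rw [hX]; push_cast; rfl
  have hexp : Real.exp (ε / (2 * n)) - 1 ≤ ε / (2 * n) + (ε / (2 * n)) ^ 2 := by
    have := (abs_le.1 (Real.abs_exp_sub_one_sub_id_le (x := ε / (2 * n))
      (by rw [abs_of_nonneg hθ0]; exact hθ1))).2
    linarith
  rw [hXr]
  have e1 : n ^ 2 * (Real.exp (ε / (2 * n)) - 1) / n = n * (Real.exp (ε / (2 * n)) - 1) := by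
    field_simp
  rw [e1]
  calc n * (Real.exp (ε / (2 * n)) - 1) - ε / (2 * n) * (n + ε)
      ≤ n * (ε / (2 * n) + (ε / (2 * n)) ^ 2) - ε / (2 * n) * (n + ε) := by gcongr
    _ = -(ε ^ 2 / (4 * n)) := by field_simp; ring

/-- The difference of two occupancy numbers whose sets have almost the same size. -/
theorem sum_exp_diff_le (X Y : Finset ι) {θ : ℝ} (h0 : 0 ≤ θ) (h1 : θ ≤ 1) {n i : ℝ} (hn : 0 < n)
    (hXY : (X.card : ℝ) ≤ Y.card + n) (hY : (Y.card : ℝ) ≤ i * n) :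
    (∑ x, (Real.exp ((if x ∈ X then θ else 0) - if x ∈ Y then θ else 0) - 1)) / n ≤
      2 + i * (2 * θ ^ 2) := by
  -- Common elements of `X` and `Y` cancel. Each element of `Y \ X` is paired with one of `X \ Y`,
  -- at second-order cost `exp θ + exp (-θ) - 2 ≤ 2 * θ ^ 2`; at most `n` unpaired elements give the
  -- constant `2`.
  have hx : ∀ x, Real.exp ((if x ∈ X then θ else 0) - if x ∈ Y then θ else 0) - 1 =
      (if x ∈ X \ Y then Real.exp θ - 1 else 0) + (if x ∈ Y \ X then Real.exp (-θ) - 1 else 0) := by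
    intro x
    by_cases hX : x ∈ X <;> by_cases hY : x ∈ Y <;> simp [hX, hY]
  simp_rw [hx]
  rw [Finset.sum_add_distrib, Finset.sum_ite_mem, Finset.sum_ite_mem, Finset.univ_inter,
    Finset.univ_inter, Finset.sum_const, Finset.sum_const, nsmul_eq_mul, nsmul_eq_mul]
  have c1 : ((X \ Y).card : ℝ) + (X ∩ Y).card = X.card := by
    exact_mod_cast Finset.card_sdiff_add_card_inter X Y
  have c2 : ((Y \ X).card : ℝ) + (X ∩ Y).card = Y.card := by
    rw [Finset.inter_comm]; exact_mod_cast Finset.card_sdiff_add_card_inter Y X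
  have hb : ((Y \ X).card : ℝ) ≤ i * n :=
    le_trans (by exact_mod_cast Finset.card_le_card Finset.sdiff_subset) hY
  have e1 := (abs_le.1 (Real.abs_exp_sub_one_sub_id_le (x := θ) (by rwa [abs_of_nonneg h0]))).2
  have e2 := (abs_le.1 (Real.abs_exp_sub_one_sub_id_le (x := -θ)
    (by rwa [abs_neg, abs_of_nonneg h0]))).2
  have e3 : 0 ≤ Real.exp θ - 1 := by linarith [Real.one_le_exp h0]
  have e4 : θ ^ 2 ≤ 1 := pow_le_one₀ h0 h1
  have hb0 : (0 : ℝ) ≤ (Y \ X).card := Nat.cast_nonneg _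
  rw [div_le_iff₀ hn]
  have s1 : ((X \ Y).card : ℝ) * (Real.exp θ - 1) ≤ ((Y \ X).card + n) * (Real.exp θ - 1) :=
    mul_le_mul_of_nonneg_right (by linarith) e3
  have s2 : ((Y \ X).card : ℝ) * (Real.exp θ - 1 + (Real.exp (-θ) - 1)) ≤
      (Y \ X).card * (2 * θ ^ 2) := mul_le_mul_of_nonneg_left (by nlinarith) hb0
  have s3 : ((Y \ X).card : ℝ) * (2 * θ ^ 2) ≤ (i * n) * (2 * θ ^ 2) :=
    mul_le_mul_of_nonneg_right hb (by positivity)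
  have s4 : n * (Real.exp θ - 1) ≤ n * 2 := mul_le_mul_of_nonneg_left (by linarith) hn.le
  nlinarith

end Occupancy

end PartitionORAM

namespace PartitionORAM
variable {P : Params}

/-! ### Positions as functions of independent draws -/

section Draws

variable (requests : List (Block P))

/-- The block requested at time `t`. -/
def reqAt (t : ℕ) : Block P := requests.getD t ⟨0, by positivity⟩

/-- The draw that gives the new position at time `t`. -/
def drawAt (t : ℕ) : Block P ⊕ Fin requests.length :=
  if h : t < requests.length then Sum.inr ⟨t, h⟩ else Sum.inl ⟨0, by positivity⟩

/-- The draw that gives the position of a block after `t` requests. -/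
def latest : ℕ → Block P → Block P ⊕ Fin requests.length
  | 0 => Sum.inl
  | t + 1 => Function.update (latest t) (reqAt requests t) (drawAt requests t)

/-- The draw that gives the partition read at time `t`. -/
def prev (t : ℕ) : Block P ⊕ Fin requests.length := latest requests t (reqAt requests t)

variable {requests}

theorem drawAt_injOn : Set.InjOn (drawAt requests) {t | t < requests.length} := by
  intro t ht t' ht' h
  simp only [Set.mem_ofPred_eq] at ht ht'
  simp only [drawAt, ht, ht', dif_pos, Sum.inr.injEq, Fin.mk.injEq] at h
  exact h

theorem latest_ne_drawAt {t t' : ℕ} (htt : t ≤ t') (ht : t' < requests.length) (u : Block P) :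
    latest requests t u ≠ drawAt requests t' := by
  induction t with
  | zero => simp [latest, drawAt, ht]
  | succ t ih =>
    rw [latest]
    by_cases hu : u = reqAt requests t
    · rw [hu, Function.update_self]
      intro h
      have := drawAt_injOn (show t < requests.length by omega) ht h
      omega
    · rw [Function.update_of_ne hu]; exact ih (by omega)

/-- The positions of distinct blocks come from distinct draws, so at any fixed time they are
independent and uniform. -/
theorem latest_injective {t : ℕ} (ht : t ≤ requests.length) :
    Function.Injective (latest requests t) := by
  induction t with
  | zero => exact Sum.inl_injective
  | succ t ih =>
    intro u v huv
    rw [latest] at huv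
    by_cases hu : u = reqAt requests t <;> by_cases hv : v = reqAt requests t
    · rw [hu, hv]
    · rw [hu, Function.update_self, Function.update_of_ne hv] at huv
      exact absurd huv.symm (latest_ne_drawAt le_rfl ht v)
    · rw [hv, Function.update_self, Function.update_of_ne hu] at huv
      exact absurd huv (latest_ne_drawAt le_rfl ht u)
    · rw [Function.update_of_ne hu, Function.update_of_ne hv] at huv
      exact ih (by omega) huv

/-- Once a draw has told which partition to read, its block receives a fresh draw, and the old one
is never current again. -/
theorem latest_ne_prev {t t' : ℕ} (htt : t < t') (ht : t' ≤ requests.length) (u : Block P) :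
    latest requests t' u ≠ prev requests t := by
  induction t' with
  | zero => omega
  | succ t' ih =>
    rw [latest]
    by_cases hu : u = reqAt requests t'
    · rw [hu, Function.update_self]
      exact (latest_ne_drawAt (by omega) ht _).symm
    · rw [Function.update_of_ne hu]
      rcases Nat.lt_succ_iff_lt_or_eq.1 htt with h | rfl
      · exact ih h (by omega)
      · exact fun h => hu (latest_injective (by omega) h)

/-- Hence the partitions read at different times are independent and uniform, although the same
block may be requested repeatedly. -/
theorem prev_injOn : Set.InjOn (prev requests) {t | t < requests.length} := by
  intro t ht t' ht' h
  simp only [Set.mem_ofPred_eq] at ht ht'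
  rcases lt_trichotomy t t' with hlt | heq | hlt
  · exact absurd h.symm (latest_ne_prev hlt ht'.le _)
  · exact heq
  · exact absurd h (latest_ne_prev hlt ht.le _)

variable (requests) in
/-- The draws that give the partitions read at the times in `[T₀, T)`. -/
def prevSet (T₀ T : ℕ) : Finset (Block P ⊕ Fin requests.length) :=
  (Finset.Ico T₀ T).image (prev requests)

variable (requests) in
/-- The draws that give the new positions at the times in `[T₀, T)`. -/
def arrSet (T₀ T : ℕ) : Finset (Block P ⊕ Fin requests.length) :=
  (Finset.Ico T₀ T).image (drawAt requests)

theorem prevSet_card_le (T₀ T : ℕ) : (prevSet requests T₀ T).card ≤ T - T₀ :=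
  Finset.card_image_le.trans (by simp)

theorem arrSet_card_le (T₀ T : ℕ) : (arrSet requests T₀ T).card ≤ T - T₀ :=
  Finset.card_image_le.trans (by simp)

theorem prevSet_card {T₀ T : ℕ} (hT : T ≤ requests.length) :
    (prevSet requests T₀ T).card = T - T₀ := by
  rw [prevSet, Finset.card_image_of_injOn, Nat.card_Ico]
  refine prev_injOn.mono fun t ht => ?_
  simp only [Finset.coe_Ico, Set.mem_Ico] at ht
  exact ht.2.trans_le hT

theorem count_add_hit {κ ι : Type*} [DecidableEq κ] [DecidableEq ι] (f : ℕ → ι) {M : ℕ}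
    (hf : Set.InjOn f {t | t < M}) (d : ι → κ) (p : κ) {T₀ T : ℕ} (h : T₀ ≤ T) (hT : T ≤ M) :
    Nat.count (fun s => d (f s) = p) T₀ + hit ((Finset.Ico T₀ T).image f) d p =
      Nat.count (fun s => d (f s) = p) T := by
  have h1 : hit ((Finset.Ico T₀ T).image f) d p =
      ((Finset.Ico T₀ T).filter fun s => d (f s) = p).card := by
    unfold hit
    rw [Finset.filter_image, Finset.card_image_of_injOn]
    refine hf.mono fun t ht => ?_
    simp only [Finset.coe_filter, Finset.mem_Ico, Set.mem_ofPred_eq] at ht ⊢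
    omega
  rw [h1, Nat.count_eq_card_filter_range, Nat.count_eq_card_filter_range,
    ← Finset.card_union_of_disjoint]
  · congr 1
    ext s
    simp only [Finset.mem_union, Finset.mem_filter, Finset.mem_range, Finset.mem_Ico]
    constructor
    · rintro (⟨h1, h2⟩ | ⟨h1, h2⟩)
      · exact ⟨by omega, h2⟩
      · exact ⟨h1.2, h2⟩
    · rintro ⟨h1, h2⟩
      rcases Nat.lt_or_ge s T₀ with h3 | h3
      · exact Or.inl ⟨h3, h2⟩
      · exact Or.inr ⟨⟨h3, h1⟩, h2⟩
  · rw [Finset.disjoint_left]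
    intro s h1 h2
    simp only [Finset.mem_filter, Finset.mem_range, Finset.mem_Ico] at h1 h2
    omega

variable {d : Block P ⊕ Fin requests.length → Part P} {fill : Part P → Fin (2 ^ P.m)}
  {η : Fin requests.length → Fin (P.maxEvict + 1)}

theorem schedule_posAt {t : ℕ} (ht : t ≤ requests.length) (u : Block P) :
    (schedule P requests d fill η).posAt t u = d (latest requests t u) := by
  induction t generalizing u with
  | zero => rfl
  | succ t ih =>
    have hreq : (schedule P requests d fill η).req t = reqAt requests t := rfl
    rw [Schedule.posAt, latest, hreq]
    by_cases hu : u = reqAt requests t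
    · rw [hu, Function.update_self, Function.update_self]
      have : t < requests.length := ht
      simp [schedule, drawAt, this]
    · rw [Function.update_of_ne hu, Function.update_of_ne hu]
      exact ih (by omega) u

theorem schedule_pig_add {T₀ T : ℕ} (p : Part P) (h : T₀ ≤ T) (hT : T ≤ requests.length) :
    (schedule P requests d fill η).pig p T₀ + hit (prevSet requests T₀ T) d p =
      (schedule P requests d fill η).pig p T := by
  have hc : ∀ T ≤ requests.length, (schedule P requests d fill η).pig p T =
      Nat.count (fun s => d (prev requests s) = p) T := by
    intro T hT
    unfold Schedule.pig
    rw [Nat.count_eq_card_filter_range, Nat.count_eq_card_filter_range]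
    congr 1
    refine Finset.filter_congr fun s hs => ?_
    rw [Finset.mem_range] at hs
    rw [Schedule.reads, schedule_posAt (by omega)]
    rfl
  rw [hc T₀ (h.trans hT), hc T hT]
  exact count_add_hit _ prev_injOn d p h hT

theorem schedule_arr_add {T₀ T : ℕ} (p : Part P) (h : T₀ ≤ T) (hT : T ≤ requests.length) :
    (schedule P requests d fill η).arr p T₀ + hit (arrSet requests T₀ T) d p =
      (schedule P requests d fill η).arr p T := by
  have hc : ∀ T ≤ requests.length, (schedule P requests d fill η).arr p T =
      Nat.count (fun s => d (drawAt requests s) = p) T := by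
    intro T hT
    unfold Schedule.arr
    rw [Nat.count_eq_card_filter_range, Nat.count_eq_card_filter_range]
    congr 1
    refine Finset.filter_congr fun s hs => ?_
    rw [Finset.mem_range] at hs
    have : s < requests.length := by omega
    simp [schedule, drawAt, this]
  rw [hc T₀ (h.trans hT), hc T hT]
  exact count_add_hit _ drawAt_injOn d p h hT

theorem hit_mono {κ ι : Type*} [DecidableEq κ] {X Y : Finset ι} (h : X ⊆ Y) (d : ι → κ) (p : κ) :
    hit X d p ≤ hit Y d p := Finset.card_le_card (Finset.filter_subset_filter _ h)

theorem hit_le_card {κ ι : Type*} [DecidableEq κ] (X : Finset ι) (d : ι → κ) (p : κ) :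
    hit X d p ≤ X.card := Finset.card_filter_le _ _

/-- Cyclic scanning hits `p` in `x` consecutive evictions `x / 2 ^ m` times, up to an error of two.
-/
theorem seqCount_window (p : Part P) (E₀ x : ℕ) :
    2 ^ P.m * seqCount p (E₀ + x) ≤ 2 ^ P.m * seqCount p E₀ + x + 2 * 2 ^ P.m ∧
      2 ^ P.m * seqCount p E₀ + x ≤ 2 ^ P.m * seqCount p (E₀ + x) + 2 * 2 ^ P.m := by
  have hn : 0 < 2 ^ P.m := by positivity
  have key : ∀ E, ∃ i ≤ 1, Nat.count (fun e => e % 2 ^ P.m = (p : ℕ)) 1 + seqCount p E =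
      (1 + E) / 2 ^ P.m + i := by
    intro E
    have h1 : Nat.count (fun e => e % 2 ^ P.m = (p : ℕ)) (1 + E) =
        Nat.count (fun e => e % 2 ^ P.m = (p : ℕ)) 1 + seqCount p E := by
      rw [Nat.count_add]
      congr 1
      unfold seqCount
      simp only [add_comm]
    have h2 : (fun e => e % 2 ^ P.m = (p : ℕ)) = fun e => e ≡ (p : ℕ) [MOD 2 ^ P.m] := by
      funext e
      rw [Nat.ModEq, Nat.mod_eq_of_lt p.2]
    refine ⟨if (p : ℕ) % 2 ^ P.m < (1 + E) % 2 ^ P.m then 1 else 0, by split <;> omega, ?_⟩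
    rw [← h1]
    simp only [h2]
    exact Nat.count_modEq_card _ hn _
  obtain ⟨i, hi, h1⟩ := key E₀
  obtain ⟨j, hj, h2⟩ := key (E₀ + x)
  have d1 := Nat.div_add_mod (1 + E₀) (2 ^ P.m)
  have d2 := Nat.div_add_mod (1 + (E₀ + x)) (2 ^ P.m)
  have m1 := Nat.mod_lt (1 + E₀) hn
  have m2 := Nat.mod_lt (1 + (E₀ + x)) hn
  have k1 := congrArg (2 ^ P.m * ·) h1
  have k2 := congrArg (2 ^ P.m * ·) h2
  simp only [mul_add] at k1 k2
  have i1 : 2 ^ P.m * i ≤ 2 ^ P.m := by nlinarith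
  have j1 : 2 ^ P.m * j ≤ 2 ^ P.m := by nlinarith
  constructor <;> omega

theorem sum_count_eq {κ : Type*} [Fintype κ] [DecidableEq κ] (f : ℕ → κ) (T : ℕ) :
    ∑ p, Nat.count (fun s => f s = p) T = T := by
  induction T with
  | zero => simp
  | succ T ih => simp only [Nat.count_succ, Finset.sum_add_distrib, ih, Finset.sum_ite_eq,
      Finset.mem_univ, if_true]

theorem Schedule.sum_cnt (σ : Schedule P) (T E : ℕ) : ∑ p, σ.cnt p T E = T + E := by
  have h : ∀ p : Part P, seqCount p E =
      Nat.count (fun e => (⟨(e + 1) % 2 ^ P.m, Nat.mod_lt _ (by positivity)⟩ : Part P) = p) E := by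
    intro p
    unfold seqCount
    simp only [Fin.ext_iff]
  simp only [Schedule.cnt, Finset.sum_add_distrib, h]
  rw [sum_count_eq]
  congr 1
  exact sum_count_eq _ _

end Draws

end PartitionORAM

namespace PartitionORAM
variable {P : Params}

/-! ### Tail bounds for the random positions -/

section OccupancyTails

variable {κ ι : Type*} [Fintype κ] [DecidableEq κ] [Nonempty κ] [Fintype ι] [DecidableEq ι]

/-- A union bound inside each box: the index `j` that is responsible for a box may differ from box
to box, and the summand `1` covers the boxes that contribute nothing. The mean of each factor is at
most `1 + A ≤ exp A`, so `n` boxes give `exp (A * n)`, and Markov's inequality concludes. -/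
theorem occupancy_tail {J : Type*} [DecidableEq J] (s : Finset J) (c : J → ℝ) (hc : ∀ j, 0 ≤ c j)
    (f : J → ι → ℝ) {A b : ℝ}
    (hA : ∑ j ∈ s, c j * Real.exp ((∑ x, (Real.exp (f j x) - 1)) / Fintype.card κ) ≤ A)
    {B : Set (ι → κ)}
    (hB : ∀ d ∈ B, Real.exp b ≤
      ∏ p, (1 + ∑ j ∈ s, c j * Real.exp (∑ x, if d x = p then f j x else 0))) :
    (piPMF (PMF.uniformOfFintype κ)).toOuterMeasure B ≤
      ENNReal.ofReal (Real.exp (A * Fintype.card κ - b)) := by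
  have h := mean_prod_sum_exp_le (κ := κ) (ι := ι) (Finset.insertNone s)
    (fun _ j => j.elim 1 c) (fun p j => by cases j <;> simp [hc])
    (fun _ j => j.elim (fun _ => 0) f)
  simp only [Finset.sum_insertNone, Option.elim_none, Option.elim_some, ite_self,
    Finset.sum_const_zero, Real.exp_zero, mul_one, sub_self, zero_div] at h
  refine (toOuterMeasure_le_mean _ (F := fun d => Real.exp (-b) *
    ∏ p, (1 + ∑ j ∈ s, c j * Real.exp (∑ x, if d x = p then f j x else 0)))
    (fun d => ?_) fun d hd => ?_).trans (ENNReal.ofReal_le_ofReal ?_)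
  · refine mul_nonneg (Real.exp_pos _).le (Finset.prod_nonneg fun p _ => ?_)
    exact add_nonneg zero_le_one (Finset.sum_nonneg fun j _ =>
      mul_nonneg (hc j) (Real.exp_pos _).le)
  · rw [Real.exp_neg, ← div_eq_inv_mul, le_div_iff₀ (Real.exp_pos _), one_mul]
    exact hB d hd
  · rw [mean_const_mul, sub_eq_add_neg, add_comm, Real.exp_add]
    refine mul_le_mul_of_nonneg_left (h.trans ?_) (Real.exp_pos _).le
    rw [Finset.prod_const, Finset.card_univ, mul_comm, Real.exp_nat_mul]
    refine pow_le_pow_left₀ (add_nonneg zero_le_one (Finset.sum_nonneg fun j _ =>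
      mul_nonneg (hc j) (Real.exp_pos _).le)) ?_ _
    linarith [Real.add_one_le_exp A]

theorem exp_eight_lt : Real.exp 8 < 4096 := by
  have h := Real.exp_one_lt_d9
  have : Real.exp 8 = Real.exp 1 ^ 8 := by rw [← Real.exp_nat_mul]; norm_num
  rw [this]
  calc Real.exp 1 ^ 8 < 2.7182818286 ^ 8 := by gcongr
    _ < 4096 := by norm_num

/-- `4096 * τ ≤ n` makes a window with `h * τ` draws unlikely to hit a box `h / 2` times. -/
theorem card_mul_exp_le {κ ι : Type*} [Fintype κ] [Nonempty κ] {τ h : ℕ}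
    (hτ : 4096 * τ ≤ Fintype.card κ) (X : Finset ι)
    (hX : X.card ≤ h * τ) : X.card * (Real.exp 8 - 1) / Fintype.card κ ≤ h := by
  have hcard : (0 : ℝ) < Fintype.card κ := by exact_mod_cast Fintype.card_pos
  have h1 : (X.card : ℝ) ≤ h * τ := by exact_mod_cast hX
  have h2 : (4096 : ℝ) * τ ≤ Fintype.card κ := by exact_mod_cast hτ
  rw [div_le_iff₀ hcard]
  have h3 : (X.card : ℝ) * (Real.exp 8 - 1) ≤ (h * τ) * 4096 := by
    refine mul_le_mul h1 (by linarith [exp_eight_lt]) ?_ (by positivity)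
    linarith [Real.one_le_exp (show (0 : ℝ) ≤ 8 by norm_num)]
  calc _ ≤ (h * τ : ℝ) * 4096 := h3
    _ = h * (4096 * τ) := by ring
    _ ≤ _ := by gcongr

/-- With tilt `8` the threshold `(h - 4) / 2` gains `4 * h - 16`, while the mean term costs at most
`h`, because `exp 8 < 4096` and `4096 * τ ≤ n`. -/
theorem chain_tail {τ h : ℕ} (hτ : 4096 * τ ≤ Fintype.card κ) (X : Finset ι)
    (hX : X.card ≤ h * τ) (p : κ) :
    (piPMF (PMF.uniformOfFintype κ)).toOuterMeasure {d : ι → κ | h ≤ 2 * hit X d p + 4} ≤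
      ENNReal.ofReal (Real.exp (16 - 3 * h)) := by
  have h1 := hit_tail X p (θ := 8) (((h : ℝ) - 4) / 2) (by norm_num)
  refine le_trans (MeasureTheory.measure_mono ?_) (h1.trans (ENNReal.ofReal_le_ofReal ?_))
  · intro d hd
    simp only [Set.mem_ofPred_eq] at hd ⊢
    have : (h : ℝ) ≤ 2 * hit X d p + 4 := by exact_mod_cast hd
    linarith
  · apply Real.exp_le_exp.2
    have := card_mul_exp_le hτ X hX
    linarith

/-- The constant in the bound for the sum of the squares of the numbers of writes that merge. -/
noncomputable def chainConst : ℝ := 2 * Real.exp 16 + 1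

theorem sq_le_exp (h : ℕ) : (h : ℝ) ^ 2 ≤ Real.exp h := by
  have h1 : (h : ℝ) / 2 ≤ Real.exp (h / 2 - 1) := by
    have := Real.add_one_le_exp ((h : ℝ) / 2 - 1)
    linarith
  have h2 : (h : ℝ) ≤ Real.exp (h / 2) := by
    have e : Real.exp ((h : ℝ) / 2) = Real.exp (h / 2 - 1) * Real.exp 1 := by
      rw [← Real.exp_add]; ring_nf
    have : (2 : ℝ) ≤ Real.exp 1 := by linarith [Real.add_one_le_exp (1 : ℝ)]
    rw [e]
    nlinarith [Real.exp_pos ((h : ℝ) / 2 - 1)]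
  calc (h : ℝ) ^ 2 ≤ Real.exp (h / 2) ^ 2 := by gcongr
    _ = Real.exp h := by rw [← Real.exp_nat_mul]; push_cast; ring_nf

theorem exp_neg_nat_le (h : ℕ) : Real.exp (-h) ≤ (1 / 2) ^ h := by
  have : (2 : ℝ) ≤ Real.exp 1 := by linarith [Real.add_one_le_exp (1 : ℝ)]
  have e : Real.exp (-(h : ℝ)) = (1 / Real.exp 1) ^ h := by
    rw [one_div, ← Real.exp_neg, ← Real.exp_nat_mul]; ring_nf
  rw [e]
  gcongr

theorem sum_half_pow_le (n : ℕ) : ∑ i ∈ Finset.range n, (1 / 2 : ℝ) ^ i ≤ 2 := by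
  exact sum_geometric_two_le n

/-- The exponential moment of `y ^ 2 / J` is usable because `y ≤ J` gives `y ^ 2 / J ≤ y`. If `y =
h` is admissible then `exp (16 - 4 * h + 8 * hit) ≥ 1`, so this weight may be inserted; it turns the
term for `h` into at most `exp (16 - h) / J` on average. The sum is at most `2 * exp 16 / J` per
box, and the extra `1` in `chainConst` leaves `exp (-n / J)`. -/
theorem chain_sq_tail {τ J : ℕ} (hJ : 0 < J) (hτ : 4096 * τ ≤ Fintype.card κ) (X : ℕ → Finset ι)
    (hX : ∀ h, (X h).card ≤ h * τ) :
    (piPMF (PMF.uniformOfFintype κ)).toOuterMeasure {d : ι → κ | ∃ y : κ → ℕ,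
      (∀ p, y p ≤ J ∧ (y p = 0 ∨ y p ≤ 2 * hit (X (y p)) d p + 4)) ∧
      chainConst * Fintype.card κ ≤ ∑ p, (y p : ℝ) ^ 2} ≤
      ENNReal.ofReal (Real.exp (-(Fintype.card κ / J))) := by
  have hJr : (0 : ℝ) < J := by exact_mod_cast hJ
  have hterm : ∀ h ∈ Finset.range (J + 1),
      (Real.exp ((h : ℝ) ^ 2 / J) - 1) * Real.exp (16 - 4 * h) *
        Real.exp ((∑ x, (Real.exp (if x ∈ X h then 8 else 0) - 1)) / Fintype.card κ) ≤
      Real.exp 16 / J * (1 / 2) ^ h := by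
    intro h hh
    have hh' : (h : ℝ) ≤ J := by
      rw [Finset.mem_range] at hh; exact_mod_cast (by omega : h ≤ J)
    have h1 : (h : ℝ) ^ 2 / J ≤ h := by
      rw [div_le_iff₀ hJr]; nlinarith [Nat.cast_nonneg (α := ℝ) h]
    have h2 : Real.exp ((h : ℝ) ^ 2 / J) - 1 ≤ (h : ℝ) ^ 2 / J * Real.exp h := by
      have e1 : Real.exp ((h : ℝ) ^ 2 / J) - 1 ≤ (h : ℝ) ^ 2 / J * Real.exp ((h : ℝ) ^ 2 / J) := by
        have := Real.add_one_le_exp (-((h : ℝ) ^ 2 / J))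
        rw [Real.exp_neg] at this
        have hp := Real.exp_pos ((h : ℝ) ^ 2 / J)
        have := mul_le_mul_of_nonneg_right this hp.le
        rw [inv_mul_cancel₀ hp.ne'] at this
        linarith
      refine e1.trans ?_
      gcongr
    have h3 : (h : ℝ) ^ 2 / J * Real.exp h ≤ Real.exp h / J * Real.exp h := by
      gcongr; exact sq_le_exp h
    rw [sum_exp_indicator]
    have h4 : Real.exp ((X h).card * (Real.exp 8 - 1) / Fintype.card κ) ≤ Real.exp h :=
      Real.exp_le_exp.2 (card_mul_exp_le hτ (X h) (hX h))
    calc _ ≤ Real.exp h / J * Real.exp h * Real.exp (16 - 4 * h) * Real.exp h := by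
          gcongr; linarith
      _ = Real.exp 16 / J * Real.exp (-h) := by
          have : Real.exp h * Real.exp h * Real.exp (16 - 4 * h) * Real.exp h =
              Real.exp 16 * Real.exp (-h) := by
            simp only [← Real.exp_add]; ring_nf
          calc _ = Real.exp h * Real.exp h * Real.exp (16 - 4 * h) * Real.exp h / J := by ring
            _ = _ := by rw [this]; ring
      _ ≤ _ := by gcongr; exact exp_neg_nat_le h
  have hsum : ∑ h ∈ Finset.range (J + 1), (Real.exp ((h : ℝ) ^ 2 / J) - 1) * Real.exp (16 - 4 * h) *
      Real.exp ((∑ x, (Real.exp (if x ∈ X h then 8 else 0) - 1)) / Fintype.card κ) ≤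
      2 * Real.exp 16 / J := by
    refine (Finset.sum_le_sum hterm).trans ?_
    rw [← Finset.mul_sum]
    calc _ ≤ Real.exp 16 / J * 2 := by gcongr; exact sum_half_pow_le _
      _ = _ := by ring
  have hc : ∀ h : ℕ, 0 ≤ (Real.exp ((h : ℝ) ^ 2 / J) - 1) * Real.exp (16 - 4 * h) := fun h =>
    mul_nonneg (by linarith [Real.one_le_exp (show 0 ≤ (h : ℝ) ^ 2 / J by positivity)])
      (Real.exp_pos _).le
  refine (occupancy_tail (κ := κ) (Finset.range (J + 1)) _ hc
    (fun h x => if x ∈ X h then 8 else 0) hsum (b := chainConst * Fintype.card κ / J)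
    fun d hd => ?_).trans (ENNReal.ofReal_le_ofReal (Real.exp_le_exp.2 (le_of_eq ?_)))
  · obtain ⟨y, hy, hsq⟩ := hd
    calc Real.exp (chainConst * Fintype.card κ / J) ≤ Real.exp (∑ p, (y p : ℝ) ^ 2 / J) := by
          rw [← Finset.sum_div]; gcongr
      _ = ∏ p, Real.exp ((y p : ℝ) ^ 2 / J) := Real.exp_sum _ _
      _ ≤ _ := by
        refine Finset.prod_le_prod (fun p _ => (Real.exp_pos _).le) fun p _ => ?_
        have hnn : ∀ h ∈ Finset.range (J + 1), 0 ≤ (Real.exp ((h : ℝ) ^ 2 / J) - 1) *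
            Real.exp (16 - 4 * h) * Real.exp (∑ x, if d x = p then (if x ∈ X h then 8 else 0) else 0) :=
          fun h _ => mul_nonneg (hc h) (Real.exp_pos _).le
        rcases (hy p).2 with h0 | h0
        · rw [h0]
          simp only [Nat.cast_zero, ne_eq, OfNat.ofNat_ne_zero, not_false_eq_true, zero_pow,
            zero_div, Real.exp_zero]
          linarith [Finset.sum_nonneg hnn]
        · have := Finset.single_le_sum hnn (Finset.mem_range.2 (Nat.lt_succ_of_le (hy p).1))
          rw [← hit_eq_sum] at this
          have h1 : (y p : ℝ) ≤ 2 * hit (X (y p)) d p + 4 := by exact_mod_cast h0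
          have h2 : 1 ≤ Real.exp (16 - 4 * (y p : ℝ)) * Real.exp (8 * hit (X (y p)) d p) := by
            rw [← Real.exp_add]; apply Real.one_le_exp; linarith
          have h3 : Real.exp ((y p : ℝ) ^ 2 / J) - 1 ≤ (Real.exp ((y p : ℝ) ^ 2 / J) - 1) *
              (Real.exp (16 - 4 * (y p : ℝ)) * Real.exp (8 * hit (X (y p)) d p)) :=
            le_mul_of_one_le_right
              (by linarith [Real.one_le_exp (show 0 ≤ (y p : ℝ) ^ 2 / J by positivity)]) h2
          linarith
  · unfold chainConst; field_simp; ring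

/-- The constant in the bound for the cache slots. -/
noncomputable def cacheConst (ν : ℝ) : ℝ :=
  (Real.exp 5 / (1 - Real.exp (-(2 * (ν / 4) ^ 2))) + 1) / (ν / 4)

/-- Summing over the starting window `i` replaces the maximum in the queue-length formula. Its term
has drift `-θ * ν * i` and second-order cost `2 * θ ^ 2 * i`. -/
theorem cache_tail {ν : ℝ} (h0 : 0 < ν) (h1 : ν ≤ 1) (M : ℕ) (X Y : ℕ → Finset ι)
    (hXY : ∀ i, (X i).card ≤ (Y i).card + Fintype.card κ)
    (hY : ∀ i, (Y i).card ≤ i * Fintype.card κ) :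
    (piPMF (PMF.uniformOfFintype κ)).toOuterMeasure {d : ι → κ | ∃ L : κ → ℕ,
      (∀ p, L p = 0 ∨ ∃ i ≤ M, L p + hit (Y i) d p + ν * i ≤ hit (X i) d p + 3) ∧
      cacheConst ν * Fintype.card κ ≤ ∑ p, (L p : ℝ)} ≤
      ENNReal.ofReal (Real.exp (-Fintype.card κ)) := by
  have hcard : (0 : ℝ) < Fintype.card κ := by exact_mod_cast Fintype.card_pos
  -- With `ν = 4 * θ` the net exponent is at most `5 - 2 * θ ^ 2 * i`, so the terms are dominated by
  -- a geometric series.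
  set θ : ℝ := (ν / 4 : ℝ) with hθ
  have hθ0 : 0 < θ := by positivity
  have hν : ν = 4 * θ := by rw [hθ]; ring
  set r : ℝ := Real.exp (-(2 * θ ^ 2)) with hr
  have hr1 : r < 1 := by rw [hr]; exact (Real.exp_lt_exp.2 (show -(2 * θ ^ 2) < 0 by nlinarith)).trans_eq Real.exp_zero
  have hr0 : 0 < r := Real.exp_pos _
  have hterm : ∀ i ∈ Finset.range (M + 1), Real.exp (3 * θ - θ * ν * i) *
      Real.exp ((∑ x, (Real.exp ((if x ∈ X i then θ else 0) - if x ∈ Y i then θ else 0) - 1)) /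
        Fintype.card κ) ≤ Real.exp 5 * r ^ i := by
    intro i _
    have := sum_exp_diff_le (X i) (Y i) hθ0.le (by linarith) hcard
      (by exact_mod_cast hXY i) (i := i) (by exact_mod_cast hY i)
    rw [hr, ← Real.exp_nat_mul, ← Real.exp_add, ← Real.exp_add]
    apply Real.exp_le_exp.2
    rw [hν]
    nlinarith
  have hsum : ∑ i ∈ Finset.range (M + 1), Real.exp (3 * θ - θ * ν * i) *
      Real.exp ((∑ x, (Real.exp ((if x ∈ X i then θ else 0) - if x ∈ Y i then θ else 0) - 1)) /
        Fintype.card κ) ≤ Real.exp 5 / (1 - r) := by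
    refine (Finset.sum_le_sum hterm).trans ?_
    rw [← Finset.mul_sum, div_eq_mul_inv]
    have := (summable_geometric_of_lt_one hr0.le hr1).sum_le_tsum (Finset.range (M + 1))
      (fun i _ => by positivity)
    rw [tsum_geometric_of_lt_one hr0.le hr1] at this
    gcongr
  refine (occupancy_tail (κ := κ) (Finset.range (M + 1)) _ (fun i => (Real.exp_pos _).le)
    (fun i x => (if x ∈ X i then θ else 0) - if x ∈ Y i then θ else 0) hsum
    (b := θ * (cacheConst ν * Fintype.card κ))
    fun d hd => ?_).trans (ENNReal.ofReal_le_ofReal (Real.exp_le_exp.2 (le_of_eq ?_)))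
  · obtain ⟨L, hL, hs⟩ := hd
    calc Real.exp (θ * (cacheConst ν * Fintype.card κ)) ≤ Real.exp (∑ p, θ * (L p : ℝ)) := by
          rw [← Finset.mul_sum]; gcongr
      _ = ∏ p, Real.exp (θ * (L p : ℝ)) := Real.exp_sum _ _
      _ ≤ _ := by
        refine Finset.prod_le_prod (fun p _ => (Real.exp_pos _).le) fun p _ => ?_
        have hnn : ∀ i ∈ Finset.range (M + 1), 0 ≤ Real.exp (3 * θ - θ * ν * i) *
            Real.exp (∑ x, if d x = p then
              ((if x ∈ X i then θ else 0) - if x ∈ Y i then θ else 0) else 0) :=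
          fun h _ => mul_nonneg (Real.exp_pos _).le (Real.exp_pos _).le
        rcases hL p with h0 | ⟨i, hi, h0⟩
        · rw [h0]
          simp only [Nat.cast_zero, mul_zero, Real.exp_zero]
          linarith [Finset.sum_nonneg hnn]
        · have := Finset.single_le_sum hnn (Finset.mem_range.2 (Nat.lt_succ_of_le hi))
          refine le_trans ?_ (this.trans (by linarith))
          have e : (∑ x, if d x = p then
              ((if x ∈ X i then θ else 0) - if x ∈ Y i then θ else 0) else 0) =
              θ * hit (X i) d p - θ * hit (Y i) d p := by
            rw [hit_eq_sum, hit_eq_sum, ← Finset.sum_sub_distrib]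
            refine Finset.sum_congr rfl fun x _ => ?_
            split <;> simp
          rw [e, ← Real.exp_add]
          apply Real.exp_le_exp.2
          nlinarith
  · have : θ * cacheConst ν = Real.exp 5 / (1 - r) + 1 := by
      rw [cacheConst, ← hθ, ← hr, mul_div_cancel₀ _ hθ0.ne']
    rw [← mul_assoc, this]
    ring

end OccupancyTails

end PartitionORAM

/-! ### Union bound for the random positions. -/

namespace PartitionORAM
variable {P : Params}

/-- The properties of the random positions that keep partitions, queue and cache slots small:
`J` bounds the number of merged writes of a job that waits at most `τ` steps per write, and `ν` is
the rate of the sequential evictions. -/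
structure GoodDraws (requests : List (Block P)) (J τ : ℕ) (ν : ℝ)
    (d : Block P ⊕ Fin requests.length → Part P) : Prop where
  load : ∀ t ≤ requests.length, ∀ p,
    hit (Finset.univ.image (latest requests t)) d p ≤ P.capacity
  short : ∀ T ≤ requests.length, ∀ p, ∀ h,
    h ≤ 2 * hit (prevSet requests (T - h * τ) T) d p + 4 → h ≤ J
  squares : ∀ T ≤ requests.length, ∀ y : Part P → ℕ,
    (∀ p, y p ≤ J ∧ (y p = 0 ∨ y p ≤ 2 * hit (prevSet requests (T - y p * τ) T) d p + 4)) →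
    ∑ p, (y p : ℝ) ^ 2 ≤ chainConst * 2 ^ P.m
  cache : ∀ t ≤ requests.length, ∀ L : Part P → ℕ,
    (∀ p, L p = 0 ∨ ∃ i ≤ requests.length,
      L p + hit (prevSet requests (t - i * 2 ^ P.m) t) d p + ν * i ≤
        hit (arrSet requests (t - (i + 1) * 2 ^ P.m) t) d p + 3) →
    ∑ p, (L p : ℝ) ≤ cacheConst ν * 2 ^ P.m

theorem not_goodDraws_le (requests : List (Block P)) {J τ : ℕ} {ν : ℝ} (hJ : 0 < J)
    (hτ : 4096 * τ ≤ 2 ^ P.m) (hν0 : 0 < ν) (hν1 : ν ≤ 1) (hs : P.surplus ≤ 2 ^ P.m) :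
    (piPMF (PMF.uniformOfFintype (Part P))).toOuterMeasure
      {d : Block P ⊕ Fin requests.length → Part P | ¬ GoodDraws requests J τ ν d} ≤
    ENNReal.ofReal
      ((requests.length + 1) * 2 ^ P.m * Real.exp (-((P.surplus : ℝ) ^ 2 / (4 * 2 ^ P.m))) +
      (requests.length + 1) * 2 ^ P.m * (2 * requests.length + 5) * Real.exp (16 - 3 * (J + 1)) +
      (requests.length + 1) * Real.exp (-(2 ^ P.m / J)) +
      (requests.length + 1) * Real.exp (-(2 ^ P.m))) := by
  set M := requests.length with hM
  have hcard : Fintype.card (Part P) = 2 ^ P.m := Fintype.card_fin _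
  have hcardr : (Fintype.card (Part P) : ℝ) = 2 ^ P.m := by rw [hcard]; push_cast; rfl
  -- partitions
  have b1 := toOuterMeasure_iUnion_le (piPMF (PMF.uniformOfFintype (Part P)))
    (Finset.range (M + 1) ×ˢ (Finset.univ : Finset (Part P)))
    (fun x => {d : Block P ⊕ Fin requests.length → Part P | (Fintype.card (Part P) : ℝ) + P.surplus ≤
      hit (Finset.univ.image (latest requests x.1)) d x.2})
    (ε := Real.exp (-((P.surplus : ℝ) ^ 2 / (4 * 2 ^ P.m)))) (fun x hx => by
      have hx1 : x.1 ≤ requests.length := by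
        have := (Finset.mem_product.1 hx).1; rw [Finset.mem_range] at this; omega
      have := load_tail (Finset.univ.image (latest requests x.1)) x.2 (by
        rw [Finset.card_image_of_injective _ (latest_injective hx1), hcard, Finset.card_univ,
          Fintype.card_fin, ← pow_mul, mul_comm, pow_mul]; norm_num) (ε := P.surplus) (by positivity)
        (by rw [hcardr]
            have : (P.surplus : ℝ) ≤ 2 ^ P.m := by exact_mod_cast hs
            linarith [pow_pos (two_pos : (0 : ℝ) < 2) P.m])
      rwa [hcardr] at this ⊢)
  -- long chains
  have b2 := toOuterMeasure_iUnion_le (piPMF (PMF.uniformOfFintype (Part P)))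
    ((Finset.range (M + 1) ×ˢ (Finset.univ : Finset (Part P))) ×ˢ
      (Finset.range (2 * M + 5)).filter (J < ·))
    (fun x => {d : Block P ⊕ Fin requests.length → Part P |
      x.2 ≤ 2 * hit (prevSet requests (x.1.1 - x.2 * τ) x.1.1) d x.1.2 + 4})
    (ε := Real.exp (16 - 3 * (J + 1))) (fun x hx => by
      refine (chain_tail (by rwa [hcard]) _ ?_ _).trans (ENNReal.ofReal_le_ofReal ?_)
      · exact (prevSet_card_le _ _).trans (by omega)
      · have := (Finset.mem_filter.1 (Finset.mem_product.1 hx).2).2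
        have : (J : ℝ) + 1 ≤ x.2 := by exact_mod_cast this
        apply Real.exp_le_exp.2; linarith)
  -- squares
  have b3 := toOuterMeasure_iUnion_le (piPMF (PMF.uniformOfFintype (Part P)))
    (Finset.range (M + 1))
    (fun T => {d : Block P ⊕ Fin requests.length → Part P | ∃ y : Part P → ℕ,
      (∀ p, y p ≤ J ∧ (y p = 0 ∨ y p ≤ 2 * hit (prevSet requests (T - y p * τ) T) d p + 4)) ∧
      chainConst * Fintype.card (Part P) ≤ ∑ p, (y p : ℝ) ^ 2})
    (ε := Real.exp (-(2 ^ P.m / J))) (fun T _ => by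
      have := chain_sq_tail hJ (by rwa [hcard]) (fun h => prevSet requests (T - h * τ) T)
        (fun h => (prevSet_card_le _ _).trans (by omega)) (κ := Part P)
      rwa [hcardr] at this ⊢)
  -- cache
  have b4 := toOuterMeasure_iUnion_le (piPMF (PMF.uniformOfFintype (Part P)))
    (Finset.range (M + 1))
    (fun t => {d : Block P ⊕ Fin requests.length → Part P | ∃ L : Part P → ℕ,
      (∀ p, L p = 0 ∨ ∃ i ≤ M, L p + hit (prevSet requests (t - i * 2 ^ P.m) t) d p + ν * i ≤
        hit (arrSet requests (t - (i + 1) * 2 ^ P.m) t) d p + 3) ∧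
      cacheConst ν * Fintype.card (Part P) ≤ ∑ p, (L p : ℝ)})
    (ε := Real.exp (-(2 ^ P.m))) (fun t ht => by
      rw [Finset.mem_range] at ht
      have := cache_tail hν0 hν1 M (fun i => arrSet requests (t - (i + 1) * 2 ^ P.m) t)
        (fun i => prevSet requests (t - i * 2 ^ P.m) t)
        (fun i => by
          rw [prevSet_card (by omega), hcard]
          refine (arrSet_card_le _ _).trans ?_
          rw [add_mul]; omega)
        (fun i => by rw [hcard]; exact (prevSet_card_le _ _).trans (by omega)) (κ := Part P)
      rwa [hcardr] at this ⊢)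
  have hn : (0 : ℝ) ≤ 2 ^ P.m := by positivity
  rw [ENNReal.ofReal_add (by positivity) (by positivity),
    ENNReal.ofReal_add (by positivity) (by positivity),
    ENNReal.ofReal_add (by positivity) (by positivity)]
  refine le_trans (le_trans (MeasureTheory.measure_mono ?_)
    (le_trans (MeasureTheory.measure_union_le _ _) (add_le_add (le_trans
      (MeasureTheory.measure_union_le _ _) (add_le_add (le_trans
        (MeasureTheory.measure_union_le _ _) (add_le_add b1 b2)) b3)) b4))) ?_
  · intro d hd
    by_contra hcon
    simp only [Set.mem_union, not_or] at hcon
    obtain ⟨⟨⟨h1, h2⟩, h3⟩, h4⟩ := hcon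
    simp only [Set.mem_ofPred_eq, not_exists, not_and, Finset.mem_product, Finset.mem_range,
      Finset.mem_univ, and_true, Prod.forall, Finset.mem_filter, not_le] at h1 h2 h3 h4
    refine hd ⟨fun t ht p => ?_, fun T hT p h hh => ?_, fun T hT y hy => ?_, fun t ht L hL => ?_⟩
    · have := h1 t p (by omega)
      rw [hcard] at this
      unfold Params.capacity
      exact_mod_cast this.le
    · by_contra hJh
      -- A window hits a box at most `M` times, so only finitely many `h` enter the union bound.
      have hh2 : h ≤ 2 * M + 4 := by
        have := (hit_le_card (prevSet requests (T - h * τ) T) d p).trans (prevSet_card_le _ _)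
        omega
      have := h2 T p h ⟨by omega, by omega, by omega⟩
      omega
    · have := h3 T (by omega) y hy
      rw [hcardr] at this
      exact this.le
    · have := h4 t (by omega) L hL
      rw [hcardr] at this
      exact this.le
  · refine add_le_add (add_le_add (add_le_add ?_ ?_) ?_) ?_ <;> refine ENNReal.ofReal_le_ofReal ?_
    · rw [Finset.card_product, Finset.card_range, Finset.card_univ, hcard]; push_cast; rfl
    · rw [Finset.card_product, Finset.card_product, Finset.card_range, Finset.card_univ, hcard]
      push_cast
      have : (((Finset.range (2 * M + 5)).filter (J < ·)).card : ℝ) ≤ 2 * M + 5 := by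
        have := Finset.card_filter_le (Finset.range (2 * M + 5)) (J < ·)
        rw [Finset.card_range] at this
        exact_mod_cast this
      gcongr
    · rw [Finset.card_range]; push_cast; rfl
    · rw [Finset.card_range]; push_cast; rfl

end PartitionORAM

namespace PartitionORAM
variable {P : Params}

/-! ### The number of sequential evictions -/

/-- A lower bound for the rate of the sequential evictions. -/
noncomputable def evictRate (c : ℕ) (q : ℝ≥0) : ℝ :=
  1 - mean (boundedGeometric c q) fun k => Real.exp (-(k : ℕ))

theorem evictRate_le_one (c : ℕ) (q : ℝ≥0) : evictRate c q ≤ 1 := by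
  have := mean_nonneg (boundedGeometric c q) (F := fun k => Real.exp (-((k : ℕ) : ℝ)))
    fun _ => (Real.exp_pos _).le
  unfold evictRate
  linarith

theorem evictRate_pos {c : ℕ} (hc : 1 ≤ c) {q : ℝ≥0} (hq : 0 < q) : 0 < evictRate c q := by
  have h1 : (1 : ℝ) = mean (boundedGeometric c q) fun _ => 1 := (mean_const _ _).symm
  have h2 : mean (boundedGeometric c q) (fun k => Real.exp (-((k : ℕ) : ℝ))) <
      mean (boundedGeometric c q) fun _ => 1 := by
    -- Strictness comes from `k = 1`, which is a possible value since `c ≥ 1`, with positive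
    -- probability since `q > 0`.
    refine Finset.sum_lt_sum (fun k _ => ?_) ⟨⟨1, by omega⟩, Finset.mem_univ _, ?_⟩
    · refine mul_le_mul_of_nonneg_left ?_ ENNReal.toReal_nonneg
      exact Real.exp_le_one_iff.2 (neg_nonpos.2 (Nat.cast_nonneg _))
    · refine mul_lt_mul_of_pos_left ?_ ?_
      · exact (Real.exp_lt_exp.2 (by norm_num : -((1 : ℕ) : ℝ) < 0)).trans_eq Real.exp_zero
      · refine ENNReal.toReal_pos ?_ (PMF.apply_ne_top _ _)
        rw [← PMF.mem_support_iff, boundedGeometric, PMF.mem_support_normalize_iff]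
        exact pow_ne_zero _ (by exact_mod_cast hq.ne')
  unfold evictRate
  linarith

/-- The sequential evictions are not much rarer than expected in any window. -/
def GoodEvictions {M c : ℕ} (ν A : ℝ) (η : Fin M → Fin (c + 1)) : Prop :=
  ∀ t₀ t, t₀ ≤ t → t ≤ M →
    ν * (t - t₀) ≤ ((∑ i : Fin M, if t₀ ≤ (i : ℕ) ∧ (i : ℕ) < t then (η i : ℕ) else 0 : ℕ) : ℝ) + A

/-- Chernoff's bound with tilt `-1`: by the definition of `evictRate`, one request has `E exp (-k) =
1 - ν ≤ exp (-ν)`. The square counts the windows. -/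
theorem not_goodEvictions_le (M c : ℕ) (q : ℝ≥0) (A : ℝ) :
    (piPMF (boundedGeometric c q)).toOuterMeasure
      {η : Fin M → Fin (c + 1) | ¬ GoodEvictions (evictRate c q) A η} ≤
    ENNReal.ofReal ((M + 1) ^ 2 * Real.exp (-A)) := by
  have key : ∀ x ∈ Finset.range (M + 1) ×ˢ Finset.range (M + 1),
      (piPMF (boundedGeometric c q)).toOuterMeasure {η : Fin M → Fin (c + 1) | x.1 ≤ x.2 ∧
        ((∑ i : Fin M, if x.1 ≤ (i : ℕ) ∧ (i : ℕ) < x.2 then (η i : ℕ) else 0 : ℕ) : ℝ) + A <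
          evictRate c q * (x.2 - x.1)} ≤ ENNReal.ofReal (Real.exp (-A)) := by
    rintro ⟨t₀, t⟩ hx
    simp only [Finset.mem_product, Finset.mem_range] at hx
    simp only
    by_cases htt : t₀ ≤ t
    swap
    · simp [htt]
    refine (toOuterMeasure_le_mean _ (F := fun η => Real.exp (evictRate c q * (t - t₀) - A) *
      ∏ i : Fin M, if t₀ ≤ (i : ℕ) ∧ (i : ℕ) < t then Real.exp (-((η i : ℕ) : ℝ)) else 1)
      (fun η => mul_nonneg (Real.exp_pos _).le (Finset.prod_nonneg fun i _ => by
        split <;> positivity)) fun η hη => ?_).trans (ENNReal.ofReal_le_ofReal ?_)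
    · have h1 : ∀ i : Fin M, (if t₀ ≤ (i : ℕ) ∧ (i : ℕ) < t then Real.exp (-((η i : ℕ) : ℝ)) else 1) =
          Real.exp (-((if t₀ ≤ (i : ℕ) ∧ (i : ℕ) < t then (η i : ℕ) else 0 : ℕ) : ℝ)) := by
        intro i; split <;> simp
      simp_rw [h1]
      rw [← Real.exp_sum, ← Real.exp_add, Finset.sum_neg_distrib]
      apply Real.one_le_exp
      have := hη.2
      push_cast at this ⊢
      linarith
    · rw [mean_const_mul, mean_piPMF (boundedGeometric c q) fun (i : Fin M) k =>
        if t₀ ≤ (i : ℕ) ∧ (i : ℕ) < t then Real.exp (-((k : ℕ) : ℝ)) else 1]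
      have h2 : ∀ i : Fin M, mean (boundedGeometric c q) (fun k =>
          if t₀ ≤ (i : ℕ) ∧ (i : ℕ) < t then Real.exp (-((k : ℕ) : ℝ)) else 1) ≤
          Real.exp (if t₀ ≤ (i : ℕ) ∧ (i : ℕ) < t then -evictRate c q else 0) := by
        intro i
        split
        · have := Real.add_one_le_exp (-evictRate c q)
          unfold evictRate at this ⊢
          linarith
        · simp [mean_const]
      refine (mul_le_mul_of_nonneg_left (Finset.prod_le_prod (fun i _ => mean_nonneg _ fun k => by
        split <;> positivity) fun i _ => h2 i) (Real.exp_pos _).le).trans ?_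
      rw [← Real.exp_sum, ← Real.exp_add]
      apply Real.exp_le_exp.2
      have h3 : ∑ i : Fin M, (if t₀ ≤ (i : ℕ) ∧ (i : ℕ) < t then -evictRate c q else 0) =
          (t - t₀) * -evictRate c q := by
        rw [Fin.sum_univ_eq_sum_range (fun i => if t₀ ≤ i ∧ i < t then -evictRate c q else 0) M,
          ← Finset.sum_filter, Finset.sum_const, nsmul_eq_mul]
        congr 1
        have : (Finset.range M).filter (fun i => t₀ ≤ i ∧ i < t) = Finset.Ico t₀ t := by
          ext i; simp only [Finset.mem_filter, Finset.mem_range, Finset.mem_Ico]; omega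
        rw [this, Nat.card_Ico, Nat.cast_sub htt]
      rw [h3]
      linarith
  refine (MeasureTheory.measure_mono ?_).trans ((toOuterMeasure_iUnion_le _ _ _ key).trans ?_)
  · intro η hη
    by_contra hcon
    simp only [Set.mem_ofPred_eq, not_exists, not_and, Finset.mem_product, Finset.mem_range,
      Prod.forall, not_lt] at hcon
    exact hη fun t₀ t h1 h2 => hcon t₀ t ⟨by omega, by omega⟩ h1
  · apply ENNReal.ofReal_le_ofReal
    rw [Finset.card_product, Finset.card_range]
    push_cast
    rw [sq]

variable {requests : List (Block P)} {d : Block P ⊕ Fin requests.length → Part P}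
  {fill : Part P → Fin (2 ^ P.m)} {η : Fin requests.length → Fin (P.maxEvict + 1)}

theorem schedule_evs_add {t₀ t : ℕ} (h : t₀ ≤ t) (ht : t ≤ requests.length) :
    (schedule P requests d fill η).evs t₀ +
      (∑ i : Fin requests.length, if t₀ ≤ (i : ℕ) ∧ (i : ℕ) < t then (η i : ℕ) else 0) =
      (schedule P requests d fill η).evs t := by
  set σ := schedule P requests d fill η with hσ
  have h1 : ∀ i : Fin requests.length, (if t₀ ≤ (i : ℕ) ∧ (i : ℕ) < t then (η i : ℕ) else 0) =
      if t₀ ≤ (i : ℕ) ∧ (i : ℕ) < t then σ.eta i else 0 := by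
    intro i
    simp [hσ, schedule, i.2]
  simp_rw [h1]
  rw [Fin.sum_univ_eq_sum_range (fun i => if t₀ ≤ i ∧ i < t then σ.eta i else 0) requests.length,
    ← Finset.sum_filter]
  have : (Finset.range requests.length).filter (fun i => t₀ ≤ i ∧ i < t) = Finset.Ico t₀ t := by
    ext i; simp only [Finset.mem_filter, Finset.mem_range, Finset.mem_Ico]; omega
  rw [this]
  exact Finset.sum_range_add_sum_Ico _ h

theorem schedule_cnt {T : ℕ} (hT : T ≤ requests.length) (p : Part P) (E : ℕ) :
    (schedule P requests d fill η).cnt p T E = hit (prevSet requests 0 T) d p + seqCount p E := by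
  have h := schedule_pig_add (fill := fill) (η := η) (d := d) p (Nat.zero_le T) hT
  have h0 : (schedule P requests d fill η).pig p 0 = 0 := Nat.count_zero _
  unfold Schedule.cnt
  omega

theorem prevSet_mono {T₀ T₁ T : ℕ} (h : T₁ ≤ T₀) : prevSet requests T₀ T ⊆ prevSet requests T₁ T :=
  Finset.image_subset_image (Finset.Ico_subset_Ico_left h)

theorem arrSet_mono {T₀ T₁ T : ℕ} (h : T₁ ≤ T₀) : arrSet requests T₀ T ⊆ arrSet requests T₁ T :=
  Finset.image_subset_image (Finset.Ico_subset_Ico_left h)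

/-- The window `[t₀, t)` is rounded to multiples of `n = 2 ^ m`: outward for arrivals, inward for
piggy-backed evictions. The sequential evictions of one slot number at least `ν * i - 3`, with two
lost to the cyclic scan and one to the deviation `A ≤ n`. -/
theorem schedule_cache {J τ : ℕ} {ν A : ℝ} (hd : GoodDraws requests J τ ν d)
    (hη : GoodEvictions ν A η) (hν : 0 ≤ ν) (hA : A ≤ 2 ^ P.m) {t : ℕ} (ht : t ≤ requests.length)
    {L : Part P → ℕ}
    (hL : ∀ p, L p = 0 ∨ ∃ t₀ ≤ t, L p + (schedule P requests d fill η).cnt p t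
        ((schedule P requests d fill η).evs t) + (schedule P requests d fill η).arr p t₀ ≤
      (schedule P requests d fill η).arr p t +
        (schedule P requests d fill η).cnt p t₀ ((schedule P requests d fill η).evs t₀)) :
    ∑ p, (L p : ℝ) ≤ cacheConst ν * 2 ^ P.m := by
  refine hd.cache t ht L fun p => (hL p).imp_right ?_
  rintro ⟨t₀, h0, h⟩
  set σ := schedule P requests d fill η with hσ
  have hn : 0 < 2 ^ P.m := by positivity
  have hdm := Nat.div_add_mod (t - t₀) (2 ^ P.m)
  have hml := Nat.mod_lt (t - t₀) hn
  set i := (t - t₀) / 2 ^ P.m with hi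
  have hile : i ≤ t - t₀ := Nat.div_le_self _ _
  refine ⟨i, by omega, ?_⟩
  have e1 := schedule_evs_add (d := d) (fill := fill) (η := η) h0 ht
  have e2 := hη t₀ t h0 ht
  set X := (∑ i : Fin requests.length, if t₀ ≤ (i : ℕ) ∧ (i : ℕ) < t then (η i : ℕ) else 0) with hX
  have e3 := (seqCount_window p (σ.evs t₀) X).2
  rw [hσ, e1] at e3
  have a1 := schedule_arr_add (d := d) (fill := fill) (η := η) p h0 ht
  have p1 := schedule_pig_add (d := d) (fill := fill) (η := η) p h0 ht
  have a2 := hit_mono (arrSet_mono (requests := requests) (T := t)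
    (show t - (i + 1) * 2 ^ P.m ≤ t₀ by rw [add_mul, mul_comm i]; omega)) d p
  have p2 := hit_mono (prevSet_mono (requests := requests) (T := t)
    (show t₀ ≤ t - i * 2 ^ P.m by rw [mul_comm i]; omega)) d p
  rw [← hσ] at a1 p1 e3 e1
  have k1 : L p + hit (prevSet requests (t - i * 2 ^ P.m) t) d p + seqCount p (σ.evs t) ≤
      hit (arrSet requests (t - (i + 1) * 2 ^ P.m) t) d p + seqCount p (σ.evs t₀) := by
    unfold Schedule.cnt at h
    omega
  have k1r : (L p : ℝ) + hit (prevSet requests (t - i * 2 ^ P.m) t) d p + seqCount p (σ.evs t) ≤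
      hit (arrSet requests (t - (i + 1) * 2 ^ P.m) t) d p + seqCount p (σ.evs t₀) := by
    exact_mod_cast k1
  have e3r : (2 : ℝ) ^ P.m * seqCount p (σ.evs t₀) + X ≤
      2 ^ P.m * seqCount p (σ.evs t) + 2 * 2 ^ P.m := by exact_mod_cast e3
  have hnr : (0 : ℝ) < 2 ^ P.m := by positivity
  have hir : (2 : ℝ) ^ P.m * i ≤ t - t₀ := by
    rw [← Nat.cast_sub h0]
    have : 2 ^ P.m * i ≤ t - t₀ := by omega
    exact_mod_cast this
  have k2 : (2 : ℝ) ^ P.m * (ν * i) ≤ 2 ^ P.m * (seqCount p (σ.evs t) - seqCount p (σ.evs t₀) + 3) := by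
    have := mul_le_mul_of_nonneg_left hir hν
    nlinarith
  have k3 := le_of_mul_le_mul_left k2 hnr
  linarith

end PartitionORAM

namespace PartitionORAM
variable {P : Params}

/-! ### The levels of the writes to a partition -/

/-- The number of `y ∈ [a, b)` for which `2 ^ i` divides `y` modulo `S`. -/
def multCount (S i a b : ℕ) : ℕ := ((Finset.Ico a b).filter fun y => 2 ^ i ∣ y % S).card

/-- A window of length `2 ^ i` contains at most one such number within each period of length `S`,
and as `2 ^ i ≤ S` it meets at most two periods. -/
theorem multCount_le_two {S i a : ℕ} (hS : 2 ^ i ≤ S) : multCount S i a (a + 2 ^ i) ≤ 2 := by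
  have hi : 0 < 2 ^ i := by positivity
  have hS0 : 0 < S := hi.trans_le hS
  have hinj : Set.InjOn (· / S) ((Finset.Ico a (a + 2 ^ i)).filter fun y => 2 ^ i ∣ y % S : Finset ℕ) := by
    intro y hy z hz h
    simp only [Finset.coe_filter, Finset.mem_Ico, Set.mem_ofPred_eq] at hy hz h
    obtain ⟨⟨y1, y2⟩, u, hu⟩ := hy
    obtain ⟨⟨z1, z2⟩, v, hv⟩ := hz
    have e1 := Nat.div_add_mod y S
    have e2 := Nat.div_add_mod z S
    rw [h, hu] at e1
    rw [hv] at e2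
    rcases lt_trichotomy u v with huv | rfl | huv
    · have : 2 ^ i * (u + 1) ≤ 2 ^ i * v := Nat.mul_le_mul_left _ huv
      rw [mul_add, mul_one] at this
      omega
    · omega
    · have : 2 ^ i * (v + 1) ≤ 2 ^ i * u := Nat.mul_le_mul_left _ huv
      rw [mul_add, mul_one] at this
      omega
  unfold multCount
  rw [← Finset.card_image_of_injOn hinj]
  refine (Finset.card_le_card (t := {a / S, a / S + 1}) ?_).trans Finset.card_le_two
  intro x hx
  simp only [Finset.mem_image, Finset.mem_filter, Finset.mem_Ico] at hx
  obtain ⟨y, ⟨⟨y1, y2⟩, -⟩, rfl⟩ := hx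
  have h1 : a / S ≤ y / S := Nat.div_le_div_right y1
  have h2 : y / S ≤ (a + S) / S := Nat.div_le_div_right (by omega)
  rw [Nat.add_div_right _ hS0] at h2
  simp only [Finset.mem_insert, Finset.mem_singleton]
  omega

theorem multCount_mono {S i a b b' : ℕ} (h : b ≤ b') : multCount S i a b ≤ multCount S i a b' :=
  Finset.card_le_card (Finset.filter_subset_filter _ (Finset.Ico_subset_Ico_right h))

theorem multCount_le_mul {S i a : ℕ} (hS : 2 ^ i ≤ S) (c : ℕ) :
    multCount S i a (a + c * 2 ^ i) ≤ 2 * c := by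
  induction c with
  | zero => simp [multCount]
  | succ c ih =>
    have h : multCount S i a (a + (c + 1) * 2 ^ i) ≤ multCount S i a (a + c * 2 ^ i) +
        multCount S i (a + c * 2 ^ i) (a + c * 2 ^ i + 2 ^ i) := by
      unfold multCount
      rw [show a + (c + 1) * 2 ^ i = a + c * 2 ^ i + 2 ^ i by ring,
        ← Finset.Ico_union_Ico_eq_Ico (Nat.le_add_right a (c * 2 ^ i))
          (Nat.le_add_right (a + c * 2 ^ i) (2 ^ i)), Finset.filter_union]
      exact Finset.card_union_le _ _
    have := multCount_le_two (a := a + c * 2 ^ i) hS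
    omega

/-- For a random start, the exponential moments of the number of multiples in a window. -/
theorem mean_exp_multCount_le {n S i : ℕ} [NeZero n] (hin : 2 ^ i ∣ n) (hS : 2 ^ i ≤ S)
    {a b : ℕ} (hab : a ≤ b) {θ : ℝ} (hθ : 0 ≤ θ) :
    mean (PMF.uniformOfFintype (Fin n)) (fun f => Real.exp (θ * multCount S i (f + a) (f + b))) ≤
      Real.exp (4 * Real.exp (2 * θ) * (b - a) / 2 ^ i) := by
  obtain ⟨k, rfl⟩ := Nat.exists_eq_add_of_le hab
  have hi : 0 < 2 ^ i := by positivity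
  have hir : (0 : ℝ) < 2 ^ i := by positivity
  have hn : (0 : ℝ) < n := by exact_mod_cast Nat.pos_of_ne_zero (NeZero.ne n)
  have hθe : θ ≤ Real.exp (2 * θ) := by linarith [Real.add_one_le_exp (2 * θ)]
  have hka : ((a + k : ℕ) : ℝ) - a = k := by push_cast; ring
  rw [hka]
  rcases le_or_gt (2 ^ i) k with hk | hk
  -- A long window satisfies a deterministic bound, for any start.
  · have hcount : ∀ f : Fin n, (multCount S i (f + a) (f + (a + k)) : ℝ) ≤ 4 * k / 2 ^ i := by
      intro f
      have h1 : multCount S i (f + a) (f + (a + k)) ≤ 2 * (k / 2 ^ i + 1) := by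
        refine le_trans (multCount_mono ?_) (multCount_le_mul hS (k / 2 ^ i + 1))
        have := Nat.div_add_mod k (2 ^ i)
        have := Nat.mod_lt k hi
        rw [add_mul, mul_comm (k / 2 ^ i)]; omega
      have h2 : (k / 2 ^ i + 1) * 2 ^ i ≤ 2 * k := by
        have := Nat.div_mul_le_self k (2 ^ i)
        rw [add_mul]; omega
      have h3 : (multCount S i (f + a) (f + (a + k)) : ℝ) ≤ 2 * ((k / 2 ^ i + 1 : ℕ) : ℝ) := by
        exact_mod_cast h1
      have h4 : ((k / 2 ^ i + 1 : ℕ) : ℝ) * 2 ^ i ≤ 2 * k := by exact_mod_cast h2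
      rw [le_div_iff₀ hir]
      nlinarith
    refine (mean_mono _ fun f => Real.exp_le_exp.2 (show _ ≤ 4 * Real.exp (2 * θ) * k / 2 ^ i from ?_)).trans_eq
      (mean_const _ _)
    calc θ * (multCount S i (f + a) (f + (a + k)) : ℝ) ≤ Real.exp (2 * θ) * (4 * k / 2 ^ i) :=
          mul_le_mul hθe (hcount f) (Nat.cast_nonneg _) (Real.exp_pos _).le
      _ = _ := by ring
  -- A short window contains at most two such numbers, so the exponential is at most `1 + exp (2 *
  -- θ)` times the count, and the mean count suffices.
  · have hcount : ∀ f : Fin n, multCount S i (f + a) (f + (a + k)) ≤ 2 := by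
      intro f
      have := multCount_le_mul (a := f + a) hS 1
      exact (multCount_mono (by omega)).trans this
    have hexp : ∀ f : Fin n, Real.exp (θ * multCount S i (f + a) (f + (a + k))) ≤
        1 + Real.exp (2 * θ) * multCount S i (f + a) (f + (a + k)) := by
      intro f
      have h1 := hcount f
      have h2 : Real.exp θ ≤ Real.exp (2 * θ) := Real.exp_le_exp.2 (by linarith)
      have h3 := Real.exp_pos (2 * θ)
      interval_cases multCount S i (f + a) (f + (a + k))
      · simp
      · simp only [Nat.cast_one, mul_one]; linarith
      · simp only [Nat.cast_ofNat]; rw [mul_comm θ]; linarith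
    refine (mean_mono _ hexp).trans ?_
    rw [mean_add, mean_const, mean_const_mul, mean_uniform, Fintype.card_fin]
    have hswap : ∑ f : Fin n, (multCount S i (f + a) (f + (a + k)) : ℝ) ≤
        k * (2 * (n / 2 ^ i)) := by
      have h1 : ∀ f : Fin n, multCount S i (f + a) (f + (a + k)) =
          ∑ j ∈ Finset.range k, if 2 ^ i ∣ ((f : ℕ) + (a + j)) % S then 1 else 0 := by
        intro f
        unfold multCount
        rw [Finset.card_filter, Finset.sum_Ico_eq_sum_range]
        rw [show (f : ℕ) + (a + k) - (f + a) = k by omega]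
        refine Finset.sum_congr rfl fun j _ => ?_
        rw [add_assoc]
      -- For a fixed offset the start runs through `n` consecutive numbers, that is, `n / 2 ^ i`
      -- windows of length `2 ^ i` with at most two hits each.
      have h2 : ∀ j, ∑ f : Fin n, (if 2 ^ i ∣ ((f : ℕ) + (a + j)) % S then 1 else 0) ≤
          2 * (n / 2 ^ i) := by
        intro j
        rw [Fin.sum_univ_eq_sum_range (fun f => if 2 ^ i ∣ (f + (a + j)) % S then 1 else 0) n]
        have := multCount_le_mul (a := a + j) hS (n / 2 ^ i)
        rw [Nat.div_mul_cancel hin] at this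
        refine le_trans (le_of_eq ?_) this
        unfold multCount
        rw [Finset.card_filter, Finset.sum_Ico_eq_sum_range, Nat.add_sub_cancel_left]
        refine Finset.sum_congr rfl fun j _ => ?_
        rw [add_comm]
      have h3 : ∑ f : Fin n, multCount S i (f + a) (f + (a + k)) ≤ k * (2 * (n / 2 ^ i)) := by
        simp_rw [h1]
        rw [Finset.sum_comm]
        refine (Finset.sum_le_sum fun j _ => h2 j).trans_eq ?_
        rw [Finset.sum_const, Finset.card_range, smul_eq_mul]
      have h4 : ((n / 2 ^ i : ℕ) : ℝ) = n / 2 ^ i := by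
        rw [Nat.cast_div hin (by positivity)]; push_cast; rfl
      rw [← h4]
      exact_mod_cast h3
    refine le_trans ?_ (Real.add_one_le_exp _)
    rw [add_comm]
    gcongr ?_ + 1
    calc _ ≤ Real.exp (2 * θ) * (k * (2 * (n / 2 ^ i)) / n) := by gcongr
      _ = 2 * (Real.exp (2 * θ) * k / 2 ^ i) := by field_simp
      _ ≤ 4 * (Real.exp (2 * θ) * k / 2 ^ i) := by
        have : 0 ≤ Real.exp (2 * θ) * k / 2 ^ i := by positivity
        linarith
      _ = _ := by ring

/-- The fillings of different partitions are independent, so the moments multiply and only the total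
length `K` of the windows matters. -/
theorem multCount_tail {κ : Type*} [Fintype κ] [DecidableEq κ] {n S i : ℕ} [NeZero n]
    (hin : 2 ^ i ∣ n) (hS : 2 ^ i ≤ S) {a b : κ → ℕ} (hab : ∀ p, a p ≤ b p) {θ : ℝ} (hθ : 0 ≤ θ)
    {K : ℝ} (hK : ∑ p, ((b p : ℝ) - a p) ≤ K) (A : ℝ) :
    (piPMF (PMF.uniformOfFintype (Fin n))).toOuterMeasure {f : κ → Fin n |
      4 * Real.exp (2 * θ) * K / 2 ^ i + A <
        θ * (∑ p, multCount S i (f p + a p) (f p + b p) : ℕ)} ≤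
      ENNReal.ofReal (Real.exp (-A)) := by
  refine (toOuterMeasure_le_mean _ (F := fun f =>
    Real.exp (-(4 * Real.exp (2 * θ) * K / 2 ^ i + A)) *
    ∏ p, Real.exp (θ * multCount S i (f p + a p) (f p + b p)))
    (fun f => by positivity) fun f hf => ?_).trans (ENNReal.ofReal_le_ofReal ?_)
  · rw [← Real.exp_sum, ← Real.exp_add, ← Finset.mul_sum]
    apply Real.one_le_exp
    simp only [Set.mem_ofPred_eq] at hf
    push_cast at hf
    linarith
  · rw [mean_const_mul, mean_piPMF (PMF.uniformOfFintype (Fin n)) fun p f =>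
      Real.exp (θ * multCount S i (f + a p) (f + b p))]
    refine (mul_le_mul_of_nonneg_left (Finset.prod_le_prod (fun p _ => mean_nonneg _ fun f =>
      (Real.exp_pos _).le) fun p _ => mean_exp_multCount_le hin hS (hab p) hθ)
      (Real.exp_pos _).le).trans ?_
    rw [← Real.exp_sum, ← Real.exp_add]
    apply Real.exp_le_exp.2
    rw [← Finset.sum_div, ← Finset.mul_sum]
    have : 4 * Real.exp (2 * θ) * ∑ p, ((b p : ℝ) - a p) / 2 ^ i ≤ 4 * Real.exp (2 * θ) * (K / 2 ^ i) := by
      rw [← Finset.sum_div]; gcongr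
    have h2 : 4 * Real.exp (2 * θ) * (∑ p, ((b p : ℝ) - a p)) / 2 ^ i ≤ 4 * Real.exp (2 * θ) * K / 2 ^ i := by
      gcongr
    linarith

end PartitionORAM

namespace PartitionORAM
variable {P : Params}

/-! ### Consequences for the schedule -/

section Deduce

variable (requests : List (Block P)) (d : Block P ⊕ Fin requests.length → Part P)

/-- The number of writes to `p` after `T` piggy-backed and `E` sequential evictions. -/
def writes (p : Part P) (T E : ℕ) : ℕ := hit (prevSet requests 0 T) d p + seqCount p E

/-- An upper bound for the number of merged writes of a job of `p`, if a job waits at most `τ` steps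
per write. -/
def chainLen (τ T : ℕ) (p : Part P) : ℕ :=
  Nat.findGreatest (fun h => h ≤ 2 * hit (prevSet requests (T - h * τ) T) d p + 4)
    (2 * requests.length + 4)

/-- The exponent used for level `i`. -/
noncomputable def tilt (m G i : ℕ) : ℝ := if i + G ≤ m then 1 else G

/-- Initial fillings for which high levels are not due too often. -/
structure GoodFill (c τ G : ℕ) (A : ℝ) (fill : Part P → Fin (2 ^ P.m)) : Prop where
  windows : ∀ T₀ E₀ T E i, T₀ ≤ T → T ≤ requests.length → E₀ ≤ E → E ≤ requests.length * c →
    i ≤ P.m → tilt P.m G i * (∑ p, multCount P.capacity i (fill p + (1 + writes requests d p T₀ E₀))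
      (fill p + (1 + writes requests d p T E)) : ℕ) ≤
      4 * Real.exp (2 * tilt P.m G i) * ((T : ℝ) + E - (T₀ + E₀)) / 2 ^ i + A
  tails : ∀ T E i, T ≤ requests.length → E ≤ requests.length * c → i ≤ P.m →
    1 * (∑ p, multCount P.capacity i
      (fill p + (1 + (writes requests d p T E - chainLen requests d τ T p)))
      (fill p + (1 + writes requests d p T E)) : ℕ) ≤
      4 * Real.exp (2 * 1) * (∑ p, (chainLen requests d τ T p : ℝ)) / 2 ^ i + A

variable {requests d}

theorem writes_mono (p : Part P) {T₀ E₀ T E : ℕ} (hT : T₀ ≤ T) (hE : E₀ ≤ E) :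
    writes requests d p T₀ E₀ ≤ writes requests d p T E :=
  add_le_add (hit_mono (Finset.image_subset_image (Finset.Ico_subset_Ico_right hT)) d p)
    (Nat.count_monotone _ hE)

theorem sum_writes {T : ℕ} (hT : T ≤ requests.length) (E : ℕ) :
    ∑ p, writes requests d p T E = T + E := by
  rw [← Schedule.sum_cnt (schedule P requests d (fun _ => ⟨0, by positivity⟩) fun _ => 0) T E]
  exact Finset.sum_congr rfl fun p _ => (schedule_cnt hT p E).symm

theorem two_pow_le_capacity {i : ℕ} (hi : i ≤ P.m) : 2 ^ i ≤ P.capacity :=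
  (Nat.pow_le_pow_right two_pos hi).trans (Nat.le_add_right _ _)

-- Given the draws `d`, the windows and the lengths `chainLen` are fixed while the fillings are
-- still uniform. Quantifying over all pairs `(T, E)` with `E ≤ M * c` avoids any dependence on the
-- eviction numbers.
variable (d) in
theorem not_goodFill_le (c τ G : ℕ) (A : ℝ) :
    (piPMF (PMF.uniformOfFintype (Fin (2 ^ P.m)))).toOuterMeasure
      {fill : Part P → Fin (2 ^ P.m) | ¬ GoodFill requests d c τ G A fill} ≤
    ENNReal.ofReal (2 * ((requests.length + 1) * (requests.length * c + 1)) ^ 2 * (P.m + 1) *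
      Real.exp (-A)) := by
  have b1 := toOuterMeasure_iUnion_le (piPMF (PMF.uniformOfFintype (Fin (2 ^ P.m))))
    (((Finset.range (requests.length + 1) ×ˢ Finset.range (requests.length * c + 1)) ×ˢ
      (Finset.range (requests.length + 1) ×ˢ Finset.range (requests.length * c + 1))) ×ˢ Finset.range (P.m + 1))
    (fun x => {fill : Part P → Fin (2 ^ P.m) | x.1.1.1 ≤ x.1.2.1 ∧ x.1.1.2 ≤ x.1.2.2 ∧
      4 * Real.exp (2 * tilt P.m G x.2) *
        ((x.1.2.1 : ℝ) + x.1.2.2 - (x.1.1.1 + x.1.1.2)) / 2 ^ x.2 + A <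
      tilt P.m G x.2 * (∑ p, multCount P.capacity x.2
        (fill p + (1 + writes requests d p x.1.1.1 x.1.1.2))
        (fill p + (1 + writes requests d p x.1.2.1 x.1.2.2)) : ℕ)})
    (ε := Real.exp (-A)) (by
      rintro ⟨⟨⟨T₀, E₀⟩, T, E⟩, i⟩ hx
      simp only [Finset.mem_product, Finset.mem_range] at hx
      simp only
      by_cases hT : T₀ ≤ T
      swap
      · simp [hT]
      by_cases hE : E₀ ≤ E
      swap
      · simp [hE]
      refine le_trans (MeasureTheory.measure_mono fun fill hf => hf.2.2)
        (multCount_tail (κ := Part P) (pow_dvd_pow 2 (by omega)) (two_pow_le_capacity (by omega))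
          (a := fun p => 1 + writes requests d p T₀ E₀) (b := fun p => 1 + writes requests d p T E)
          (fun p => Nat.add_le_add_left (writes_mono p hT hE) 1)
          (by unfold tilt; split <;> simp) ?_ A)
      have h1 := sum_writes (d := d) (show T ≤ requests.length by omega) E
      have h0 := sum_writes (d := d) (show T₀ ≤ requests.length by omega) E₀
      have h1r : ∑ p, (writes requests d p T E : ℝ) = T + E := by exact_mod_cast h1
      have h0r : ∑ p, (writes requests d p T₀ E₀ : ℝ) = T₀ + E₀ := by exact_mod_cast h0
      rw [← h1r, ← h0r, ← Finset.sum_sub_distrib]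
      refine Finset.sum_le_sum fun p _ => ?_
      push_cast
      linarith)
  have b2 := toOuterMeasure_iUnion_le (piPMF (PMF.uniformOfFintype (Fin (2 ^ P.m))))
    ((Finset.range (requests.length + 1) ×ˢ Finset.range (requests.length * c + 1)) ×ˢ Finset.range (P.m + 1))
    (fun x => {fill : Part P → Fin (2 ^ P.m) |
      4 * Real.exp (2 * 1) * (∑ p, (chainLen requests d τ x.1.1 p : ℝ)) / 2 ^ x.2 + A <
      1 * (∑ p, multCount P.capacity x.2
        (fill p + (1 + (writes requests d p x.1.1 x.1.2 - chainLen requests d τ x.1.1 p)))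
        (fill p + (1 + writes requests d p x.1.1 x.1.2)) : ℕ)})
    (ε := Real.exp (-A)) (by
      rintro ⟨⟨T, E⟩, i⟩ hx
      simp only [Finset.mem_product, Finset.mem_range] at hx
      simp only
      refine multCount_tail (κ := Part P) (pow_dvd_pow 2 (by omega)) (two_pow_le_capacity (by omega))
          (a := fun p => 1 + (writes requests d p T E - chainLen requests d τ T p))
          (b := fun p => 1 + writes requests d p T E)
          (fun p => by omega) zero_le_one ?_ A
      refine Finset.sum_le_sum fun p _ => ?_
      rw [sub_le_iff_le_add']
      exact_mod_cast (by omega : 1 + writes requests d p T E ≤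
        1 + (writes requests d p T E - chainLen requests d τ T p) + chainLen requests d τ T p))
  refine (MeasureTheory.measure_mono ?_).trans ((MeasureTheory.measure_union_le _ _).trans
    ((add_le_add b1 b2).trans ?_))
  · intro fill hf
    by_contra hcon
    simp only [Set.mem_union, not_or] at hcon
    obtain ⟨h1, h2⟩ := hcon
    simp only [Set.mem_ofPred_eq, not_exists, not_and, Finset.mem_product, Finset.mem_range,
      Prod.forall, not_lt] at h1 h2
    exact hf ⟨fun T₀ E₀ T E i a1 a2 a3 a4 a5 => h1 T₀ E₀ T E i
      ⟨⟨⟨by omega, by omega⟩, by omega, by omega⟩, by omega⟩ a1 a3,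
      fun T E i a1 a2 a3 => h2 T E i ⟨⟨by omega, by omega⟩, by omega⟩⟩
  · rw [← ENNReal.ofReal_add (by positivity) (by positivity)]
    apply ENNReal.ofReal_le_ofReal
    simp only [Finset.card_product, Finset.card_range]
    push_cast
    have h1 : (1 : ℝ) ≤ (requests.length + 1) * (requests.length * c + 1) := by
      have : (0 : ℝ) ≤ requests.length * c := by positivity
      nlinarith [Nat.cast_nonneg (α := ℝ) requests.length]
    have h2 : ((requests.length : ℝ) + 1) * (requests.length * c + 1) ≤ ((requests.length + 1) * (requests.length * c + 1)) ^ 2 := by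
      rw [sq]; exact le_mul_of_one_le_left (by positivity) h1
    have h3 : (0 : ℝ) ≤ (P.m + 1) * Real.exp (-A) := by positivity
    have := mul_le_mul_of_nonneg_right h2 h3
    linarith

theorem chainLen_spec (τ T : ℕ) (p : Part P) : chainLen requests d τ T p ≤
    2 * hit (prevSet requests (T - chainLen requests d τ T p * τ) T) d p + 4 := by
  unfold chainLen
  exact Nat.findGreatest_spec (P := fun h => h ≤ 2 * hit (prevSet requests (T - h * τ) T) d p + 4)
    (m := 0) (Nat.zero_le _) (Nat.zero_le _)

theorem le_chainLen {τ T h : ℕ} {p : Part P} (hT : T ≤ requests.length)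
    (hh : h ≤ 2 * hit (prevSet requests (T - h * τ) T) d p + 4) : h ≤ chainLen requests d τ T p := by
  unfold chainLen
  refine Nat.le_findGreatest ?_ hh
  have := (hit_le_card (prevSet requests (T - h * τ) T) d p).trans (prevSet_card_le _ _)
  omega

variable {fill : Part P → Fin (2 ^ P.m)} {η : Fin requests.length → Fin (P.maxEvict + 1)}

theorem card_filter_lev (p : Part P) (a b : ℕ) {i : ℕ} (hi : i ≤ P.m) :
    ((Finset.Ico a b).filter fun j => i ≤ ((schedule P requests d fill η).lev p j : ℕ)).card =
      multCount P.capacity i (fill p + (1 + a)) (fill p + (1 + b)) := by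
  unfold multCount
  rw [Finset.card_filter, Finset.card_filter, Finset.sum_Ico_eq_sum_range,
    Finset.sum_Ico_eq_sum_range,
    show (fill p : ℕ) + (1 + b) - (fill p + (1 + a)) = b - a by omega]
  refine Finset.sum_congr rfl fun j _ => ?_
  have : i ≤ ((schedule P requests d fill η).lev p (a + j) : ℕ) ↔
      2 ^ i ∣ ((fill p : ℕ) + (1 + a) + j) % P.capacity := by
    unfold Schedule.lev
    rw [le_jobLevel_iff hi]
    have : (schedule P requests d fill η).fill p = fill p := rfl
    rw [this, show (fill p : ℕ) + 1 + (a + j) = fill p + (1 + a) + j by omega]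
  simp only [this]

theorem jobWork_le (hs : P.surplus ≤ 2 ^ P.m) (l : Lvl P) : jobWork P l ≤ 12 * 2 ^ (l : ℕ) := by
  have hslots : ∀ i : Lvl P, slots P i ≤ 4 * 2 ^ (i : ℕ) := by
    intro i
    unfold slots half Params.capacity
    split
    · rename_i h; rw [h]; omega
    · omega
  have hsum : ∑ i ∈ Finset.Iic l, 2 ^ (i : ℕ) ≤ 2 * 2 ^ (l : ℕ) := by
    have h1 : ∑ i ∈ Finset.Iic l, 2 ^ (i : ℕ) = ∑ i ∈ (Finset.Iic l).map Fin.valEmbedding, 2 ^ i := by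
      rw [Finset.sum_map]; rfl
    rw [h1]
    calc _ ≤ ∑ i ∈ Finset.range ((l : ℕ) + 1), 2 ^ i := by
          refine Finset.sum_le_sum_of_subset fun i hi => ?_
          simp only [Finset.mem_map, Finset.mem_Iic, Fin.valEmbedding_apply] at hi
          obtain ⟨j, hj, rfl⟩ := hi
          rw [Finset.mem_range]
          have : (j : ℕ) ≤ l := hj
          omega
      _ ≤ _ := by
        have := Nat.geomSum_eq (m := 2) le_rfl ((l : ℕ) + 1)
        rw [this, pow_succ]; omega
  unfold jobWork
  have h2 : ∑ i ∈ Finset.Iic l, slots P i ≤ 4 * ∑ i ∈ Finset.Iic l, 2 ^ (i : ℕ) := by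
    rw [Finset.mul_sum]; exact Finset.sum_le_sum fun i _ => hslots i
  have := hslots l
  omega

/-- Layer-cake summation: a function of the level is written as a sum over thresholds `i`, so that
only the numbers of writes of level at least `i` are needed. -/
theorem sum_window_swap (σ : Schedule P) (g : ℕ → ℕ) (a b : Part P → ℕ) (F : Lvl P → ℕ)
    (hF : ∀ l, F l ≤ ∑ i ∈ Finset.range (P.m + 1), if i ≤ (l : ℕ) then g i else 0) :
    ∑ p, ∑ j ∈ Finset.Ico (a p) (b p), F (σ.lev p j) ≤
      ∑ i ∈ Finset.range (P.m + 1), g i *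
        ∑ p, ((Finset.Ico (a p) (b p)).filter fun j => i ≤ (σ.lev p j : ℕ)).card := by
  calc _ ≤ ∑ p, ∑ j ∈ Finset.Ico (a p) (b p), ∑ i ∈ Finset.range (P.m + 1),
        if i ≤ (σ.lev p j : ℕ) then g i else 0 :=
        Finset.sum_le_sum fun p _ => Finset.sum_le_sum fun j _ => hF _
    _ = ∑ p, ∑ i ∈ Finset.range (P.m + 1), ∑ j ∈ Finset.Ico (a p) (b p),
        if i ≤ (σ.lev p j : ℕ) then g i else 0 :=
        Finset.sum_congr rfl fun p _ => Finset.sum_comm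
    _ = _ := by
      rw [Finset.sum_comm]
      refine Finset.sum_congr rfl fun i _ => ?_
      rw [Finset.mul_sum]
      refine Finset.sum_congr rfl fun p _ => ?_
      rw [← Finset.sum_filter, Finset.sum_const, smul_eq_mul, mul_comm]

theorem exp_two_le : Real.exp 2 ≤ 7.5 := by
  have h := Real.exp_one_lt_d9
  have : Real.exp 2 = Real.exp 1 ^ 2 := by rw [← Real.exp_nat_mul]; norm_num
  rw [this]
  calc Real.exp 1 ^ 2 ≤ 2.7182818286 ^ 2 := by gcongr
    _ ≤ 7.5 := by norm_num

/-- A threshold `i` contributes work `2 ^ i` per write. With tilt `1` the deviations `2 ^ i * A` for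
`i ≤ m - G` sum to at most `2 * 2 ^ (m - G) * A`, which is below `2 * 2 ^ m * A / G`. The top `G`
levels, with tilt `G`, deviate by `2 ^ i * A / G` only, and their means add up to `4 * exp (2 * G)`
per write step. So the additive slack is divided by `G`, while the rate grows only by a constant. -/
theorem sched_le {c τ G : ℕ} {A : ℝ} (hf : GoodFill requests d c τ G A fill)
    (hs : P.surplus ≤ 2 ^ P.m) (hA : 0 ≤ A) (hG0 : 0 < G) (hGm : G ≤ P.m) {T₀ E₀ T E : ℕ}
    (hT₀ : T₀ ≤ T) (hT : T ≤ requests.length) (hE₀ : E₀ ≤ E) (hE : E ≤ requests.length * c) :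
    ((schedule P requests d fill η).sched T₀ E₀ T E : ℝ) ≤
      ((T : ℝ) + E - (T₀ + E₀)) * (360 * (P.m + 1) + 48 * Real.exp (2 * G)) +
        48 * 2 ^ P.m * A / G := by
  set σ := schedule P requests d fill η with hσ
  set W : ℝ := ((T : ℝ) + E - (T₀ + E₀) : ℝ) with hW
  have hW0 : 0 ≤ W := by
    have : (T₀ : ℝ) ≤ T := by exact_mod_cast hT₀
    have : (E₀ : ℝ) ≤ E := by exact_mod_cast hE₀
    linarith
  have hGr : (0 : ℝ) < G := by exact_mod_cast hG0
  set N : ℕ → ℕ := fun i => ∑ p, multCount P.capacity i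
    (fill p + (1 + writes requests d p T₀ E₀)) (fill p + (1 + writes requests d p T E)) with hN
  have h1 : σ.sched T₀ E₀ T E ≤ ∑ i ∈ Finset.range (P.m + 1), 12 * 2 ^ i * N i := by
    unfold Schedule.sched
    refine (sum_window_swap σ (fun i => 12 * 2 ^ i) _ _ (jobWork P) fun l => ?_).trans_eq ?_
    · refine (jobWork_le hs l).trans ?_
      have := Finset.single_le_sum (s := Finset.range (P.m + 1))
        (f := fun i => if i ≤ (l : ℕ) then 12 * 2 ^ i else 0) (fun _ _ => Nat.zero_le _)
        (Finset.mem_range.2 l.2)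
      simpa using this
    · refine Finset.sum_congr rfl fun i hi => ?_
      rw [Finset.mem_range] at hi
      congr 1
      refine Finset.sum_congr rfl fun p _ => ?_
      rw [card_filter_lev p _ _ (by omega), schedule_cnt (by omega), schedule_cnt hT]
      rfl
  have h2 : ∀ i ∈ Finset.range (P.m + 1), (2 : ℝ) ^ i * N i ≤ 30 * W + 2 ^ i * (A / G) +
      ((if i + G ≤ P.m then 2 ^ i * A else 0) +
        if i + G ≤ P.m then 0 else 4 * Real.exp (2 * G) * W / G) := by
    intro i hi
    rw [Finset.mem_range] at hi
    have h3 := hf.windows T₀ E₀ T E i hT₀ hT hE₀ hE (by omega)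
    have hp : (0 : ℝ) < 2 ^ i := by positivity
    have hAG : 0 ≤ (2 : ℝ) ^ i * (A / G) := by positivity
    unfold tilt at h3
    by_cases hiG : i + G ≤ P.m
    · simp only [hiG, if_true, one_mul] at h3 ⊢
      have h4 : (2 : ℝ) ^ i * N i ≤ 2 ^ i * (4 * Real.exp (2 * 1) * W / 2 ^ i + A) :=
        mul_le_mul_of_nonneg_left h3 hp.le
      have h5 : (2 : ℝ) ^ i * (4 * Real.exp (2 * 1) * W / 2 ^ i + A) =
          4 * Real.exp 2 * W + 2 ^ i * A := by
        rw [mul_one]; field_simp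
      have h6 : 4 * Real.exp 2 * W ≤ 30 * W := by
        gcongr; linarith [exp_two_le]
      linarith
    · simp only [hiG, if_false] at h3 ⊢
      have h4 : (2 : ℝ) ^ i * (G * N i) ≤ 2 ^ i * (4 * Real.exp (2 * G) * W / 2 ^ i + A) :=
        mul_le_mul_of_nonneg_left h3 hp.le
      have h5 : (2 : ℝ) ^ i * (4 * Real.exp (2 * G) * W / 2 ^ i + A) =
          4 * Real.exp (2 * G) * W + 2 ^ i * A := by field_simp
      have h6 : (2 : ℝ) ^ i * N i ≤ (4 * Real.exp (2 * G) * W + 2 ^ i * A) / G := by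
        rw [le_div_iff₀ hGr]; linarith
      rw [add_div] at h6
      have h7 : (2 : ℝ) ^ i * (A / G) = 2 ^ i * A / G := by ring
      have : 0 ≤ 30 * W := by positivity
      linarith
  have hgeo : ∀ n : ℕ, ∑ i ∈ Finset.range n, (2 : ℝ) ^ i ≤ 2 ^ n := by
    intro n
    rw [geom_sum_eq (by norm_num)]
    have : (0 : ℝ) < 2 ^ n := by positivity
    norm_num
  have s1 : ∑ i ∈ Finset.range (P.m + 1), (if i + G ≤ P.m then (2 : ℝ) ^ i * A else 0) ≤
      2 * 2 ^ P.m * (A / G) := by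
    rw [← Finset.sum_filter, ← Finset.sum_mul]
    have e1 : (Finset.range (P.m + 1)).filter (fun i => i + G ≤ P.m) =
        Finset.range (P.m - G + 1) := by
      ext i; simp only [Finset.mem_filter, Finset.mem_range]; omega
    rw [e1]
    have e2 : (G : ℝ) ≤ 2 ^ G := by exact_mod_cast Nat.lt_two_pow_self.le
    have e3 : (2 : ℝ) ^ (P.m - G + 1) * 2 ^ G = 2 * 2 ^ P.m := by
      rw [← pow_add, show P.m - G + 1 + G = P.m + 1 by omega, pow_succ]; ring
    have e4 : (2 : ℝ) ^ (P.m - G + 1) * G ≤ 2 * 2 ^ P.m := by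
      rw [← e3]; gcongr
    calc _ ≤ (2 : ℝ) ^ (P.m - G + 1) * A := by gcongr; exact hgeo _
      _ = (2 : ℝ) ^ (P.m - G + 1) * G * (A / G) := by field_simp
      _ ≤ _ := by gcongr
  have s2 : ∑ i ∈ Finset.range (P.m + 1),
      (if i + G ≤ P.m then 0 else 4 * Real.exp (2 * G) * W / G) ≤ 4 * Real.exp (2 * G) * W := by
    have e0 : ∀ i, (if i + G ≤ P.m then 0 else 4 * Real.exp (2 * G) * W / G) =
        if ¬ i + G ≤ P.m then 4 * Real.exp (2 * G) * W / G else 0 := by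
      intro i; split <;> simp_all
    simp_rw [e0]
    rw [← Finset.sum_filter, Finset.sum_const, nsmul_eq_mul]
    have e1 : ((Finset.range (P.m + 1)).filter (fun i => ¬ i + G ≤ P.m)).card ≤ G := by
      have : (Finset.range (P.m + 1)).filter (fun i => ¬ i + G ≤ P.m) ⊆
          Finset.Ico (P.m + 1 - G) (P.m + 1) := by
        intro i; simp only [Finset.mem_filter, Finset.mem_range, Finset.mem_Ico]; omega
      refine (Finset.card_le_card this).trans ?_
      rw [Nat.card_Ico]; omega
    calc _ ≤ (G : ℝ) * (4 * Real.exp (2 * G) * W / G) := by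
          gcongr
      _ = _ := by field_simp
  have s3 : ∑ i ∈ Finset.range (P.m + 1), (2 : ℝ) ^ i * (A / G) ≤ 2 * 2 ^ P.m * (A / G) := by
    rw [← Finset.sum_mul]
    gcongr
    refine (hgeo _).trans_eq ?_
    rw [pow_succ]; ring
  have h1r : (σ.sched T₀ E₀ T E : ℝ) ≤ ∑ i ∈ Finset.range (P.m + 1), (12 : ℝ) * (2 ^ i * N i) := by
    have : (σ.sched T₀ E₀ T E : ℝ) ≤ ((∑ i ∈ Finset.range (P.m + 1), 12 * 2 ^ i * N i : ℕ) : ℝ) := by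
      exact_mod_cast h1
    refine this.trans_eq ?_
    push_cast
    refine Finset.sum_congr rfl fun i _ => ?_
    ring
  rw [← Finset.mul_sum] at h1r
  have h3 := Finset.sum_le_sum h2
  rw [Finset.sum_add_distrib, Finset.sum_add_distrib, Finset.sum_add_distrib, Finset.sum_const,
    Finset.card_range, nsmul_eq_mul] at h3
  push_cast at h3
  calc (σ.sched T₀ E₀ T E : ℝ) ≤ 12 * (((P.m : ℝ) + 1) * (30 * W) + 2 * 2 ^ P.m * (A / G) +
        (2 * 2 ^ P.m * (A / G) + 4 * Real.exp (2 * G) * W)) := by linarith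
    _ = _ := by ring

theorem sum_mul_half_pow (n : ℕ) : ∑ i ∈ Finset.range n, (i : ℝ) / 2 ^ i ≤ 2 := by
  have h : ∑ i ∈ Finset.range n, (i : ℝ) / 2 ^ i = 2 - 2 * (n + 1) / 2 ^ n := by
    induction n with
    | zero => simp
    | succ n ih => rw [Finset.sum_range_succ, ih]; push_cast; field_simp; ring
  rw [h]
  have : (0 : ℝ) ≤ 2 * (n + 1) / 2 ^ n := by positivity
  linarith

/-- The constant in the bound for the blocks of the queued jobs. -/
noncomputable def queueConst : ℝ := 123 * chainConst

/-- The product `h * t` is split into squares. The sum of `h ^ 2` is controlled by the draws. The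
top level `t` is attained among the last `chainLen` writes, so `t ^ 2` is at most the sum of their
squared levels; as high levels are geometrically rare, that sum is of the order of the total chain
length. The constant in `queueConst` is `3 + 120`, one summand for each of these two parts. -/
theorem sum_chain_le {c τ G J : ℕ} {A ν : ℝ} (hf : GoodFill requests d c τ G A fill)
    (hd : GoodDraws requests J τ ν d) (hA : 0 ≤ A) (hτ : 4096 * τ ≤ 2 ^ P.m) {T E : ℕ}
    (hT : T ≤ requests.length) (hE : E ≤ requests.length * c) {b : Part P → ℕ}
    (hb : ∀ p, b p = 0 ∨ ∃ h t T₀ E₀, T₀ ≤ T ∧ E₀ ≤ E ∧ b p ≤ h + h * (t + 1) ∧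
      T + E ≤ T₀ + E₀ + h * τ ∧ (schedule P requests d fill η).cnt p T E =
        (schedule P requests d fill η).cnt p T₀ E₀ + h ∧
      ∃ i < h, t ≤ ((schedule P requests d fill η).lev p
        ((schedule P requests d fill η).cnt p T₀ E₀ + i) : ℕ)) :
    ∑ p, (b p : ℝ) ≤ queueConst * 2 ^ P.m + A * (P.m + 1) ^ 2 := by
  set σ := schedule P requests d fill η with hσ
  set y : Part P → ℕ := chainLen requests d τ T with hy
  have hn : 0 < 2 ^ P.m := by positivity
  have hpt : ∀ p, b p ≤ 3 * y p ^ 2 +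
      ∑ j ∈ Finset.Ico (σ.cnt p T E - y p) (σ.cnt p T E), (σ.lev p j : ℕ) ^ 2 := by
    intro p
    rcases hb p with h0 | ⟨h, t, T₀, E₀, hT₀, hE₀, hbp, hwait, hcnt, i, hi, ht⟩
    · omega
    -- Within `h * τ` steps the cyclic scan hits `p` at most `h * τ / 2 ^ m + 2 ≤ h / 2 + 2` times,
    -- so at least `h / 2 - 2` of the `h` writes are piggy-backed.
    have hqual : h ≤ 2 * hit (prevSet requests (T - h * τ) T) d p + 4 := by
      have p1 := schedule_pig_add (d := d) (fill := fill) (η := η) p hT₀ hT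
      rw [← hσ] at p1
      have p2 := hit_mono (prevSet_mono (requests := requests) (T := T)
        (show T - h * τ ≤ T₀ by omega)) d p
      have p3 := (seqCount_window p E₀ (E - E₀)).1
      rw [show E₀ + (E - E₀) = E by omega] at p3
      unfold Schedule.cnt at hcnt
      obtain ⟨s, hs⟩ : ∃ s, seqCount p E = seqCount p E₀ + s :=
        Nat.exists_eq_add_of_le (Nat.count_monotone _ hE₀)
      rw [hs, mul_add] at p3
      have p4 : 2 ^ P.m * s ≤ h * τ + 2 * 2 ^ P.m := by omega
      have p5 : 2 * s ≤ h + 4 := by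
        by_contra hcon
        have q1 : 2 ^ P.m * (h + 5) ≤ 2 ^ P.m * (2 * s) := Nat.mul_le_mul_left _ (by omega)
        have q2 : h * (4096 * τ) ≤ h * 2 ^ P.m := Nat.mul_le_mul_left _ hτ
        nlinarith
      omega
    have hhy : h ≤ y p := le_chainLen hT hqual
    have h1 : t ^ 2 ≤ ∑ j ∈ Finset.Ico (σ.cnt p T E - y p) (σ.cnt p T E), (σ.lev p j : ℕ) ^ 2 := by
      refine le_trans (Nat.pow_le_pow_left ht 2) ?_
      exact Finset.single_le_sum (f := fun j => (σ.lev p j : ℕ) ^ 2) (fun _ _ => Nat.zero_le _)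
        (Finset.mem_Ico.2 ⟨by omega, by omega⟩)
    have h2 : h + h * (t + 1) ≤ 3 * h ^ 2 + t ^ 2 := by
      have : h ≤ h ^ 2 := Nat.le_self_pow two_ne_zero h
      nlinarith [sq_nonneg ((h : ℤ) - t), two_mul_le_add_sq h t]
    have h3 : h ^ 2 ≤ y p ^ 2 := Nat.pow_le_pow_left hhy 2
    omega
  have hY2 : ∑ p, (y p : ℝ) ^ 2 ≤ chainConst * 2 ^ P.m :=
    hd.squares T hT y fun p => ⟨hd.short T hT p _ (chainLen_spec τ T p),
      Or.inr (chainLen_spec τ T p)⟩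
  have hY1 : ∑ p, (y p : ℝ) ≤ chainConst * 2 ^ P.m := by
    refine le_trans (Finset.sum_le_sum fun p _ => ?_) hY2
    exact_mod_cast Nat.le_self_pow two_ne_zero (y p)
  have hswap := sum_window_swap σ (fun i => 2 * i) (fun p => σ.cnt p T E - y p)
    (fun p => σ.cnt p T E) (fun l => (l : ℕ) ^ 2) (fun l => by
      rw [← Finset.sum_filter]
      have : (Finset.range (P.m + 1)).filter (fun i => i ≤ (l : ℕ)) = Finset.range ((l : ℕ) + 1) := by
        ext i; simp only [Finset.mem_filter, Finset.mem_range]; have := l.2; omega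
      rw [this, ← Finset.mul_sum, mul_comm 2, Finset.sum_range_id_mul_two, Nat.add_sub_cancel]
      nlinarith)
  have htail : ∀ i ∈ Finset.range (P.m + 1), ((2 * i : ℕ) : ℝ) *
      (∑ p, ((Finset.Ico (σ.cnt p T E - y p) (σ.cnt p T E)).filter
        fun j => i ≤ (σ.lev p j : ℕ)).card : ℕ) ≤
      60 * (chainConst * 2 ^ P.m) * (i / 2 ^ i) + 2 * i * A := by
    intro i hi
    rw [Finset.mem_range] at hi
    have h1 := hf.tails T E i hT hE (by omega)
    have h2 : ∀ p, ((Finset.Ico (σ.cnt p T E - y p) (σ.cnt p T E)).filter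
        fun j => i ≤ (σ.lev p j : ℕ)).card = multCount P.capacity i
      (fill p + (1 + (writes requests d p T E - y p))) (fill p + (1 + writes requests d p T E)) := by
      intro p
      rw [card_filter_lev p _ _ (by omega), schedule_cnt hT]
      rfl
    simp_rw [h2]
    rw [one_mul, mul_one] at h1
    have h3 : 4 * Real.exp 2 * (∑ p, (y p : ℝ)) / 2 ^ i ≤ 30 * (chainConst * 2 ^ P.m) / 2 ^ i := by
      have : 4 * Real.exp 2 ≤ 30 := by linarith [exp_two_le]
      gcongr
    calc _ ≤ ((2 * i : ℕ) : ℝ) * (30 * (chainConst * 2 ^ P.m) / 2 ^ i + A) := by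
          gcongr; linarith
      _ = _ := by push_cast; ring
  have hsum : ((∑ p, ∑ j ∈ Finset.Ico (σ.cnt p T E - y p) (σ.cnt p T E),
      (σ.lev p j : ℕ) ^ 2 : ℕ) : ℝ) ≤ 120 * (chainConst * 2 ^ P.m) + A * (P.m + 1) ^ 2 := by
    refine (Nat.cast_le.2 hswap).trans ?_
    rw [Nat.cast_sum]
    simp only [Nat.cast_mul (2 * _)]
    refine (Finset.sum_le_sum htail).trans ?_
    rw [Finset.sum_add_distrib, ← Finset.mul_sum, ← Finset.sum_mul, ← Finset.mul_sum]
    have h1 : (2 : ℝ) * ∑ i ∈ Finset.range (P.m + 1), (i : ℝ) ≤ (P.m + 1) ^ 2 := by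
      have := Finset.sum_range_id_mul_two (P.m + 1)
      rw [Nat.add_sub_cancel] at this
      have h2 : (∑ i ∈ Finset.range (P.m + 1), (i : ℝ)) * 2 = (P.m + 1) * P.m := by
        have h3 := congrArg (Nat.cast (R := ℝ)) this
        push_cast at h3
        exact h3
      nlinarith [Nat.cast_nonneg (α := ℝ) P.m]
    have hK : 0 ≤ chainConst * 2 ^ P.m := by unfold chainConst; positivity
    have h2 := mul_le_mul_of_nonneg_left (sum_mul_half_pow (P.m + 1))
      (show 0 ≤ 60 * (chainConst * 2 ^ P.m) by linarith)
    have h3 := mul_le_mul_of_nonneg_right h1 hA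
    linarith
  have hfin : ∑ p, (b p : ℝ) ≤ 3 * ∑ p, (y p : ℝ) ^ 2 +
      ((∑ p, ∑ j ∈ Finset.Ico (σ.cnt p T E - y p) (σ.cnt p T E), (σ.lev p j : ℕ) ^ 2 : ℕ) : ℝ) := by
    rw [Finset.mul_sum, Nat.cast_sum, ← Finset.sum_add_distrib]
    exact Finset.sum_le_sum fun p _ => by exact_mod_cast hpt p
  unfold queueConst
  linarith

/-- Good random choices give a good schedule. -/
theorem schedule_good {J τ G : ℕ} {ν A : ℝ} (hd : GoodDraws requests J τ ν d)
    (hf : GoodFill requests d P.maxEvict τ G A fill) (hη : GoodEvictions ν A η)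
    (hs : P.surplus ≤ 2 ^ P.m) (hτ : 4096 * τ ≤ 2 ^ P.m) (hν : 0 ≤ ν) (hA0 : 0 ≤ A)
    (hA : A ≤ 2 ^ P.m) (hG0 : 0 < G) (hGm : G ≤ P.m)
    (hb₁ : 360 * (P.m + 1) + 48 * Real.exp (2 * G) ≤ P.budget)
    (hb₂ : 48 * 2 ^ P.m * A / G + P.budget ≤ P.budget * τ) :
    (schedule P requests d fill η).Good requests.length (P.budget * τ) τ
      ⌊queueConst * 2 ^ P.m + A * (P.m + 1) ^ 2⌋₊ ⌊cacheConst ν * 2 ^ P.m⌋₊ := by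
  set σ := schedule P requests d fill η with hσ
  have hevs : σ.evs requests.length ≤ requests.length * P.maxEvict := by
    unfold Schedule.evs
    refine (Finset.sum_le_card_nsmul _ _ P.maxEvict fun s _ => ?_).trans_eq (by simp)
    simp only [hσ, schedule]
    split
    · exact Nat.le_of_lt_succ (η _).2
    · exact Nat.zero_le _
  refine ⟨?_, le_rfl, fun t ht p => ?_, fun T₀ E₀ T E h1 h2 h3 h4 => ?_,
    fun T hT E hE b hb => ?_, fun t ht L hL => ?_⟩
  · have h1 := Real.exp_pos (2 * G)
    have : ((P.m + 1 : ℕ) : ℝ) ≤ P.budget := by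
      push_cast; nlinarith [Nat.cast_nonneg (α := ℝ) P.m]
    exact_mod_cast this
  · refine le_trans (le_of_eq ?_) (hd.load t ht p)
    unfold hit
    rw [Finset.filter_image, Finset.card_image_of_injective _ (latest_injective ht)]
    congr 1
    ext v
    simp only [Finset.mem_filter, Finset.mem_univ, true_and, hσ, schedule_posAt ht]
  · have h5 := sched_le (η := η) hf hs hA0 hG0 hGm h1 h2 h3 (h4.trans hevs)
    have hw : (0 : ℝ) ≤ (T : ℝ) + E - (T₀ + E₀) := by
      have : (T₀ : ℝ) ≤ T := by exact_mod_cast h1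
      have : (E₀ : ℝ) ≤ E := by exact_mod_cast h3
      linarith
    have h6 := mul_le_mul_of_nonneg_left hb₁ hw
    rw [← hσ] at h5
    have h7 : (σ.sched T₀ E₀ T E : ℝ) + P.budget + P.budget * (T₀ + E₀) ≤
        P.budget * (T + E) + P.budget * τ := by
      nlinarith
    exact_mod_cast h7
  · have := sum_chain_le hf hd hA0 hτ hT (hE.trans hevs) hb
    apply Nat.le_floor
    push_cast
    exact this
  · have := schedule_cache hd hη hν hA ht hL
    apply Nat.le_floor
    push_cast
    exact this

end Deduce

end PartitionORAM

namespace PartitionORAM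
variable {P : Params}

/-! ### The failure probability -/

/-- The failure probability of `M` requests. -/
noncomputable def failure (P : Params) (M J : ℕ) (A : ℝ) : ℝ :=
  ((M + 1) * 2 ^ P.m * Real.exp (-((P.surplus : ℝ) ^ 2 / (4 * 2 ^ P.m))) +
    (M + 1) * 2 ^ P.m * (2 * M + 5) * Real.exp (16 - 3 * (J + 1)) +
    (M + 1) * Real.exp (-(2 ^ P.m / J)) + (M + 1) * Real.exp (-(2 ^ P.m))) +
  (2 * ((M + 1) * (M * P.maxEvict + 1)) ^ 2 * (P.m + 1) * Real.exp (-A) +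
    (M + 1) ^ 2 * Real.exp (-A))

/-- The bad events are peeled off in the order positions, fillings, eviction numbers; once all three
choices are good, the bad set does not meet the support. -/
theorem execution_not_fine_le (requests : List (Block P)) {J τ G : ℕ} {A : ℝ} (hJ : 0 < J)
    (hc : 1 ≤ P.maxEvict) (hq : 0 < P.ratio)
    (hs : P.surplus ≤ 2 ^ P.m) (hτ : 4096 * τ ≤ 2 ^ P.m) (hA0 : 0 ≤ A)
    (hA : A ≤ 2 ^ P.m) (hG0 : 0 < G) (hGm : G ≤ P.m)
    (hb₁ : 360 * (P.m + 1) + 48 * Real.exp (2 * G) ≤ P.budget)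
    (hb₂ : 48 * 2 ^ P.m * A / G + P.budget ≤ P.budget * τ) :
    (execution P requests).toOuterMeasure {tr | ¬ (tr.length = requests.length ∧ ∀ seg ∈ tr,
      (∀ s ∈ seg, Fine (P.budget * τ) ⌊queueConst * 2 ^ P.m + A * (P.m + 1) ^ 2⌋₊
        ⌊cacheConst (evictRate P.maxEvict P.ratio) * 2 ^ P.m⌋₊ s) ∧
      requestCost seg ≤ (2 + P.maxEvict) * P.budget)} ≤
    ENNReal.ofReal (failure P requests.length J A) := by
  have hν := evictRate_pos hc hq
  unfold failure
  rw [execution_eq, ENNReal.ofReal_add (by positivity) (by positivity)]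
  refine (toOuterMeasure_bind_le _ _ _ _ _ fun d hd => ?_).trans
    (add_le_add_left (not_goodDraws_le requests hJ hτ hν (evictRate_le_one _ _) hs) _)
  have hd' := not_not.1 hd
  rw [ENNReal.ofReal_add (by positivity) (by positivity)]
  refine (toOuterMeasure_bind_le _ _ _ _ _ fun fill hf => ?_).trans
    (add_le_add_left (not_goodFill_le d P.maxEvict τ G A) _)
  have hf' := not_not.1 hf
  refine (toOuterMeasure_bind_le _ _ _ _ 0 fun η hη => ?_).trans
    ((add_zero _).le.trans (not_goodEvictions_le requests.length P.maxEvict P.ratio A))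
  have hη' := not_not.1 hη
  have hgood := schedule_good hd' hf' hη' hs hτ hν.le hA0 hA hG0 hGm hb₁ hb₂
  refine (toOuterMeasure_eq_zero_of_support fun tr htr => ?_).le
  refine not_not.2 (runFrom_initial hgood (c := P.maxEvict) (fun t => ?_) fill (fun _ => rfl) htr)
  simp only [schedule]
  split
  · exact Nat.le_of_lt_succ (η _).2
  · exact Nat.zero_le _

theorem exp_neg_mul_le (A m : ℕ) : Real.exp (-((A * m : ℕ) : ℝ)) ≤ ((2 : ℝ) ^ m)⁻¹ ^ A := by
  refine (exp_neg_nat_le _).trans_eq ?_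
  rw [← inv_pow, ← pow_mul, mul_comm A m, one_div]

/-- Each term is at most a constant times `Q ^ 4 * n * x` with `n = √N`, `Q = M + 1` and `x = exp
(-A * m) ≤ n ^ (-A)`. As `Q ^ 4 ≤ 16 * n ^ (8 * k)`, and one more factor `n` absorbs the constant,
`A = 8 * k + 2 * a + 2` leaves `n ^ (-2 * a)`. -/
theorem failure_le {M k a : ℕ} (hM : (M : ℝ) ≤ ((4 : ℝ) ^ P.m) ^ k) {A : ℕ}
    (hA : A = 8 * k + 2 * a + 2) (hm : 0 < P.m)
    (hsur : 4 * A * P.m * 2 ^ P.m ≤ (P.surplus : ℝ) ^ 2)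
    (hpow : (A * P.m : ℝ) ^ 2 ≤ 2 ^ P.m)
    (hD : 16 * (5 * Real.exp 13 + 2 * (P.maxEvict + 1) ^ 2 + 4) ≤ (2 : ℝ) ^ P.m) :
    failure P M (A * P.m) (A * P.m : ℕ) ≤ 1 / ((4 : ℝ) ^ P.m) ^ a := by
  set n : ℝ := (2 : ℝ) ^ P.m with hn
  set Q : ℝ := (M : ℝ) + 1 with hQ
  set c : ℝ := (P.maxEvict : ℝ) with hc
  set x : ℝ := Real.exp (-((A * P.m : ℕ) : ℝ)) with hx
  have h4 : (4 : ℝ) ^ P.m = n ^ 2 := by rw [hn, ← pow_mul, mul_comm, pow_mul]; norm_num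
  have hn0 : 0 < n := by positivity
  have hn1 : 1 ≤ n := one_le_pow₀ (by norm_num)
  have hmn : (P.m : ℝ) + 1 ≤ n := by
    have : P.m + 1 ≤ 2 ^ P.m := Nat.lt_two_pow_self
    rw [hn]; exact_mod_cast this
  clear_value n
  have hQ1 : 1 ≤ Q := by rw [hQ]; linarith [Nat.cast_nonneg (α := ℝ) M]
  have hc0 : 0 ≤ c := Nat.cast_nonneg _
  have hx0 : 0 < x := Real.exp_pos _
  have hAm : (1 : ℝ) ≤ A * P.m := by
    have : 1 ≤ A * P.m := Nat.mul_pos (by omega) hm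
    exact_mod_cast this
  have f1 : Real.exp (-((P.surplus : ℝ) ^ 2 / (4 * n))) ≤ x := by
    apply Real.exp_le_exp.2
    rw [neg_le_neg_iff, le_div_iff₀ (by positivity)]
    push_cast
    linarith
  have f2 : Real.exp (16 - 3 * (((A * P.m : ℕ) : ℝ) + 1)) ≤ Real.exp 13 * x := by
    rw [hx, ← Real.exp_add]
    apply Real.exp_le_exp.2
    have := Nat.cast_nonneg (α := ℝ) (A * P.m)
    linarith
  have f3 : Real.exp (-(n / ((A * P.m : ℕ) : ℝ))) ≤ x := by
    apply Real.exp_le_exp.2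
    push_cast
    rw [neg_le_neg_iff, le_div_iff₀ (by linarith)]
    rw [← sq]; exact hpow
  have f4 : Real.exp (-n) ≤ x := by
    apply Real.exp_le_exp.2
    push_cast
    nlinarith
  have hQ2 : Q ≤ Q ^ 4 := le_self_pow₀ hQ1 (by norm_num)
  have hQ3 : Q ^ 2 ≤ Q ^ 4 := pow_le_pow_right₀ hQ1 (by norm_num)
  have g1 : Q * n * Real.exp (-((P.surplus : ℝ) ^ 2 / (4 * n))) ≤ Q ^ 4 * n * x := by gcongr
  have g2 : Q * n * (2 * M + 5) * Real.exp (16 - 3 * (((A * P.m : ℕ) : ℝ) + 1)) ≤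
      5 * Real.exp 13 * (Q ^ 4 * n * x) := by
    have : 2 * (M : ℝ) + 5 ≤ 5 * Q := by rw [hQ]; linarith [Nat.cast_nonneg (α := ℝ) M]
    calc _ ≤ Q * n * (5 * Q) * (Real.exp 13 * x) := by gcongr
      _ = 5 * Real.exp 13 * (Q ^ 2 * n * x) := by ring
      _ ≤ _ := by gcongr
  have g3 : Q * Real.exp (-(n / ((A * P.m : ℕ) : ℝ))) ≤ Q ^ 4 * n * x := by
    calc _ ≤ Q ^ 4 * x := by gcongr
      _ ≤ Q ^ 4 * n * x := by gcongr; exact le_mul_of_one_le_right (by positivity) hn1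
  have g4 : Q * Real.exp (-n) ≤ Q ^ 4 * n * x := by
    calc _ ≤ Q ^ 4 * x := by gcongr
      _ ≤ Q ^ 4 * n * x := by gcongr; exact le_mul_of_one_le_right (by positivity) hn1
  have g5 : 2 * (Q * (M * c + 1)) ^ 2 * (P.m + 1) * x ≤ 2 * (c + 1) ^ 2 * (Q ^ 4 * n * x) := by
    have h1 : (M : ℝ) * c + 1 ≤ (c + 1) * Q := by
      rw [hQ]; nlinarith [Nat.cast_nonneg (α := ℝ) M]
    calc _ ≤ 2 * (Q * ((c + 1) * Q)) ^ 2 * n * x := by gcongr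
      _ = _ := by ring
  have g6 : Q ^ 2 * x ≤ Q ^ 4 * n * x := by
    calc _ ≤ Q ^ 4 * x := by gcongr
      _ ≤ Q ^ 4 * n * x := by gcongr; exact le_mul_of_one_le_right (by positivity) hn1
  have hQn : Q ^ 4 ≤ 16 * n ^ (8 * k) := by
    have h1 : Q ≤ 2 * n ^ (2 * k) := by
      have : (1 : ℝ) ≤ n ^ (2 * k) := one_le_pow₀ hn1
      rw [h4, ← pow_mul] at hM
      rw [hQ]; linarith
    calc Q ^ 4 ≤ (2 * n ^ (2 * k)) ^ 4 := by gcongr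
      _ = 16 * n ^ (8 * k) := by rw [mul_pow, ← pow_mul]; norm_num; ring
  have hxn : x ≤ n⁻¹ ^ A := by rw [hx, hn]; exact exp_neg_mul_le A P.m
  have key : (5 * Real.exp 13 + 2 * (c + 1) ^ 2 + 4) * (Q ^ 4 * n * x) ≤ 1 / (n ^ 2) ^ a := by
    have hD' : 5 * Real.exp 13 + 2 * (c + 1) ^ 2 + 4 ≤ n / 16 := by linarith
    calc _ ≤ n / 16 * (16 * n ^ (8 * k) * n * n⁻¹ ^ A) := by gcongr
      _ = n ^ (8 * k + 2) * n⁻¹ ^ A := by ring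
      _ = 1 / (n ^ 2) ^ a := by
        rw [hA, ← pow_mul, show 8 * k + 2 * a + 2 = (8 * k + 2) + 2 * a by ring, pow_add n⁻¹,
          ← mul_assoc, ← mul_pow, mul_inv_cancel₀ hn0.ne', one_pow, one_mul, inv_pow, one_div]
  rw [h4]
  refine le_trans ?_ key
  unfold failure
  rw [← hn, ← hQ, ← hc, ← hx]
  linarith

/-! ### Storage -/

theorem partitionSlots_le (hs : P.surplus ≤ 2 ^ P.m) : partitionSlots P ≤ 12 * 2 ^ P.m := by
  refine le_trans ?_ (jobWork_le hs (Fin.last P.m))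
  unfold jobWork partitionSlots
  have : Finset.Iic (Fin.last P.m) = Finset.univ := by
    ext i; simp [Fin.le_last]
  rw [this]
  exact Nat.le_add_right _ _

theorem slots_last_le (hs : P.surplus ≤ 2 ^ P.m) : slots P (Fin.last P.m) ≤ 4 * 2 ^ P.m := by
  simp only [slots, half, Fin.val_last, if_true, Params.capacity]
  omega

theorem serverBlocks_le {s : State P} (h : s.LayoutSuffices) (hs : P.surplus ≤ 2 ^ P.m) :
    s.serverBlocks ≤ 12 * 4 ^ P.m := by
  have h1 : s.serverBlocks = ∑ _p : Part P, partitionSlots P :=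
    Finset.sum_congr rfl fun p _ => Finset.sum_congr rfl fun l _ => max_eq_left (h.1 p l)
  rw [h1, Finset.sum_const, Finset.card_univ, Fintype.card_fin, smul_eq_mul]
  calc 2 ^ P.m * partitionSlots P ≤ 2 ^ P.m * (12 * 2 ^ P.m) :=
        Nat.mul_le_mul_left _ (partitionSlots_le hs)
    _ = 12 * (2 * 2) ^ P.m := by rw [mul_pow]; ring
    _ = _ := by norm_num

/-- The position map dominates: partition, level and offset take about `3 * m` bits per block,
within `4 * m = 2 * log₂ N`. The client blocks with their identifiers, the read bits and the tables
have lower order or contribute to the constant. -/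
theorem clientBits_le {s : State P} {K : ℝ} (hs : P.surplus ≤ 2 ^ P.m)
    (hm : (P.m + 1) * (P.m + 5) ≤ 2 ^ P.m) (hb : (s.clientBlocks : ℝ) ≤ K * 2 ^ P.m)
    (hq : s.queue.length ≤ 2 ^ P.m) (B κ : ℕ) :
    (s.clientBits B κ : ℝ) ≤ 4 ^ P.m * (4 * P.m + (K + 40)) + (K + 40) * 2 ^ P.m * B +
      2 ^ P.m * (P.m + 1) * κ := by
  have hpm : ∀ j, (2 : ℕ) ^ (P.m + j) = 2 ^ j * 2 ^ P.m := fun j => by rw [pow_add, mul_comm]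
  have hmn : P.m + 1 ≤ 2 ^ P.m := Nat.lt_two_pow_self
  have c1 : Nat.clog 2 (4 ^ P.m) ≤ 2 * P.m := Nat.clog_le_of_le_pow (by rw [pow_mul]; norm_num)
  have c2 : Nat.clog 2 (2 ^ P.m) ≤ P.m := Nat.clog_le_of_le_pow le_rfl
  have c3 : Nat.clog 2 (P.m + 1) ≤ P.m := Nat.clog_le_of_le_pow hmn
  have hsl := slots_last_le hs
  have hps := partitionSlots_le hs
  have c4 : Nat.clog 2 (slots P (Fin.last P.m)) ≤ P.m + 2 := Nat.clog_le_of_le_pow (by rw [hpm]; omega)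
  have c5 : Nat.clog 2 (slots P (Fin.last P.m) + 1) ≤ P.m + 3 :=
    Nat.clog_le_of_le_pow (by rw [hpm]; omega)
  have c6 : Nat.clog 2 P.capacity ≤ P.m + 1 :=
    Nat.clog_le_of_le_pow (by rw [hpm, Params.capacity]; omega)
  have c7 : Nat.clog 2 (2 * partitionSlots P + 1) ≤ P.m + 5 :=
    Nat.clog_le_of_le_pow (by rw [hpm]; omega)
  have hN : (4 : ℕ) ^ P.m = 2 ^ P.m * 2 ^ P.m := by rw [← mul_pow]; norm_num
  have key : s.clientBits B κ ≤ s.clientBlocks * (B + 2 * P.m) + 4 ^ P.m * (P.m + P.m + (P.m + 2)) +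
      2 ^ P.m * (12 * 2 ^ P.m) + 2 ^ P.m * (P.m + 1) * (κ + (P.m + 3) + 2) + 2 ^ P.m * (P.m + 1) + P.m +
      2 ^ P.m * (P.m + P.m) + (P.m + P.m + (P.m + 5) + 12 * 2 ^ P.m) := by
    unfold State.clientBits
    gcongr
  have keyr : (s.clientBits B κ : ℝ) ≤ s.clientBlocks * (B + 2 * P.m) + 4 ^ P.m * (P.m + P.m + (P.m + 2)) +
      2 ^ P.m * (12 * 2 ^ P.m) + 2 ^ P.m * (P.m + 1) * (κ + (P.m + 3) + 2) + 2 ^ P.m * (P.m + 1) + P.m +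
      2 ^ P.m * (P.m + P.m) + (P.m + P.m + (P.m + 5) + 12 * 2 ^ P.m) := by exact_mod_cast key
  have hNr : (4 : ℝ) ^ P.m = 2 ^ P.m * 2 ^ P.m := by exact_mod_cast hN
  have hmr : ((P.m : ℝ) + 1) * (P.m + 5) ≤ 2 ^ P.m := by exact_mod_cast hm
  rw [hNr] at keyr ⊢
  set n : ℝ := (2 : ℝ) ^ P.m with hn
  clear_value n
  have hm0 : (0 : ℝ) ≤ P.m := Nat.cast_nonneg _
  have hn1 : 1 ≤ n := by nlinarith
  have h2m : 2 * (P.m : ℝ) ≤ n := by nlinarith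
  have hK : 0 ≤ K * n := le_trans (Nat.cast_nonneg _) hb
  have t1 : (s.clientBlocks : ℝ) * (B + 2 * P.m) ≤ K * n * B + K * n * n := by
    calc _ ≤ K * n * (B + n) := by gcongr
      _ = _ := by ring
  have t2 : n * (P.m + 1) * (P.m + 3 + 2) ≤ n * n := by
    calc _ = n * ((P.m + 1) * (P.m + 5)) := by ring
      _ ≤ _ := by gcongr
  have t3 : n * ((P.m : ℝ) + 1) ≤ n * n := by gcongr; nlinarith
  have t4 : (P.m : ℝ) ≤ n * n := by nlinarith
  have t5 : n * ((P.m : ℝ) + P.m) ≤ n * n := by gcongr; linarith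
  have t6 : (P.m : ℝ) + P.m + (P.m + 5) + 12 * n ≤ 13 * (n * n) := by nlinarith
  have t7 : 0 ≤ n * n * P.m := by positivity
  have t8 : 0 ≤ n * B := by positivity
  have t9 : 0 ≤ n * n := by positivity
  nlinarith

end PartitionORAM

namespace PartitionORAM

/-! ### Asymptotics of the parameters -/

theorem eventually_surplus_le {surplus : ℕ → ℕ}
    (h : (fun m : ℕ => (surplus m : ℝ)) =o[atTop] (fun m : ℕ => Real.sqrt ((4 : ℝ) ^ m))) :
    ∀ᶠ m in atTop, surplus m ≤ 2 ^ m := by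
  filter_upwards [h.bound one_pos] with m hm
  have hsq : Real.sqrt ((4 : ℝ) ^ m) = 2 ^ m := by
    rw [show (4 : ℝ) ^ m = (2 ^ m) ^ 2 by rw [← pow_mul, mul_comm, pow_mul]; norm_num]
    exact Real.sqrt_sq (by positivity)
  rw [hsq, one_mul, Real.norm_natCast, Real.norm_of_nonneg (by positivity)] at hm
  exact_mod_cast hm

/-- Squaring the lower bound on the surplus gives `ε ^ 2 ≥ D * √N * log₂ √N` for every constant `D`,
so the Chernoff exponent `ε ^ 2 / (4 * √N)` of the partition loads beats any power of `N`. -/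
theorem eventually_le_surplus_sq {surplus : ℕ → ℕ}
    (h : (fun m : ℕ => ((4 : ℝ) ^ m) ^ (1 / 4 : ℝ) * Real.sqrt (Real.log ((4 : ℝ) ^ m)))
        =o[atTop] (fun m : ℕ => (surplus m : ℝ))) {D : ℝ} (hD : 0 < D) :
    ∀ᶠ m : ℕ in atTop, D * m * 2 ^ m ≤ (surplus m : ℝ) ^ 2 := by
  filter_upwards [h.bound (show 0 < 1 / Real.sqrt D by positivity)] with m hm
  have hlog : Real.log ((4 : ℝ) ^ m) = m * Real.log 4 := Real.log_pow _ _
  have hlog4 : 1 ≤ Real.log 4 := by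
    rw [Real.le_log_iff_exp_le (by norm_num)]
    linarith [Real.exp_one_lt_d9]
  rw [Real.norm_natCast, Real.norm_of_nonneg (by positivity)] at hm
  have h2 := pow_le_pow_left₀ (by positivity) hm 2
  have h4 : (((4 : ℝ) ^ m) ^ (1 / 4 : ℝ)) ^ 2 = 2 ^ m := by
    rw [← Real.rpow_natCast, ← Real.rpow_mul (by positivity), ← Real.rpow_natCast,
      ← Real.rpow_mul (by norm_num), show (4 : ℝ) = 2 ^ (2 : ℝ) by norm_num,
      ← Real.rpow_mul (by norm_num), ← Real.rpow_natCast]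
    congr 1
    push_cast
    ring
  rw [mul_pow, mul_pow, h4, Real.sq_sqrt (by rw [hlog]; positivity), div_pow, one_pow,
    Real.sq_sqrt hD.le, hlog, one_div, inv_mul_eq_div, le_div_iff₀ hD] at h2
  refine le_trans ?_ h2
  have : (m : ℝ) ≤ m * Real.log 4 := le_mul_of_one_le_right (Nat.cast_nonneg _) hlog4
  calc D * m * 2 ^ m = 2 ^ m * m * D := by ring
    _ ≤ _ := by gcongr

theorem eventually_const_mul_pow_le (D : ℝ) (j : ℕ) :
    ∀ᶠ m : ℕ in atTop, D * (m : ℝ) ^ j ≤ 2 ^ m := by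
  have h := isLittleO_pow_const_const_pow_of_one_lt (R := ℝ) j (one_lt_two : (1 : ℝ) < 2)
  filter_upwards [h.bound (show 0 < 1 / (|D| + 1) by positivity)] with m hm
  rw [Real.norm_of_nonneg (by positivity), Real.norm_of_nonneg (by positivity), one_div,
    inv_mul_eq_div, le_div_iff₀ (by positivity)] at hm
  refine le_trans ?_ hm
  rw [mul_comm]
  gcongr
  linarith [le_abs_self D]

theorem cacheConst_nonneg {ν : ℝ} (hν : 0 < ν) : 0 ≤ cacheConst ν := by
  have h : Real.exp (-(2 * (ν / 4) ^ 2)) ≤ 1 :=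
    Real.exp_le_one_iff.2 (neg_nonpos.2 (by positivity))
  have h1 : 0 ≤ Real.exp 5 / (1 - Real.exp (-(2 * (ν / 4) ^ 2))) :=
    div_nonneg (Real.exp_pos _).le (by linarith)
  unfold cacheConst
  positivity

/-- The bounds for a state whose queue and cache slots are small. -/
theorem Fine.bounds {P : Params} {A δ γ τ : ℕ} {ν C K : ℝ} {s : State P}
    (h : Fine (P.budget * τ) δ γ s)
    (hδ : (δ : ℝ) ≤ queueConst * 2 ^ P.m + (A * P.m : ℕ) * (P.m + 1) ^ 2)
    (hγ : (γ : ℝ) ≤ cacheConst ν * 2 ^ P.m)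
    (hs : P.surplus ≤ 2 ^ P.m) (hτ : 4096 * τ ≤ 2 ^ P.m) (hm : 3 ≤ P.m) (hA : 1 ≤ A)
    (hpow : 16 * (A : ℝ) ^ 2 * (P.m : ℝ) ^ 3 ≤ 2 ^ P.m)
    (hC : 12 ≤ C) (hK : cacheConst ν + 2 * queueConst + 60 + P.workRate ≤ K) (hK1 : P.workRate ≤ K)
    (hK2 : 1 ≤ K) (B κ : ℕ) (hB : 1 ≤ B) :
    (s.backlog : ℝ) ≤ K * Real.sqrt (4 ^ P.m) * Real.logb 2 (4 ^ P.m) ∧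
    (s.clientBits B κ : ℝ) ≤ ((2 * Real.logb 2 (4 ^ P.m) + K) / B
      + K / Real.sqrt (4 ^ P.m) * (1 + κ * Real.logb 2 (4 ^ P.m) / B)) * 4 ^ P.m * B ∧
    (s.serverBlocks : ℝ) ≤ C * 4 ^ P.m ∧ s.LayoutSuffices := by
  have h4 : (4 : ℝ) ^ P.m = (2 ^ P.m) ^ 2 := by rw [← pow_mul, mul_comm, pow_mul]; norm_num
  have hsq : Real.sqrt ((4 : ℝ) ^ P.m) = 2 ^ P.m := by
    rw [h4]; exact Real.sqrt_sq (by positivity)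
  have hlog : Real.logb 2 ((4 : ℝ) ^ P.m) = 2 * P.m := by
    rw [h4, ← pow_mul, Real.logb_pow, Real.logb_self_eq_one (by norm_num)]
    push_cast; ring
  have hmr : (3 : ℝ) ≤ P.m := by exact_mod_cast hm
  have hAr : (1 : ℝ) ≤ A := by exact_mod_cast hA
  have hBr : (1 : ℝ) ≤ B := by exact_mod_cast hB
  have hn : (0 : ℝ) < 2 ^ P.m := by positivity
  have hA2 : (A : ℝ) ≤ (A : ℝ) ^ 2 := le_self_pow₀ hAr (by norm_num)
  have hn1 : (1 : ℝ) ≤ 2 ^ P.m := one_le_pow₀ (by norm_num)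
  rw [hsq, hlog]
  refine ⟨?_, ?_, ?_, h.layout⟩
  · have hτr : (4096 : ℝ) * τ ≤ 2 ^ P.m := by exact_mod_cast hτ
    have h1 : (s.backlog : ℝ) ≤ P.workRate * (2 * P.m) * τ := by
      have := h.backlog
      unfold Params.budget at this
      exact_mod_cast this
    calc (s.backlog : ℝ) ≤ P.workRate * (2 * P.m) * τ := h1
      _ ≤ K * (2 * P.m) * 2 ^ P.m := by
        gcongr
        linarith [Nat.cast_nonneg (α := ℝ) τ]
      _ = _ := by ring
  · have hpow2 : ((A * P.m : ℕ) : ℝ) * (P.m + 1) ^ 2 ≤ 2 ^ P.m := by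
      refine le_trans ?_ hpow
      push_cast
      have h1 : ((P.m : ℝ) + 1) ^ 2 ≤ 4 * (P.m : ℝ) ^ 2 := by nlinarith
      calc (A : ℝ) * P.m * (P.m + 1) ^ 2 ≤ (A : ℝ) ^ 2 * P.m * (4 * (P.m : ℝ) ^ 2) := by gcongr
        _ = 4 * ((A : ℝ) ^ 2 * (P.m : ℝ) ^ 3) := by ring
        _ ≤ _ := by
          have : 0 ≤ (A : ℝ) ^ 2 * (P.m : ℝ) ^ 3 := by positivity
          linarith
    have hm5 : (P.m + 1) * (P.m + 5) ≤ 2 ^ P.m := by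
      have : ((P.m : ℝ) + 1) * (P.m + 5) ≤ 2 ^ P.m := by
        refine le_trans ?_ hpow
        have h1 : ((P.m : ℝ) + 1) * (P.m + 5) ≤ 16 * (P.m : ℝ) ^ 2 := by nlinarith
        have h2 : (P.m : ℝ) ^ 2 ≤ (P.m : ℝ) ^ 3 := pow_le_pow_right₀ (by linarith) (by norm_num)
        have h3 : (P.m : ℝ) ^ 3 ≤ (A : ℝ) ^ 2 * (P.m : ℝ) ^ 3 :=
          le_mul_of_one_le_left (by positivity) (by linarith)
        linarith
      exact_mod_cast this
    have hcb : (s.clientBlocks : ℝ) ≤ (cacheConst ν + 2 * queueConst + 11) * 2 ^ P.m := by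
      have h1 : (s.clientBlocks : ℝ) ≤ γ + 1 + 2 * δ + 2 * (4 * 2 ^ P.m) := by
        have := h.client.trans (Nat.add_le_add_left (Nat.mul_le_mul_left 2 (slots_last_le hs)) _)
        exact_mod_cast this
      linarith
    refine (clientBits_le hs hm5 hcb h.queue B κ).trans ?_
    have hB0 : (B : ℝ) ≠ 0 := by positivity
    have e : ((2 * (2 * (P.m : ℝ)) + K) / B + K / 2 ^ P.m * (1 + κ * (2 * P.m) / B)) * 4 ^ P.m * B =
        4 ^ P.m * (4 * P.m + K) + K * 2 ^ P.m * B + 2 ^ P.m * (K * (2 * P.m)) * κ := by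
      rw [h4]; field_simp; ring
    rw [e]
    have hw0 : (0 : ℝ) ≤ P.workRate := Nat.cast_nonneg _
    gcongr
    · linarith
    · linarith
    · nlinarith
  · have := serverBlocks_le h.layout hs
    have h1 : (s.serverBlocks : ℝ) ≤ 12 * 4 ^ P.m := by exact_mod_cast this
    refine h1.trans ?_
    gcongr

end PartitionORAM
-- Choice of the constants and conclusion.
theorem mainTheorem2
    (maxEvict : ℕ) (hmax : 1 ≤ maxEvict)
    (ratio : ℝ≥0) (hratio₀ : 0 < ratio) (hratio₁ : ratio < 1)
    (surplus : ℕ → ℕ)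
    (hsurplus_lower :
      (fun m : ℕ => ((4 : ℝ) ^ m) ^ (1 / 4 : ℝ) * Real.sqrt (Real.log ((4 : ℝ) ^ m)))
        =o[atTop] (fun m : ℕ => (surplus m : ℝ)))
    (hsurplus_upper :
      (fun m : ℕ => (surplus m : ℝ)) =o[atTop] (fun m : ℕ => Real.sqrt ((4 : ℝ) ^ m))) :
    ∃ w₀ : ℕ, ∀ w : ℕ, w₀ ≤ w →
    ∃ C : ℝ, ∀ k a : ℕ, ∃ K : ℝ, ∃ m₀ : ℕ, ∀ m : ℕ, m₀ ≤ m →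
    ∀ (N : ℝ), N = (4 : ℝ) ^ m →
    ∀ (P : PartitionORAM.Params), P = ⟨m, surplus m, maxEvict, ratio, w⟩ →
    ∀ requests : List (PartitionORAM.Block P), (requests.length : ℝ) ≤ N ^ k →
    ∀ B κ : ℕ, 1 ≤ B →
      ENNReal.ofReal (1 - 1 / N ^ a) ≤
        (PartitionORAM.execution P requests).toOuterMeasure
          {tr |
            -- worst-case cost
            (∀ seg ∈ tr, (PartitionORAM.requestCost seg : ℝ) ≤ C * Real.logb 2 N) ∧
            -- amortized cost
            ((tr.map PartitionORAM.requestCost).sum : ℝ) ≤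
              C * Real.logb 2 N * requests.length ∧
            ∀ seg ∈ tr, ∀ s ∈ seg,
              -- deferred work
              (s.backlog : ℝ) ≤ K * Real.sqrt N * Real.logb 2 N ∧
              -- client storage
              (s.clientBits B κ : ℝ) ≤
                ((2 * Real.logb 2 N + K) / B
                  + K / Real.sqrt N * (1 + κ * Real.logb 2 N / B)) * N * B ∧
              -- server storage
              (s.serverBlocks : ℝ) ≤ C * N ∧
              s.LayoutSuffices} := by
  -- With `w ≥ 400` the budget is at least `800 * m`, above the mean rate of the scheduled work,
  -- about `360 * m`. In `C`, a request has at most `maxEvict + 2` time steps of `w * log₂ N` blocks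
  -- each, and `12` is for the server storage.
  refine ⟨400, fun w hw => ⟨(maxEvict + 2) * w + 12, fun k a => ?_⟩⟩
  set ν := PartitionORAM.evictRate maxEvict ratio with hν
  set A : ℕ := 8 * k + 2 * a + 2 with hA
  -- Since `196608 = 48 * 4096`, the slack `48 * 2 ^ m * (A * m) / G` of `sched_le` equals `m * τ`
  -- when `4096 * τ = 2 ^ m`, whatever `A` is.
  set G : ℕ := 196608 * A with hG
  clear_value G A
  have hA0 : (0 : ℝ) < A := by rw [hA]; positivity
  refine ⟨|PartitionORAM.cacheConst ν| + 2 * |PartitionORAM.queueConst| + 60 + w, ?_⟩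
  refine eventually_atTop.1 ?_
  filter_upwards [PartitionORAM.eventually_surplus_le hsurplus_upper,
    PartitionORAM.eventually_le_surplus_sq hsurplus_lower (D := 4 * A) (by positivity),
    PartitionORAM.eventually_const_mul_pow_le (16 * (A : ℝ) ^ 2) 3,
    PartitionORAM.eventually_const_mul_pow_le
      (16 * (5 * Real.exp 13 + 2 * ((maxEvict : ℝ) + 1) ^ 2 + 4)) 0,
    eventually_ge_atTop G, eventually_ge_atTop 13,
    eventually_ge_atTop ⌈360 + 48 * Real.exp (2 * G)⌉₊] with m h1 h2 h3 h4 h5 h6 h7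
  intro N hN P hP requests hreq B κ hB
  subst hN
  have hPm : P.m = m := by rw [hP]
  have hPs : P.surplus = surplus m := by rw [hP]
  have hPe : P.maxEvict = maxEvict := by rw [hP]
  have hPr : P.ratio = ratio := by rw [hP]
  have hPw : P.workRate = w := by rw [hP]
  clear hP
  subst hPm hPe hPr hPw
  rw [← hPs] at h1 h2
  rw [pow_zero, mul_one] at h4
  have hm13 : (13 : ℝ) ≤ P.m := by exact_mod_cast h6
  have hwr : (400 : ℝ) ≤ P.workRate := by exact_mod_cast hw
  have hA1 : (1 : ℝ) ≤ A := by exact_mod_cast (by omega : 1 ≤ A)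
  have hAm2 : (A * P.m : ℝ) ^ 2 ≤ 2 ^ P.m := by
    refine le_trans ?_ h3
    have e1 : (P.m : ℝ) ^ 2 ≤ (P.m : ℝ) ^ 3 := pow_le_pow_right₀ (by linarith) (by norm_num)
    calc (A * P.m : ℝ) ^ 2 = (A : ℝ) ^ 2 * (P.m : ℝ) ^ 2 := mul_pow _ _ _
      _ ≤ (A : ℝ) ^ 2 * (P.m : ℝ) ^ 3 := by gcongr
      _ ≤ _ := by
        have : 0 ≤ (A : ℝ) ^ 2 * (P.m : ℝ) ^ 3 := by positivity
        linarith
  have hAm : ((A * P.m : ℕ) : ℝ) ≤ 2 ^ P.m := by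
    refine le_trans ?_ hAm2
    push_cast
    exact le_self_pow₀ (by nlinarith) (by norm_num)
  have hbud : (P.budget : ℝ) = P.workRate * (2 * P.m) := by
    unfold PartitionORAM.Params.budget; push_cast; rfl
  -- The choice is `τ = 2 ^ (m - 12)`; `m ≥ 13` makes it at least `2`, so that one budget fits into
  -- `budget * τ` beside the slack.
  obtain ⟨τ, hτ, hτ2⟩ : ∃ τ : ℕ, 4096 * τ = 2 ^ P.m ∧ (2 : ℝ) ≤ τ := by
    refine ⟨2 ^ (P.m - 12), ?_, ?_⟩
    · rw [show (4096 : ℕ) = 2 ^ 12 by norm_num, ← pow_add, Nat.add_sub_cancel' (by omega)]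
    · have : 2 ^ 1 ≤ 2 ^ (P.m - 12) := Nat.pow_le_pow_right two_pos (by omega)
      exact_mod_cast this
  have hτr : (4096 : ℝ) * τ = 2 ^ P.m := by exact_mod_cast hτ
  -- Both the longest chain `J` and the deviation are `A * m`, so that all failure terms are
  -- governed by the same `exp (-A * m)`.
  have hgood := PartitionORAM.execution_not_fine_le (P := P) requests (J := A * P.m)
    (τ := τ) (G := G) (A := (A * P.m : ℕ)) (Nat.mul_pos (by omega) (by omega)) hmax
    hratio₀ h1 hτ.le (Nat.cast_nonneg _) hAm (by omega) h5
    (by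
      have := Nat.le_of_ceil_le h7
      rw [hbud]
      nlinarith)
    (by
      have e1 : 48 * (2 : ℝ) ^ P.m * (A * P.m : ℕ) / G = P.m * τ := by
        rw [hG, ← hτr]; push_cast; field_simp; norm_num
      rw [e1, hbud]
      have e2 : (P.m : ℝ) * τ ≤
          P.workRate * P.m * τ := by
        gcongr
        exact le_mul_of_one_le_left (by positivity) (by linarith)
      have e3 : (P.workRate : ℝ) * P.m * 2 ≤ P.workRate * P.m * τ := by gcongr
      linarith)
  refine PartitionORAM.le_toOuterMeasure_of_compl (by positivity)
    (le_trans (MeasureTheory.measure_mono ?_) (hgood.trans (ENNReal.ofReal_le_ofReal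
        (PartitionORAM.failure_le hreq hA (by omega) (by linarith) hAm2 h4))))
  rintro tr htr ⟨hlen, hfine⟩
  refine htr ?_
  have hlog : Real.logb 2 ((4 : ℝ) ^ P.m) = 2 * P.m := by
    rw [show (4 : ℝ) = 2 ^ 2 by norm_num, ← pow_mul, Real.logb_pow,
      Real.logb_self_eq_one (by norm_num)]
    push_cast; ring
  have hcost : ∀ seg ∈ tr, (PartitionORAM.requestCost seg : ℝ) ≤
      ((P.maxEvict + 2) * P.workRate + 12) * Real.logb 2 ((4 : ℝ) ^ P.m) := by
    intro seg hseg
    have e1 : (PartitionORAM.requestCost seg : ℝ) ≤ (2 + P.maxEvict) * P.budget := by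
      exact_mod_cast (hfine seg hseg).2
    rw [hlog]
    rw [hbud] at e1
    linarith
  refine ⟨hcost, ?_, fun seg hseg s hs => ?_⟩
  · have e1 := List.sum_le_card_nsmul (tr.map fun seg => (PartitionORAM.requestCost seg : ℝ))
      (((P.maxEvict + 2) * P.workRate + 12) * Real.logb 2 ((4 : ℝ) ^ P.m)) (by
        intro x hx
        obtain ⟨seg, hseg, rfl⟩ := List.mem_map.1 hx
        exact hcost seg hseg)
    rw [List.length_map, hlen, nsmul_eq_mul, mul_comm] at e1
    refine le_trans (le_of_eq ?_) e1
    rw [Nat.cast_list_sum, List.map_map]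
    rfl
  · have hq0 : 0 ≤ PartitionORAM.queueConst := by
      unfold PartitionORAM.queueConst PartitionORAM.chainConst; positivity
    have hc1 := le_abs_self (PartitionORAM.cacheConst ν)
    have hc2 := abs_nonneg (PartitionORAM.cacheConst ν)
    have hq1 := abs_of_nonneg hq0
    have hcache : 0 ≤ PartitionORAM.cacheConst ν := PartitionORAM.cacheConst_nonneg
      (PartitionORAM.evictRate_pos hmax hratio₀)
    refine ((hfine seg hseg).1 s hs).bounds (A := A) (ν := ν) (Nat.floor_le (by positivity))
      (Nat.floor_le (by positivity)) h1 hτ.le (by omega) (by omega) h3 ?_ ?_ ?_ ?_ B κ hB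
    · have : (0 : ℝ) ≤ (P.maxEvict + 2) * P.workRate := by positivity
      linarith
    · rw [hq1]; linarith
    · rw [hq1]; linarith
    · rw [hq1]; linarith
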